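/- **Setting.** Let $T>0$, let $d,k$ be natural numbers, and let $|\cdot|$ be the Euclidean norm. For $N\in\mathbb N$ let $\mathcal D^N$ be the space of càdlàg functions $[0,T]\to\mathbb R^N$ with the $\sigma$-algebra generated by the coordinate maps, and let $\mathcal D^k_\uparrow\subseteq\mathcal D^k$ be the set of componentwise nondecreasing $A$ with $A_0\ge 0$ componentwise. For $A\in\mathcal D^k_\uparrow$ put $$\int_{[0,T]} x(t)\,dA_t=\sum_{i=1}^k\Big(x^i(0)A^i_0+\int_{(0,T]}x^i(t)\,dA^i_t\Big),$$ that is, $A_{0-}=0$. For a process $X$ let $\mathcal F^X_t=\sigma(X_s: s\le t)$ be its raw filtration, and let $\mathcal F^X_{t+}=\bigcap_{s>t}\mathcal F^X_s$ for $t<T$ and $\mathcal F^X_{T+}=\mathcal F^X_T$. Fix a probability measure $\mathbb P_0$ on $\mathcal D^d$. A probability measure $\mathbb P$ on $\mathcal D^d\times\mathcal D^k_\uparrow$, with coordinate process $(L,A)$, is *admissible*, written $\mathbb P\in\mathcal A$, if its $L$-marginal is $\mathbb P_0$ and if for each $t\in[0,T]$ the $\sigma$-algebras $\mathcal F^A_t$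 and $\mathcal F^L_T$ are $\mathbb P$-conditionally independent given $\mathcal F^L_{t+}$. Let $f:[0,T]\to[0,\infty)^k$ be continuous and let $g,h:\mathbb R^d\times[0,\infty)^k\to[0,\infty)$ be Borel measurable, such that $g(l,\cdot)$ and $h(l,\cdot)$ are convex and continuously differentiable on $[0,\infty)^k$ for each $l\in\mathbb R^d$. Write $\nabla g$ and $\nabla h$ for the gradients in the second variable. Put $$C(L,A)=\int_{[0,T]}f(t)\,dA_t+\int_0^T h(L_t,A_t)\,dt+g(L_T,A_T),\qquad V=\inf_{\mathbb P\in\mathcal A}\mathbb E^{\mathbb P}[C(L,A)].$$ **Corollary (existence for the Pontryagin FBSDE).** Suppose that 1. (linear coercivity) there are constants $\kappa,K>0$ such that $\mathbb E^{\mathbb P}[C(L,A)]\ge\kappa\,\mathbb E^{\mathbb P}[|A_T|]$ for all $\mathbb P\in\mathcal A$ with $\mathbb E^{\mathbb P}[|A_T|]\ge K$; 2. (gradient growth) there are Borel functions $\Phi_g,\Phi_h:\mathbb R^d\to[0,\infty)$ and a constant $M\ge 0$ such that $\mathbb E^{\mathbb P_0}\big[\int_0^T\Phi_h(L_t)\,dt+\Phi_g(L_T)\big]<\infty$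 and, for $\varphi\in\{g,h\}$, $$|\nabla\varphi(l,a)|\le\Phi_\varphi(l)+M\varphi(l,a)\quad\text{for all }(l,a)\in\mathbb R^d\times[0,\infty)^k;$$ 3. $V<\infty$. Then the Pontryagin FBSDE has a weak solution. That is, there is a probability measure $\tilde{\mathbb P}$ on $\mathcal D^{d}\times\mathcal D^k\times\mathcal D^k$, with coordinate process $(L,A,Y)$, such that * the law of $(L,A)$ under $\tilde{\mathbb P}$ is admissible (in particular $A\in\mathcal D^k_\uparrow$ a.s.); * $\tilde{\mathbb P}$-a.s., $Y_t\ge 0$ componentwise for all $t\in[0,T]$, and $\int_{[0,T]}Y_t\,dA_t=0$; * $\tilde{\mathbb P}$-a.s., $\int_0^T|\nabla h(L_t,A_t)|\,dt<\infty$; the $\mathbb R^k$-valued process $Y_t+\int_0^t\nabla h(L_s,A_s)\,ds-f(t)$, $t\in[0,T]$, is a $\tilde{\mathbb P}$-martingale with respect to the raw filtration $\mathcal F^{L,A,Y}$; and $Y_T=f(T)+\nabla g(L_T,A_T)$, $\tilde{\mathbb P}$-a.s. -/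

import Mathlib

open MeasureTheory ProbabilityTheory
open scoped ENNReal NNReal Topology

namespace MonotoneFollower

noncomputable section

/-- Euclidean space `ℝᴺ`, with the Euclidean norm. -/
abbrev E (N : ℕ) : Type := EuclideanSpace ℝ (Fin N)

/-- The closed orthant `[0,∞)ᵏ`. -/
def orthant (k : ℕ) : Set (E k) := {a | ∀ i, 0 ≤ a i}

/-- The time interval `[0,T]`. -/
abbrev Time (T : ℝ) : Type := Set.Icc (0 : ℝ) T

instance factNonneg (T : ℝ) [h : Fact (0 < T)] : Fact ((0 : ℝ) ≤ T) := ⟨h.out.le⟩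

/-- Lebesgue measure on `[0,T]`. -/
def leb (T : ℝ) : Measure (Time T) := (volume : Measure ℝ).comap Subtype.val

/-- Right-continuous with left limits. At the time `T` right-continuity is void, and at the time
`0` the existence of a left limit is void (the filters are trivial there). -/
def IsCadlag {T : ℝ} {N : ℕ} (x : Time T → E N) : Prop :=
  ∀ t, ContinuousWithinAt x (Set.Ici t) t ∧ ∃ l, Filter.Tendsto x (𝓝[<] t) (𝓝 l)

/-- The space of càdlàg paths `[0,T] → ℝᴺ`. -/
def Skorokhod (T : ℝ) (N : ℕ) : Type := {x : Time T → E N // IsCadlag x}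

/-- The space of càdlàg paths which are componentwise nondecreasing and nonnegative at `0`. -/
def IncSkorokhod (T : ℝ) [Fact (0 < T)] (k : ℕ) : Type :=
  {x : Time T → E k // IsCadlag x ∧ (∀ i, Monotone fun t => x t i) ∧ ∀ i, 0 ≤ x ⊥ i}

instance (T : ℝ) (N : ℕ) : CoeFun (Skorokhod T N) fun _ => Time T → E N := ⟨Subtype.val⟩

/-- The σ-algebra generated by the coordinate maps (the product σ-algebra, traced). -/
instance (T : ℝ) (N : ℕ) : MeasurableSpace (Skorokhod T N) :=
  MeasurableSpace.comap Subtype.val MeasurableSpace.pi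

theorem Skorokhod.measurable_eval {T : ℝ} {N : ℕ} (t : Time T) :
    Measurable fun x : Skorokhod T N => x t :=
  (measurable_pi_apply t).comp (comap_measurable Subtype.val)

section

variable {T : ℝ} [Fact (0 < T)]

instance (k : ℕ) : CoeFun (IncSkorokhod T k) fun _ => Time T → E k := ⟨Subtype.val⟩

/-- The σ-algebra generated by the coordinate maps. -/
instance (k : ℕ) : MeasurableSpace (IncSkorokhod T k) :=
  MeasurableSpace.comap Subtype.val MeasurableSpace.pi

theorem IncSkorokhod.measurable_eval {k : ℕ} (t : Time T) :
    Measurable fun x : IncSkorokhod T k => x t :=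
  (measurable_pi_apply t).comp (comap_measurable Subtype.val)

/-! ### Stieltjes integration against nondecreasing paths -/

/-- A component of a nondecreasing càdlàg path, as a Stieltjes function on `[0,T]`. -/
def IncSkorokhod.stieltjes {k : ℕ} (A : IncSkorokhod T k) (i : Fin k) :
    StieltjesFunction (Time T) where
  toFun t := A t i
  mono' := A.2.2.1 i
  right_continuous' t :=
    ((by fun_prop : Continuous fun a : E k => a i).continuousAt).comp_continuousWithinAt (A.2.1 t).1

/-- The measure `dAⁱ` on `[0,T]`: the Lebesgue-Stieltjes measure on `(0,T]` (Mathlib's measure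
gives no mass to the least point `0`), together with an atom of mass `Aⁱ₀` at `0`, corresponding
to the convention `Aⁱ₀₋ = 0`. -/
def IncSkorokhod.dMeasure {k : ℕ} (A : IncSkorokhod T k) (i : Fin k) : Measure (Time T) :=
  ENNReal.ofReal (A ⊥ i) • Measure.dirac ⊥ + (A.stieltjes i).measure

/-! ### The control problem -/

/-- The data `f, g, h` of a cost functional. The functions `g` and `h` matter only on
`ℝᵈ × [0,∞)ᵏ`. -/
structure CostData (T : ℝ) (d k : ℕ) where
  f : Time T → E k
  g : E d → E k → ℝ
  h : E d → E k → ℝ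
  f_continuous : Continuous f
  f_mem : ∀ t, f t ∈ orthant k
  g_measurable : Measurable fun p : E d × orthant k => g p.1 p.2
  h_measurable : Measurable fun p : E d × orthant k => h p.1 p.2
  g_nonneg : ∀ l, ∀ a ∈ orthant k, 0 ≤ g l a
  h_nonneg : ∀ l, ∀ a ∈ orthant k, 0 ≤ h l a
  g_convex : ∀ l, ConvexOn ℝ (orthant k) (g l)
  h_convex : ∀ l, ConvexOn ℝ (orthant k) (h l)

/-- The cost `C(L,A) = ∫_{[0,T]} f dA + ∫₀ᵀ h(L_t,A_t) dt + g(L_T,A_T)`, in `[0,∞]`. -/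
def CostData.cost {d k : ℕ} (c : CostData T d k) (L : Skorokhod T d) (A : IncSkorokhod T k) :
    ℝ≥0∞ :=
  (∑ i, ∫⁻ t, ENNReal.ofReal (c.f t i) ∂(A.dMeasure i))
    + (∫⁻ t, ENNReal.ofReal (c.h (L t) (A t)) ∂leb T)
    + ENNReal.ofReal (c.g (L ⊤) (A ⊤))

/-- The expected cost `J(P)`. -/
def CostData.expCost {d k : ℕ} (c : CostData T d k)
    (P : Measure (Skorokhod T d × IncSkorokhod T k)) : ℝ≥0∞ :=
  ∫⁻ ω, c.cost ω.1 ω.2 ∂P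

/-- The raw filtration generated by `L` on the space of pairs `(L,A)`. -/
def filtL (T : ℝ) [Fact (0 < T)] (d k : ℕ) :
    Filtration (Time T)
      (inferInstance : MeasurableSpace (Skorokhod T d × IncSkorokhod T k)) :=
  Filtration.natural (fun t ω => ω.1 t)
    fun t => ((Skorokhod.measurable_eval t).comp measurable_fst).stronglyMeasurable

/-- The raw filtration generated by `A` on the space of pairs `(L,A)`. -/
def filtA (T : ℝ) [Fact (0 < T)] (d k : ℕ) :
    Filtration (Time T)
      (inferInstance : MeasurableSpace (Skorokhod T d × IncSkorokhod T k)) :=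
  Filtration.natural (fun t ω => ω.2 t)
    fun t => ((IncSkorokhod.measurable_eval t).comp measurable_snd).stronglyMeasurable

/-- Conditionally on `m`, the σ-algebras `m₁` and `m₂` are `μ`-independent:
`μ(s ∩ t | m) = μ(s | m) μ(t | m)` a.s., for all `s ∈ m₁` and `t ∈ m₂`. -/
def CondIndependent {Ω : Type*} (m m₁ m₂ : MeasurableSpace Ω) {mΩ : MeasurableSpace Ω}
    (μ : Measure Ω) : Prop :=
  ∀ s t, MeasurableSet[m₁] s → MeasurableSet[m₂] t →
    μ⟦s ∩ t | m⟧ =ᵐ[μ] μ⟦s | m⟧ * μ⟦t | m⟧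

/-- `P` is an admissible control for the target law `P₀`. `Filtration.rightCont` is the
right-continuous enlargement `𝓕_{t+} = ⋂_{s>t} 𝓕_s`, with `𝓕_{T+} = 𝓕_T`. -/
structure Admissible {d k : ℕ} (P₀ : Measure (Skorokhod T d))
    (P : Measure (Skorokhod T d × IncSkorokhod T k)) : Prop where
  isProbabilityMeasure : IsProbabilityMeasure P
  marginal : P.map Prod.fst = P₀
  condIndep : ∀ t : Time T,
    CondIndependent ((filtL T d k).rightCont t) (filtA T d k t) (filtL T d k ⊤) P

/-- The value of the monotone-follower problem. -/
def CostData.value {d k : ℕ} (c : CostData T d k) (P₀ : Measure (Skorokhod T d)) : ℝ≥0∞ :=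
  ⨅ P : Measure (Skorokhod T d × IncSkorokhod T k), ⨅ _ : Admissible P₀ P, c.expCost P

/-- Linear coercivity of the cost functional. -/
def CostData.LinearlyCoercive {d k : ℕ} (c : CostData T d k) (P₀ : Measure (Skorokhod T d)) :
    Prop :=
  ∃ κ K : ℝ, 0 < κ ∧ 0 < K ∧
    ∀ P : Measure (Skorokhod T d × IncSkorokhod T k), Admissible P₀ P →
      ENNReal.ofReal K ≤ ∫⁻ ω, ‖ω.2 ⊤‖ₑ ∂P →
        ENNReal.ofReal κ * ∫⁻ ω, ‖ω.2 ⊤‖ₑ ∂P ≤ c.expCost P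

/-! ### The Pontryagin FBSDE -/

/-- `a ↦ φ(l,a)` is continuously differentiable on `[0,∞)ᵏ`, for each `l`. -/
def IsC1InControl {d k : ℕ} (φ : E d → E k → ℝ) : Prop :=
  ∀ l, ContDiffOn ℝ 1 (φ l) (orthant k)

/-- The gradient in the second variable, relative to `[0,∞)ᵏ`. -/
def grad {d k : ℕ} (φ : E d → E k → ℝ) (l : E d) (a : E k) : E k :=
  gradientWithin (φ l) (orthant k) a

/-- The growth condition on the gradients of `g` and `h`. -/
def CostData.GradientGrowth {d k : ℕ} (c : CostData T d k) (P₀ : Measure (Skorokhod T d)) :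
    Prop :=
  ∃ (Φg Φh : E d → ℝ≥0) (M : ℝ≥0), Measurable Φg ∧ Measurable Φh ∧
    (∫⁻ L, ((∫⁻ t, Φh (L t) ∂leb T) + Φg (L ⊤)) ∂P₀ < ∞) ∧
    (∀ l, ∀ a ∈ orthant k, ‖grad c.g l a‖ ≤ Φg l + M * c.g l a) ∧
    (∀ l, ∀ a ∈ orthant k, ‖grad c.h l a‖ ≤ Φh l + M * c.h l a)

/-- The space of triples `(L,A,Y)`. -/
abbrev Triple (T : ℝ) [Fact (0 < T)] (d k : ℕ) : Type :=
  Skorokhod T d × IncSkorokhod T k × Skorokhod T k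

/-- The raw filtration generated by `(L,A,Y)`. -/
def filtLAY (T : ℝ) [Fact (0 < T)] (d k : ℕ) :
    Filtration (Time T) (inferInstance : MeasurableSpace (Triple T d k)) :=
  Filtration.natural (fun t ω => (ω.1 t, ω.2.1 t, ω.2.2 t)) fun t =>
    (((Skorokhod.measurable_eval t).comp measurable_fst).prodMk
      (((IncSkorokhod.measurable_eval t).comp (measurable_fst.comp measurable_snd)).prodMk
        ((Skorokhod.measurable_eval t).comp
          (measurable_snd.comp measurable_snd)))).stronglyMeasurable

/-- `Q` is a weak solution of the Pontryagin FBSDE with data `c` and target law `P₀`. Since the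
`(L,A)`-marginal of a solution is carried by the paths with `A` nondecreasing and `A₀ ≥ 0`, the
measure `Q` is taken on the space of triples with such `A`. -/
structure IsPontryaginSolution {d k : ℕ} (c : CostData T d k) (P₀ : Measure (Skorokhod T d))
    (Q : Measure (Triple T d k)) : Prop where
  isProbabilityMeasure : IsProbabilityMeasure Q
  admissible : Admissible P₀ (Q.map fun ω => (ω.1, ω.2.1))
  nonneg : ∀ᵐ ω ∂Q, ∀ t i, 0 ≤ ω.2.2 t i
  reflection : ∀ᵐ ω ∂Q, ∑ i, ∫ t, ω.2.2 t i ∂(ω.2.1.dMeasure i) = 0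
  integrable_grad : ∀ᵐ ω ∂Q, Integrable (fun t => grad c.h (ω.1 t) (ω.2.1 t)) (leb T)
  martingale : Martingale
    (fun t ω => ω.2.2 t + (∫ s in Set.Iic t, grad c.h (ω.1 s) (ω.2.1 s) ∂leb T) - c.f t)
    (filtLAY T d k) Q
  terminal : ∀ᵐ ω ∂Q, ω.2.2 ⊤ = c.f ⊤ + grad c.g (ω.1 ⊤) (ω.2.1 ⊤)

end

end

end MonotoneFollower

/-! Fix an admissible `P` of finite cost and let the agent use any control on the canonical space of
`(L,A)` which is adapted to the augmented filtration. Its joint law with `L` is again admissible,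
and the cost is convex, so a Komlós-type argument together with linear coercivity and Fatou's lemma
gives a control `A` which is optimal on this space.

The directional derivative of the cost at `A` in a direction `b` is the mean of `∫ Γ db`, where
`Γ t = f t + ∇g (L T, A T) + ∫_t^T ∇h (L, A)` is the marginal cost of a push at the time `t`; the
growth condition provides the dominating function. Let `Y` be the càdlàg version of
`t ↦ E[Γ t | F t]`, which exists since the filtration is right-continuous. Pushing `A` up by a jump
at `t` shows `Y t ≥ 0`, and pulling it back along `-min(A,n)` shows that the mean of
`∫ Γ d(min(A,n))` is nonpositive. Along Riemann sums over dyadic partitions `Γ` may be replaced by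
`Y` in this mean, whence `∫ Y dA = 0`. Finally
`Y t + ∫_0^t ∇h (L, A) - f t = E[∇g (L T, A T) + ∫_0^T ∇h (L, A) | F t]`
is a martingale, and remains one in the smaller raw filtration of `(L,A,Y)`. -/

namespace MonotoneFollower

noncomputable section

open Filter Set

/-! ### Càdlàg paths and Stieltjes integrals -/

section PathsOnInterval

variable {T : ℝ} {N : ℕ}

theorem Skorokhod.measurable_iff {Ω : Type*} [MeasurableSpace Ω] {x : Ω → Skorokhod T N} :
    Measurable x ↔ ∀ t, Measurable fun ω => x ω t :=
  measurable_comap_iff.trans measurable_pi_iff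

theorem IsCadlag.exists_norm_le {x : Time T → E N} (hx : IsCadlag x) : ∃ R, ∀ t, ‖x t‖ ≤ R := by
  suffices h : ∃ R, ∀ t ∈ (univ : Set (Time T)), ‖x t‖ ≤ R by simpa using h
  refine isCompact_univ.induction_on (p := fun s => ∃ R, ∀ t ∈ s, ‖x t‖ ≤ R) ⟨0, by simp⟩ ?_ ?_ ?_
  · rintro s t hst ⟨R, hR⟩
    exact ⟨R, fun u hu => hR u (hst hu)⟩
  · rintro s t ⟨R, hR⟩ ⟨R', hR'⟩
    exact ⟨max R R', fun u hu => hu.elim (fun h => (hR u h).trans (le_max_left _ _))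
      (fun h => (hR' u h).trans (le_max_right _ _))⟩
  · intro t _
    obtain ⟨hright, l, hleft⟩ := hx t
    have bdd_right : ∀ᶠ s in 𝓝[≥] t, ‖x s‖ < ‖x t‖ + 1 :=
      hright.norm.eventually (gt_mem_nhds (lt_add_one _))
    have bdd_left : ∀ᶠ s in 𝓝[<] t, ‖x s‖ < ‖l‖ + 1 :=
      hleft.norm.eventually (gt_mem_nhds (lt_add_one _))
    refine ⟨{s | ‖x s‖ ≤ max (‖x t‖ + 1) (‖l‖ + 1)}, ?_, _, fun s hs => hs⟩
    rw [nhdsWithin_univ, ← nhdsLT_sup_nhdsGE]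
    exact ⟨bdd_left.mono fun s hs => hs.le.trans (le_max_right _ _),
      bdd_right.mono fun s hs => hs.le.trans (le_max_left _ _)⟩

theorem isCadlag_of_continuous {x : Time T → E N} (hx : Continuous x) : IsCadlag x :=
  fun t => ⟨hx.continuousWithinAt, x t, (hx.tendsto t).mono_left nhdsWithin_le_nhds⟩

theorem IsCadlag.map₂ {M K : ℕ} {x : Time T → E N} {y : Time T → E M} (hx : IsCadlag x)
    (hy : IsCadlag y) {F : E N → E M → E K} (hF : Continuous fun p : E N × E M => F p.1 p.2) :
    IsCadlag fun t => F (x t) (y t) := by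
  intro t
  obtain ⟨a, ha⟩ := (hx t).2
  obtain ⟨b, hb⟩ := (hy t).2
  exact ⟨hF.continuousAt.comp_continuousWithinAt ((hx t).1.prodMk (hy t).1), F a b,
    (hF.tendsto (a, b)).comp (ha.prodMk_nhds hb)⟩

theorem IsCadlag.map {K : ℕ} {x : Time T → E N} (hx : IsCadlag x) {F : E N → E K}
    (hF : Continuous F) : IsCadlag fun t => F (x t) :=
  hx.map₂ hx (F := fun a _ => F a) (hF.comp continuous_fst)

theorem leb_apply {s : Set (Time T)} (hs : MeasurableSet s) :
    leb T s = volume (Subtype.val '' s) :=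
  Measure.comap_apply _ Subtype.val_injective (fun _ hu => measurableSet_Icc.subtype_image hu) _ hs

instance : IsFiniteMeasure (leb T) :=
  ⟨by rw [leb_apply .univ, image_univ, Subtype.range_coe, Real.volume_Icc]
      exact ENNReal.ofReal_lt_top⟩

instance : NullSingletonClass (leb T) :=
  ⟨fun t => by simp [leb_apply (measurableSet_singleton t)]⟩

/-- The index of the least dyadic point of level `n` above `t`. -/
def gridIdx (n : ℕ) (t : Time T) : ℕ := ⌈(t : ℝ) * 2 ^ n / T⌉₊

theorem measurable_gridIdx (n : ℕ) : Measurable (gridIdx (T := T) n) :=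
  Nat.measurable_ceil.comp (f := fun t : Time T => (t : ℝ) * 2 ^ n / T) (by fun_prop)

end PathsOnInterval

section Paths

variable {T : ℝ} [hT : Fact (0 < T)] {k N : ℕ}

instance : (leb T).IsOpenPosMeasure := by
  refine ⟨fun U hU ⟨x, hx⟩ h0 => ?_⟩
  obtain ⟨V, hV, rfl⟩ := isOpen_induced_iff.1 hU
  rw [leb_apply hU.measurableSet, Subtype.image_preimage_coe, inter_comm] at h0
  have hx' : (x : ℝ) ∈ closure (Ioo 0 T) := by
    rw [closure_Ioo hT.out.ne]; exact x.2
  have hpos : 0 < volume (V ∩ Ioo 0 T) :=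
    (hV.inter isOpen_Ioo).measure_pos volume (mem_closure_iff.1 hx' V hV hx)
  exact hpos.ne' (measure_mono_null (inter_subset_inter_right _ Ioo_subset_Icc_self) h0)

theorem nhdsGT_neBot_of_lt_top {t : Time T} (ht : t < ⊤) : (𝓝[>] t).NeBot :=
  nhdsGT_neBot_of_exists_gt ⟨⊤, ht⟩

namespace IncSkorokhod

theorem measurable_iff {Ω : Type*} [MeasurableSpace Ω] {a : Ω → IncSkorokhod T k} :
    Measurable a ↔ ∀ t, Measurable fun ω => a ω t :=
  measurable_comap_iff.trans measurable_pi_iff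

variable (A : IncSkorokhod T k) (i : Fin k) (t : Time T)

theorem nonneg : 0 ≤ A t i := (A.2.2.2 i).trans (A.2.2.1 i bot_le)

theorem apply_le_apply_top : A t i ≤ A ⊤ i := A.2.2.1 i le_top

theorem mem_orthant : A t ∈ orthant k := fun i => A.nonneg i t

theorem dMeasure_Iic : A.dMeasure i (Iic t) = ENNReal.ofReal (A t i) := by
  have measure_bot : (A.stieltjes i).measure {⊥} = 0 := by
    rw [← botSet_eq_singleton_of_isBot isBot_bot]
    exact (A.stieltjes i).measure_botSet
  have measure_Iic : (A.stieltjes i).measure (Iic t) = ENNReal.ofReal (A t i - A ⊥ i) := by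
    rw [← Icc_bot, ← Ioc_union_left bot_le, measure_union (by simp) (measurableSet_singleton _),
      measure_bot, add_zero, StieltjesFunction.measure_Ioc]
    rfl
  rw [dMeasure, Measure.add_apply, Measure.smul_apply, measure_Iic,
    Measure.dirac_apply' _ measurableSet_Iic, indicator_of_mem (mem_Iic.2 bot_le), Pi.one_apply,
    smul_eq_mul, mul_one, ← ENNReal.ofReal_add (A.2.2.2 i) (sub_nonneg.2 (A.2.2.1 i bot_le)),
    add_sub_cancel]

theorem dMeasure_univ : A.dMeasure i univ = ENNReal.ofReal (A ⊤ i) := by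
  rw [← A.dMeasure_Iic, Iic_top]

instance : IsFiniteMeasure (A.dMeasure i) :=
  ⟨by rw [A.dMeasure_univ]; exact ENNReal.ofReal_lt_top⟩

theorem dMeasure_real_Iic : (A.dMeasure i).real (Iic t) = A t i := by
  rw [measureReal_def, A.dMeasure_Iic, ENNReal.toReal_ofReal (A.nonneg i t)]

theorem dMeasure_real_univ : (A.dMeasure i).real univ = A ⊤ i := by
  rw [← A.dMeasure_real_Iic, Iic_top]

variable {A i}

theorem dMeasure_eq_of_linear {B C : IncSkorokhod T k} {α β : ℝ} (hα : 0 ≤ α) (hβ : 0 ≤ β)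
    (h : ∀ t, C t i = α * A t i + β * B t i) :
    C.dMeasure i = ENNReal.ofReal α • A.dMeasure i + ENNReal.ofReal β • B.dMeasure i := by
  have : IsFiniteMeasure (ENNReal.ofReal α • A.dMeasure i + ENNReal.ofReal β • B.dMeasure i) :=
    ⟨by simp [ENNReal.mul_lt_top_iff]⟩
  refine Measure.ext_of_Iic _ _ fun t => ?_
  rw [Measure.add_apply, Measure.smul_apply, Measure.smul_apply, dMeasure_Iic, dMeasure_Iic,
    dMeasure_Iic, h, smul_eq_mul, smul_eq_mul, ENNReal.ofReal_add
      (mul_nonneg hα (A.nonneg i t)) (mul_nonneg hβ (B.nonneg i t)), ENNReal.ofReal_mul hα,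
    ENNReal.ofReal_mul hβ]

end IncSkorokhod

/-- The dyadic point `jT/2ⁿ` of `[0,T]`; for `j > 2ⁿ` it is `T`. -/
def gridPt (T : ℝ) [Fact (0 < T)] (n j : ℕ) : Time T :=
  projIcc 0 T (factNonneg T).out (T * j / 2 ^ n)

/-- The least dyadic point of level `n` above `t`. -/
def gridUp (n : ℕ) (t : Time T) : Time T := gridPt T n (gridIdx n t)

theorem gridIdx_le_iff {n j : ℕ} {t : Time T} : gridIdx n t ≤ j ↔ t ≤ gridPt T n j := by
  rw [gridIdx, Nat.ceil_le, div_le_iff₀ hT.out, gridPt, ← Subtype.coe_le_coe, coe_projIcc,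
    le_max_iff, le_min_iff, le_div_iff₀ (by positivity), mul_comm T]
  refine ⟨fun h => Or.inr ⟨t.2.2, h⟩, Or.rec (fun h => ?_) And.right⟩
  have := hT.out
  rw [le_antisymm h t.2.1, zero_mul]
  positivity

theorem le_gridUp (n : ℕ) (t : Time T) : t ≤ gridUp n t := gridIdx_le_iff.1 le_rfl

theorem gridPt_mono (n : ℕ) : Monotone (gridPt T n) := by
  intro i j hij
  have := hT.out
  exact monotone_projIcc _ (by gcongr)

theorem gridPt_zero (n : ℕ) : gridPt T n 0 = ⊥ := Subtype.ext (by simp [gridPt])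

theorem gridPt_pow (n : ℕ) : gridPt T n (2 ^ n) = ⊤ := Subtype.ext (by simp [gridPt])

theorem gridIdx_le (n : ℕ) (t : Time T) : gridIdx n t ≤ 2 ^ n := by
  rw [gridIdx_le_iff, gridPt_pow]
  exact le_top

theorem gridPt_eq_of_le {m n : ℕ} (h : m ≤ n) (j : ℕ) :
    gridPt T m j = gridPt T n (j * 2 ^ (n - m)) := by
  obtain ⟨r, rfl⟩ := Nat.exists_eq_add_of_le h
  rw [gridPt, gridPt, Nat.add_sub_cancel_left, pow_add]
  congr 1
  push_cast
  field_simp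

theorem gridUp_coe_le (n : ℕ) (t : Time T) : (gridUp n t : ℝ) ≤ t + T / 2 ^ n := by
  have hT' := hT.out
  have h0 : 0 ≤ (t : ℝ) * 2 ^ n / T := div_nonneg (mul_nonneg t.2.1 (by positivity)) hT'.le
  rw [gridUp, gridPt, coe_projIcc]
  refine max_le (add_nonneg t.2.1 (by positivity)) ((min_le_right _ _).trans ?_)
  rw [div_le_iff₀ (by positivity), gridIdx]
  calc T * (⌈(t : ℝ) * 2 ^ n / T⌉₊ : ℝ)
      ≤ T * ((t : ℝ) * 2 ^ n / T + 1) := by gcongr; exact (Nat.ceil_lt_add_one h0).le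
    _ = (t + T / 2 ^ n) * 2 ^ n := by field_simp

theorem tendsto_gridUp (t : Time T) : Tendsto (fun n => gridUp n t) atTop (𝓝[≥] t) := by
  refine tendsto_nhdsWithin_iff.2 ⟨?_, Eventually.of_forall fun n => le_gridUp n t⟩
  rw [tendsto_subtype_rng]
  have hmesh : Tendsto (fun n : ℕ => T / 2 ^ n) atTop (𝓝 0) :=
    tendsto_const_nhds.div_atTop (tendsto_pow_atTop_atTop_of_one_lt (by norm_num))
  exact tendsto_of_tendsto_of_tendsto_of_le_of_le tendsto_const_nhds
    (by simpa using hmesh.const_add (t : ℝ)) (fun n => le_gridUp n t) (fun n => gridUp_coe_le n t)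

theorem measurable_gridUp (n : ℕ) : Measurable (gridUp (T := T) n) :=
  (measurable_from_nat (f := gridPt T n)).comp (measurable_gridIdx n)

theorem IsCadlag.tendsto_comp_gridUp {x : Time T → E N} (hx : IsCadlag x) (t : Time T) :
    Tendsto (fun n => x (gridUp n t)) atTop (𝓝 (x t)) :=
  (hx t).1.tendsto.comp (tendsto_gridUp t)

/-- Adapted càdlàg processes are progressively measurable: the time argument is stopped at `t₀` so
that only the values up to `t₀` enter. -/
theorem measurable_uncurry_min_of_isCadlag {Ω : Type*} [MeasurableSpace Ω]
    {X : Ω → Time T → E N} (hX : ∀ ω, IsCadlag (X ω)) {t₀ : Time T}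
    (hm : ∀ s ≤ t₀, Measurable fun ω => X ω s) :
    Measurable fun p : Ω × Time T => X p.1 (min p.2 t₀) := by
  refine measurable_of_tendsto_metrizable (f := fun n (p : Ω × Time T) =>
    X p.1 (min (gridUp n (min p.2 t₀)) t₀)) (fun n => ?_) (tendsto_pi_nhds.2 fun p => ?_)
  · have measurable_at_grid : Measurable fun q : Ω × ℕ => X q.1 (min (gridPt T n q.2) t₀) :=
      measurable_from_prod_countable_left fun j => hm (min (gridPt T n j) t₀) (min_le_right _ _)
    exact measurable_at_grid.comp
      (g := fun q : Ω × ℕ => X q.1 (min (gridPt T n q.2) t₀))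
      (f := fun p : Ω × Time T => (p.1, gridIdx n (min p.2 t₀)))
      (measurable_fst.prodMk ((measurable_gridIdx n).comp (measurable_snd.min measurable_const)))
  · refine (hX p.1 _).1.tendsto.comp (tendsto_nhdsWithin_iff.2 ⟨?_, Eventually.of_forall fun n =>
      le_min (le_gridUp n _) (min_le_right _ _)⟩)
    simpa using (tendsto_nhdsWithin_iff.1 (tendsto_gridUp (min p.2 t₀))).1.min
      (tendsto_const_nhds (x := t₀))

theorem measurable_uncurry_of_isCadlag {Ω : Type*} [MeasurableSpace Ω]
    {X : Ω → Time T → E N} (hX : ∀ ω, IsCadlag (X ω)) (hm : ∀ s, Measurable fun ω => X ω s) :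
    Measurable fun p : Ω × Time T => X p.1 p.2 := by
  simpa using measurable_uncurry_min_of_isCadlag hX (t₀ := ⊤) fun s _ => hm s

theorem IsCadlag.measurable {x : Time T → E N} (hx : IsCadlag x) : Measurable x :=
  (measurable_uncurry_of_isCadlag (Ω := Unit) (X := fun _ => x) (fun _ => hx)
    fun _ => measurable_const).comp (measurable_const (a := ()) |>.prodMk measurable_id)

theorem IsCadlag.integrable_apply {x : Time T → E N} (hx : IsCadlag x) (i : Fin N)
    (μ : Measure (Time T)) [IsFiniteMeasure μ] : Integrable (fun t => x t i) μ := by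
  obtain ⟨R, hR⟩ := hx.exists_norm_le
  have := hx.measurable
  exact Integrable.of_bound (by fun_prop : Measurable fun t => x t i).aestronglyMeasurable R
    (Eventually.of_forall fun t => (PiLp.norm_apply_le (x t) i).trans (hR t))

/-- The increment of `b` over the `j`-th dyadic interval of level `n`. The `0`-th interval is `{0}`,
where the increment is `b 0` since `b` is thought of as vanishing before the time `0`. -/
def gridIncr (n : ℕ) (b : Time T → ℝ) : ℕ → ℝ
  | 0 => b (gridPt T n 0)
  | j + 1 => b (gridPt T n (j + 1)) - b (gridPt T n j)

theorem gridIncr_nonneg (n : ℕ) {b : Time T → ℝ} (hb : Monotone b) (h0 : 0 ≤ b ⊥) (j : ℕ) :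
    0 ≤ gridIncr n b j := by
  cases j with
  | zero => exact h0.trans (hb bot_le)
  | succ j => exact sub_nonneg.2 (hb (gridPt_mono n j.le_succ))

theorem sum_gridIncr (n m : ℕ) (b : Time T → ℝ) :
    ∑ j ∈ Finset.range (m + 1), gridIncr n b j = b (gridPt T n m) := by
  induction m with
  | zero => simp [gridIncr]
  | succ m ih => rw [Finset.sum_range_succ, ih, gridIncr, add_sub_cancel]

theorem IncSkorokhod.dMeasure_real_gridIdx_eq (A : IncSkorokhod T k) (i : Fin k) (n j : ℕ) :
    (A.dMeasure i).real {t | gridIdx n t = j} = gridIncr n (fun t => A t i) j := by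
  cases j with
  | zero =>
    have : {t : Time T | gridIdx n t = 0} = Iic (gridPt T n 0) := by
      ext t
      simp [← gridIdx_le_iff]
    rw [this, A.dMeasure_real_Iic, gridIncr]
  | succ j =>
    have : {t : Time T | gridIdx n t = j + 1} = Iic (gridPt T n (j + 1)) \ Iic (gridPt T n j) := by
      ext t
      simp only [mem_ofPred_eq, Set.mem_sdiff, mem_Iic, ← gridIdx_le_iff]
      omega
    rw [this, measureReal_sdiff (Iic_subset_Iic.2 (gridPt_mono n j.le_succ)) measurableSet_Iic,
      A.dMeasure_real_Iic, A.dMeasure_real_Iic, gridIncr]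

/-- The Riemann sum of level `n` for the Stieltjes integral `∫_{[0,T]} y db`, which evaluates `y` at
the right end points. -/
def riemannSum (n : ℕ) (y b : Time T → ℝ) : ℝ :=
  ∑ j ∈ Finset.range (2 ^ n + 1), gridIncr n b j * y (gridPt T n j)

theorem IncSkorokhod.integral_gridUp (A : IncSkorokhod T k) (i : Fin k) (n : ℕ) (y : Time T → ℝ) :
    ∫ t, y (gridUp n t) ∂(A.dMeasure i) = riemannSum n y fun t => A t i := by
  have comp_gridUp_eq_sum : ∀ t, y (gridUp n t) = ∑ j ∈ Finset.range (2 ^ n + 1),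
      ({s : Time T | gridIdx n s = j}).indicator (fun _ => y (gridPt T n j)) t := by
    intro t
    rw [Finset.sum_eq_single (gridIdx n t)]
    · simp [gridUp]
    · intro j _ hj
      simp [hj.symm]
    · intro h
      exact absurd (Finset.mem_range.2 (Nat.lt_succ_of_le (gridIdx_le n t))) h
  have hms : ∀ j, MeasurableSet {s : Time T | gridIdx n s = j} := fun j =>
    measurable_gridIdx n (measurableSet_singleton j)
  simp_rw [comp_gridUp_eq_sum]
  rw [integral_finsetSum _ fun j _ => (integrable_const _).indicator (hms j)]
  refine Finset.sum_congr rfl fun j _ => ?_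
  rw [integral_indicator (hms j), setIntegral_const, A.dMeasure_real_gridIdx_eq, smul_eq_mul]

theorem IncSkorokhod.tendsto_riemannSum (A : IncSkorokhod T k) (i : Fin k) {y : Time T → E N}
    (hy : IsCadlag y) (l : Fin N) :
    Tendsto (fun n => riemannSum n (fun t => y t l) fun t => A t i) atTop
      (𝓝 (∫ t, y t l ∂(A.dMeasure i))) := by
  obtain ⟨R, hR⟩ := hy.exists_norm_le
  have hym := hy.measurable
  simp_rw [← A.integral_gridUp]
  refine tendsto_integral_of_dominated_convergence (fun _ => R) (fun n => ?_)
    (integrable_const _) (fun n => ?_) (Eventually.of_forall fun t => ?_)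
  · have := measurable_gridUp (T := T) n
    exact (by fun_prop : Measurable fun t => y (gridUp n t) l).aestronglyMeasurable
  · exact Eventually.of_forall fun t => (PiLp.norm_apply_le _ _).trans (hR _)
  · exact ((by fun_prop : Continuous fun a : E N => a l).tendsto _).comp (hy.tendsto_comp_gridUp t)

theorem riemannSum_nonneg (n : ℕ) {y b : Time T → ℝ} (hy : ∀ t, 0 ≤ y t) (hb : Monotone b)
    (h0 : 0 ≤ b ⊥) : 0 ≤ riemannSum n y b :=
  Finset.sum_nonneg fun j _ => mul_nonneg (gridIncr_nonneg n hb h0 j) (hy _)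

theorem abs_riemannSum_le (n : ℕ) {y b : Time T → ℝ} {R : ℝ} (hy : ∀ t, |y t| ≤ R)
    (hb : Monotone b) (h0 : 0 ≤ b ⊥) : |riemannSum n y b| ≤ R * b ⊤ := by
  calc |riemannSum n y b| ≤ ∑ j ∈ Finset.range (2 ^ n + 1), |gridIncr n b j * y (gridPt T n j)| :=
        Finset.abs_sum_le_sum_abs _ _
    _ ≤ ∑ j ∈ Finset.range (2 ^ n + 1), gridIncr n b j * R := by
        refine Finset.sum_le_sum fun j _ => ?_
        rw [abs_mul, abs_of_nonneg (gridIncr_nonneg n hb h0 j)]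
        exact mul_le_mul_of_nonneg_left (hy _) (gridIncr_nonneg n hb h0 j)
    _ = R * b ⊤ := by rw [← Finset.sum_mul, sum_gridIncr, gridPt_pow, mul_comm]

theorem IncSkorokhod.integral_setIntegral_Ici (A : IncSkorokhod T k) (i : Fin k) {ψ : Time T → ℝ}
    (hψ : Integrable ψ (leb T)) :
    ∫ t, (∫ s in Ici t, ψ s ∂leb T) ∂(A.dMeasure i) = ∫ s, ψ s * A s i ∂leb T := by
  let Ψ : Time T → Time T → ℝ := fun t s => (Ici t).indicator ψ s
  have integrable_Ψ : Integrable (Function.uncurry Ψ) ((A.dMeasure i).prod (leb T)) :=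
    (hψ.comp_snd _).indicator (s := {p : Time T × Time T | p.1 ≤ p.2}) measurableSet_le'
  calc ∫ t, (∫ s in Ici t, ψ s ∂leb T) ∂(A.dMeasure i)
      = ∫ t, ∫ s, Ψ t s ∂leb T ∂(A.dMeasure i) := by
        simp_rw [Ψ, integral_indicator measurableSet_Ici]
    _ = ∫ s, ∫ t, Ψ t s ∂(A.dMeasure i) ∂leb T := integral_integral_swap integrable_Ψ
    _ = ∫ s, ψ s * A s i ∂leb T := by
        refine integral_congr_ae (Eventually.of_forall fun s => ?_)
        have : (fun t => Ψ t s) = (Iic s).indicator fun _ => ψ s := rfl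
        simp only [this, integral_indicator measurableSet_Iic, setIntegral_const,
          A.dMeasure_real_Iic, smul_eq_mul, mul_comm]

end Paths

/-! ### Right-continuous regularization -/

theorem tendsto_euclidean_iff {N : ℕ} {ι : Type*} {x : ι → E N} {l : Filter ι} {a : E N} :
    Tendsto x l (𝓝 a) ↔ ∀ i, Tendsto (fun n => x n i) l (𝓝 (a i)) :=
  ⟨fun h i => ((by fun_prop : Continuous fun a : E N => a i).tendsto a).comp h, fun h =>
    ((PiLp.continuous_toLp 2 _).tendsto _).comp (tendsto_pi_nhds.2 h)⟩

theorem measurable_euclidean_iff {N : ℕ} {Ω : Type*} [MeasurableSpace Ω] {x : Ω → E N} :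
    Measurable x ↔ ∀ i, Measurable fun ω => x ω i :=
  ⟨fun h i => (by fun_prop : Measurable fun a : E N => a i).comp h, fun h =>
    (PiLp.continuous_toLp 2 _).measurable.comp (measurable_pi_iff.2 h)⟩

section Regularization

variable {ι β : Type*} [LinearOrder ι] [TopologicalSpace ι]

/-- `u` has one-sided limits along `D` at every time. -/
def HasSideLimits [TopologicalSpace β] (D : Set ι) (u : ι → β) : Prop :=
  ∀ t, (∃ l, Tendsto u (𝓝[D ∩ Ioi t] t) (𝓝 l)) ∧ ∃ l, Tendsto u (𝓝[D ∩ Iio t] t) (𝓝 l)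

section OrderTop

variable [OrderTop ι]

/-- The right-continuous regularization of a function given on `D`: its value at `t` is the limit of
`u s` as `s` decreases to `t` in `D`, except that the value at the last time is kept. -/
def regularize [TopologicalSpace β] [Nonempty β] (D : Set ι) (u : ι → β) (t : ι) : β :=
  if t = ⊤ then u ⊤ else limUnder (𝓝[D ∩ Ioi t] t) u

section TopologicalSpace

variable [TopologicalSpace β] [Nonempty β]

theorem regularize_top (D : Set ι) (u : ι → β) : regularize D u ⊤ = u ⊤ := if_pos rfl

theorem tendsto_regularize {D : Set ι} {u : ι → β} (hu : HasSideLimits D u) {t : ι} (ht : t < ⊤) :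
    Tendsto u (𝓝[D ∩ Ioi t] t) (𝓝 (regularize D u t)) := by
  rw [regularize, if_neg ht.ne]
  exact tendsto_nhds_limUnder (hu t).1

end TopologicalSpace

variable [OrderTopology ι] [DenselyOrdered ι]

theorem nhdsWithin_inter_Ioi_neBot {D : Set ι} (hD : Dense D) {t : ι} (ht : t < ⊤) :
    (𝓝[D ∩ Ioi t] t).NeBot := by
  rw [← mem_closure_iff_nhdsWithin_neBot, inter_comm]
  exact closure_minimal (hD.open_subset_closure_inter isOpen_Ioi) isClosed_closure
    (mem_closure_iff_nhdsWithin_neBot.2 (nhdsGT_neBot_of_exists_gt ⟨⊤, ht⟩))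

theorem exists_seq_tendsto_nhdsWithin_inter_Ioi [FirstCountableTopology ι] {D : Set ι}
    (hD : Dense D) {t s : ι} (hts : t < s) :
    ∃ q : ℕ → ι, (∀ n, q n ∈ D ∧ q n ∈ Ioo t s) ∧ Tendsto q atTop (𝓝[D ∩ Ioi t] t) := by
  have := nhdsWithin_inter_Ioi_neBot hD (hts.trans_le le_top)
  obtain ⟨q, hq⟩ := (𝓝[D ∩ Ioi t] t).exists_seq_tendsto
  have eventually_between : ∀ᶠ n in atTop, q n ∈ D ∧ q n ∈ Ioo t s := by
    filter_upwards [hq.eventually self_mem_nhdsWithin,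
      hq.eventually (nhdsWithin_le_nhds (Iio_mem_nhds hts))] with n hDn hns
    exact ⟨hDn.1, hDn.2, hns⟩
  obtain ⟨m, hm⟩ := eventually_atTop.1 eventually_between
  exact ⟨fun n => q (n + m), fun n => hm _ (Nat.le_add_left _ _),
    hq.comp (tendsto_add_atTop_nat m)⟩

theorem measurable_of_forall_gt {Ω γ : Type*} [MeasurableSpace γ] {mΩ : MeasurableSpace Ω}
    {f : Filtration ι mΩ} [f.IsRightContinuous] {t : ι} (ht : t < ⊤) {g : Ω → γ}
    (h : ∀ s, t < s → Measurable[f s] g) : Measurable[f t] g := by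
  have := nhdsGT_neBot_of_exists_gt ⟨⊤, ht⟩
  rw [← Filtration.IsRightContinuous.eq (𝓕 := f), Filtration.rightCont_eq_of_neBot_nhdsGT]
  intro B hB
  simp only [MeasurableSpace.measurableSet_iInf]
  exact fun s hs => h s hs hB

theorem measurable_regularize [FirstCountableTopology ι] [TopologicalSpace β] [Nonempty β]
    [TopologicalSpace.PseudoMetrizableSpace β] [MeasurableSpace β] [BorelSpace β]
    {Ω : Type*} {mΩ : MeasurableSpace Ω}
    {f : Filtration ι mΩ} [f.IsRightContinuous] {D : Set ι} (hD : Dense D) (htop : ⊤ ∈ D)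
    {u : Ω → ι → β} (hu : ∀ ω, HasSideLimits D (u ω))
    (hm : ∀ q ∈ D, Measurable[f q] fun ω => u ω q) (t : ι) :
    Measurable[f t] fun ω => regularize D (u ω) t := by
  rcases eq_or_lt_of_le (le_top (a := t)) with rfl | ht
  · simp_rw [regularize_top]
    exact hm _ htop
  · refine measurable_of_forall_gt ht fun s hs => ?_
    obtain ⟨q, hq, hlim⟩ := exists_seq_tendsto_nhdsWithin_inter_Ioi hD hs
    refine @measurable_of_tendsto_metrizable _ _ (f s) _ _ _ _ (fun n ω => u ω (q n)) _
      (fun n => (hm _ (hq n).1).mono (f.mono (hq n).2.2.le) le_rfl) ?_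
    exact tendsto_pi_nhds.2 fun ω => (tendsto_regularize (hu ω) ht).comp hlim

variable [PseudoMetricSpace β] [Nonempty β] {D : Set ι} {u : ι → β}

theorem dist_regularize_le (hD : Dense D) (hu : HasSideLimits D u) {O : Set ι} (hO : IsOpen O)
    {l : β} {ε : ℝ} (h : ∀ s ∈ D ∩ O, dist (u s) l ≤ ε) {t : ι} (ht : t < ⊤) (htO : t ∈ O) :
    dist (regularize D u t) l ≤ ε := by
  have := nhdsWithin_inter_Ioi_neBot hD ht
  refine le_of_tendsto ((tendsto_regularize hu ht).dist tendsto_const_nhds) ?_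
  filter_upwards [self_mem_nhdsWithin, nhdsWithin_le_nhds (hO.mem_nhds htO)] with s hsD hsO
  exact h s ⟨hsD.1, hsO⟩

theorem tendsto_regularize_of_tendsto (hD : Dense D) (hu : HasSideLimits D u) {t : ι} {I : Set ι}
    (hI : IsOpen I) (htop : ⊤ ∉ I) {l : β} (h : Tendsto u (𝓝[D ∩ I] t) (𝓝 l)) :
    Tendsto (regularize D u) (𝓝[I] t) (𝓝 l) := by
  rw [Metric.tendsto_nhds]
  intro ε hε
  obtain ⟨O, hO, htO, hsub⟩ :=
    mem_nhdsWithin.1 (Metric.tendsto_nhds.1 h (ε / 2) (half_pos hε))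
  filter_upwards [self_mem_nhdsWithin, nhdsWithin_le_nhds (hO.mem_nhds htO)] with s hsI hsO
  refine (dist_regularize_le hD hu (hO.inter hI) (ε := ε / 2) (fun r hr => ?_)
    (lt_top_iff_ne_top.2 fun h => htop (h ▸ hsI)) ⟨hsO, hsI⟩).trans_lt (half_lt_self hε)
  exact le_of_lt (hsub ⟨hr.2.1, hr.1, hr.2.2⟩)

theorem continuousWithinAt_Ici_regularize (hD : Dense D) (hu : HasSideLimits D u) (t : ι) :
    ContinuousWithinAt (regularize D u) (Ici t) t := by
  rcases eq_or_lt_of_le (le_top (a := t)) with rfl | ht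
  · rw [Ici_top]
    exact continuousWithinAt_singleton
  · rw [← Ioi_insert, continuousWithinAt_insert_self, ContinuousWithinAt,
      ← nhdsWithin_Ioo_eq_nhdsGT ht]
    refine tendsto_regularize_of_tendsto hD hu isOpen_Ioo (by simp)
      ((tendsto_regularize hu ht).mono_left ?_)
    exact nhdsWithin_mono _ (inter_subset_inter_right _ Ioo_subset_Ioi_self)

end OrderTop

theorem hasSideLimits_of_monotoneOn [OrderTopology ι] [OrderTop ι] {N : ℕ} {D : Set ι}
    {u : ι → E N} (htop : ⊤ ∈ D) (hmono : ∀ i, MonotoneOn (fun t => u t i) D)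
    (h0 : ∀ t ∈ D, ∀ i, 0 ≤ u t i) : HasSideLimits D u := by
  have exists_extension : ∀ i, ∃ v : ι → ℝ, Monotone v ∧ EqOn (fun t => u t i) v D := fun i =>
    (hmono i).exists_monotone_extension ⟨0, by rintro _ ⟨t, ht, rfl⟩; exact h0 t ht i⟩
      ⟨u ⊤ i, by rintro _ ⟨t, ht, rfl⟩; exact hmono i ht htop le_top⟩
  choose v hv huv using exists_extension
  have tendsto_of_extension : ∀ (t : ι) (I : Set ι) (l : Fin N → ℝ),
      (∀ i, Tendsto (v i) (𝓝[I] t) (𝓝 (l i))) →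
        Tendsto u (𝓝[D ∩ I] t) (𝓝 (WithLp.toLp 2 l)) := by
    intro t I l h
    refine tendsto_euclidean_iff.2 fun i => ?_
    refine ((h i).mono_left (nhdsWithin_mono _ inter_subset_right)).congr' ?_
    filter_upwards [self_mem_nhdsWithin] with s hs
    exact (huv i hs.1).symm
  exact fun t => ⟨⟨_, tendsto_of_extension t (Ioi t) _ fun i => (hv i).tendsto_nhdsGT t⟩,
    ⟨_, tendsto_of_extension t (Iio t) _ fun i => (hv i).tendsto_nhdsLT t⟩⟩

theorem tendsto_of_tendsto_dense [OrderTopology ι] [DenselyOrdered ι] [BoundedOrder ι] {D : Set ι}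
    (hD : Dense D) {v : ℕ → ι → ℝ} {u A : ι → ℝ} (hv : ∀ n, Monotone (v n))
    (hlim : ∀ q ∈ D, Tendsto (fun n => v n q) atTop (𝓝 (u q)))
    (hle : ∀ t, ∀ q ∈ D, q ≤ t → u q ≤ A t) (hge : ∀ t, ∀ q ∈ D, t < q → A t ≤ u q)
    {t : ι} (hbot : ⊥ < t) (htop : t < ⊤) (hA : ContinuousAt A t) :
    Tendsto (fun n => v n t) atTop (𝓝 (A t)) := by
  rw [tendsto_order]
  constructor
  · intro y hy
    obtain ⟨r, hrt, hr⟩ := exists_Ioc_subset_of_mem_nhds (hA.eventually (lt_mem_nhds hy)) ⟨⊥, hbot⟩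
    obtain ⟨r', hrr', hr't⟩ := exists_between hrt
    obtain ⟨q, hq, hr'q, hqt⟩ := hD.exists_between hr't
    have : y < u q := (hr ⟨hrr', hr't.le⟩).trans_le (hge _ _ hq hr'q)
    filter_upwards [(hlim q hq).eventually (lt_mem_nhds this)] with n hn
    exact hn.trans_le (hv n hqt.le)
  · intro y hy
    obtain ⟨r, hrt, hr⟩ := exists_Ico_subset_of_mem_nhds (hA.eventually (gt_mem_nhds hy)) ⟨⊤, htop⟩
    obtain ⟨q, hq, htq, hqr⟩ := hD.exists_between hrt
    have : u q < y := (hle _ _ hq le_rfl).trans_lt (hr ⟨htq.le, hqr⟩)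
    filter_upwards [(hlim q hq).eventually (gt_mem_nhds this)] with n hn
    exact (hv n htq.le).trans_lt hn

end Regularization

section RegularizedPaths

variable {T : ℝ} [hT : Fact (0 < T)] {N : ℕ} {D : Set (Time T)} {u : Time T → E N}

theorem isCadlag_regularize (hD : Dense D) (hu : HasSideLimits D u) :
    IsCadlag (regularize D u) := by
  refine fun t => ⟨continuousWithinAt_Ici_regularize hD hu t, ?_⟩
  obtain ⟨l, hl⟩ := (hu t).2
  exact ⟨l, tendsto_regularize_of_tendsto hD hu isOpen_Iio (by simp) hl⟩

variable (hD : Dense D) (htop : ⊤ ∈ D) (hmono : ∀ i, MonotoneOn (fun t => u t i) D)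
  (h0 : ∀ t ∈ D, ∀ i, 0 ≤ u t i)

include hD htop hmono h0

theorem regularize_le_of_lt {t q : Time T} (hq : q ∈ D) (htq : t < q) (i : Fin N) :
    regularize D u t i ≤ u q i := by
  have ht := htq.trans_le le_top
  have := nhdsWithin_inter_Ioi_neBot hD ht
  refine le_of_tendsto (tendsto_euclidean_iff.1
    (tendsto_regularize (hasSideLimits_of_monotoneOn htop hmono h0) ht) i) ?_
  filter_upwards [self_mem_nhdsWithin, nhdsWithin_le_nhds (Iio_mem_nhds htq)] with s hsD hsq
  exact hmono i hsD.1 hq (le_of_lt hsq)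

theorem le_regularize_of_forall_le {t : Time T} {i : Fin N} {r : ℝ}
    (hr : ∀ s ∈ D, t ≤ s → r ≤ u s i) : r ≤ regularize D u t i := by
  rcases eq_or_lt_of_le (le_top (a := t)) with rfl | ht
  · rw [regularize_top]
    exact hr ⊤ htop le_rfl
  · have := nhdsWithin_inter_Ioi_neBot hD ht
    refine ge_of_tendsto (tendsto_euclidean_iff.1
      (tendsto_regularize (hasSideLimits_of_monotoneOn htop hmono h0) ht) i) ?_
    filter_upwards [self_mem_nhdsWithin] with s hs
    exact hr s hs.1 (le_of_lt hs.2)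

theorem le_regularize_of_le {t q : Time T} (hq : q ∈ D) (hqt : q ≤ t) (i : Fin N) :
    u q i ≤ regularize D u t i :=
  le_regularize_of_forall_le hD htop hmono h0 fun _ hs hts => hmono i hq hs (hqt.trans hts)

theorem monotone_regularize (i : Fin N) : Monotone fun t => regularize D u t i := by
  intro t t' htt'
  rcases eq_or_lt_of_le htt' with rfl | h
  · exact le_rfl
  · obtain ⟨q, hq, htq, hqt'⟩ := hD.exists_between h
    exact (regularize_le_of_lt hD htop hmono h0 hq htq i).trans
      (le_regularize_of_le hD htop hmono h0 hq hqt'.le i)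

/-- The regularization of a nonnegative nondecreasing function, as a path. -/
def incRegularize : IncSkorokhod T N :=
  ⟨regularize D u, isCadlag_regularize hD (hasSideLimits_of_monotoneOn htop hmono h0),
    monotone_regularize hD htop hmono h0,
    fun i => le_regularize_of_forall_le hD htop hmono h0 fun s hs _ => h0 s hs i⟩

end RegularizedPaths

/-! ### Càdlàg conditional expectations -/

theorem exists_mem_of_frequently_nhdsWithin_inter {ι : Type*} [TopologicalSpace ι]
    {D I O : Set ι} {t : ι} {p : ι → Prop}
    (h : ∃ᶠ s in 𝓝[D ∩ I] t, p s) (hO : IsOpen O) (ht : t ∈ O) :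
    ∃ s ∈ D, s ∈ I ∧ s ∈ O ∧ p s := by
  obtain ⟨s, hs, hsDI, hsO⟩ := (h.and_eventually
    (eventually_mem_nhdsWithin.and (nhdsWithin_le_nhds (hO.mem_nhds ht)))).exists
  exact ⟨s, hsDI.1, hsDI.2, hsO, hs⟩

section Upcrossings

variable {ι : Type*} [LinearOrder ι] {D : Set ι} {u : ι → ℝ} {a b : ℝ}

/-- After time `x`, the function `u` has `K` successive upcrossings of `[a,b]` along `D`. -/
def HasUpcrossings (D : Set ι) (u : ι → ℝ) (a b : ℝ) : ℕ → ι → Prop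
  | 0, _ => True
  | K + 1, x => ∃ p ∈ D, ∃ q ∈ D, x < p ∧ p < q ∧ u p < a ∧ b < u q ∧ HasUpcrossings D u a b K q

theorem HasUpcrossings.anti {K : ℕ} {x y : ι} (hxy : x ≤ y) (h : HasUpcrossings D u a b K y) :
    HasUpcrossings D u a b K x := by
  cases K with
  | zero => trivial
  | succ K =>
    obtain ⟨p, hp, q, hq, hyp, h⟩ := h
    exact ⟨p, hp, q, hq, hxy.trans_lt hyp, h⟩

variable [TopologicalSpace ι] [OrderTopology ι]

theorem hasUpcrossings_of_frequently_left {t : ι}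
    (ha : ∃ᶠ s in 𝓝[D ∩ Iio t] t, u s < a) (hb : ∃ᶠ s in 𝓝[D ∩ Iio t] t, b < u s)
    (K : ℕ) : ∀ x < t, HasUpcrossings D u a b K x := by
  induction K with
  | zero => exact fun _ _ => trivial
  | succ K ih =>
    intro x hx
    obtain ⟨p, hp, hpt, hxp, hpa⟩ := exists_mem_of_frequently_nhdsWithin_inter ha isOpen_Ioi hx
    obtain ⟨q, hq, hqt, hpq, hqb⟩ := exists_mem_of_frequently_nhdsWithin_inter hb isOpen_Ioi hpt
    exact ⟨p, hp, q, hq, hxp, hpq, hpa, hqb, ih q hqt⟩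

theorem hasUpcrossings_of_frequently_right [DenselyOrdered ι] [OrderTop ι] {t : ι} (ht : t < ⊤)
    (ha : ∃ᶠ s in 𝓝[D ∩ Ioi t] t, u s < a) (hb : ∃ᶠ s in 𝓝[D ∩ Ioi t] t, b < u s)
    (K : ℕ) : ∃ x, t < x ∧ HasUpcrossings D u a b K x := by
  induction K with
  | zero => exact ⟨⊤, ht, trivial⟩
  | succ K ih =>
    obtain ⟨y, hty, hy⟩ := ih
    obtain ⟨q, hq, htq, hqy, hqb⟩ := exists_mem_of_frequently_nhdsWithin_inter hb isOpen_Iio hty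
    obtain ⟨p, hp, htp, hpq, hpa⟩ := exists_mem_of_frequently_nhdsWithin_inter ha isOpen_Iio htq
    obtain ⟨x, htx, hxp⟩ := exists_between (mem_Ioi.1 htp)
    exact ⟨x, htx, p, hp, q, hq, hxp, hpq, hpa, hqb, hy.anti (le_of_lt hqy)⟩

theorem hasSideLimits_of_bounded_of_not_hasUpcrossings [DenselyOrdered ι] [BoundedOrder ι] {R : ℝ}
    (hR : ∀ t ∈ D, |u t| ≤ R)
    (hup : ∀ a b : ℚ, (a : ℝ) < b → ∃ K, ∀ x, ¬ HasUpcrossings D u a b K x) :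
    HasSideLimits D u := by
  intro t
  have bounded_above : ∀ I, IsBoundedUnder (· ≤ ·) (𝓝[D ∩ I] t) u := fun I =>
    isBoundedUnder_of_eventually_le (a := R) <| by
      filter_upwards [self_mem_nhdsWithin] with s hs using (abs_le.1 (hR s hs.1)).2
  have bounded_below : ∀ I, IsBoundedUnder (· ≥ ·) (𝓝[D ∩ I] t) u := fun I =>
    isBoundedUnder_of_eventually_ge (a := -R) <| by
      filter_upwards [self_mem_nhdsWithin] with s hs using (abs_le.1 (hR s hs.1)).1
  constructor
  · rcases eq_or_lt_of_le (le_top (a := t)) with rfl | ht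
    · exact ⟨0, by simp⟩
    · refine tendsto_of_no_upcrossings Rat.denseRange_cast ?_ (bounded_above _) (bounded_below _)
      rintro _ ⟨a, rfl⟩ _ ⟨b, rfl⟩ hab ⟨ha, hb⟩
      obtain ⟨K, hK⟩ := hup a b hab
      obtain ⟨x, -, hx⟩ := hasUpcrossings_of_frequently_right ht ha hb K
      exact hK x hx
  · rcases eq_or_lt_of_le (bot_le (a := t)) with rfl | ht
    · exact ⟨0, by simp⟩
    · refine tendsto_of_no_upcrossings Rat.denseRange_cast ?_ (bounded_above _) (bounded_below _)
      rintro _ ⟨a, rfl⟩ _ ⟨b, rfl⟩ hab ⟨ha, hb⟩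
      obtain ⟨K, hK⟩ := hup a b hab
      exact hK ⊥ (hasUpcrossings_of_frequently_left ha hb K ⊥ ht)

end Upcrossings

section Dyadics

variable {T : ℝ} [hT : Fact (0 < T)]

/-- The dyadic points of `[0,T]`. -/
def dyadics (T : ℝ) [Fact (0 < T)] : Set (Time T) := {t | ∃ n j, j ≤ 2 ^ n ∧ t = gridPt T n j}

theorem gridUp_mem_dyadics (n : ℕ) (t : Time T) : gridUp n t ∈ dyadics T :=
  ⟨n, gridIdx n t, gridIdx_le n t, rfl⟩

theorem dense_dyadics : Dense (dyadics T) := fun t =>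
  mem_closure_of_tendsto ((tendsto_gridUp t).mono_right nhdsWithin_le_nhds)
    (Eventually.of_forall fun n => gridUp_mem_dyadics n t)

theorem top_mem_dyadics : ⊤ ∈ dyadics T := ⟨0, 2 ^ 0, le_rfl, (gridPt_pow 0).symm⟩

theorem countable_dyadics : (dyadics T).Countable := by
  refine (countable_range fun p : ℕ × ℕ => gridPt T p.1 p.2).mono ?_
  rintro t ⟨n, j, -, rfl⟩
  exact ⟨(n, j), rfl⟩

theorem exists_gridPt_eq_of_le {m n j : ℕ} (hmn : m ≤ n) (hj : j ≤ 2 ^ m) :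
    ∃ j' ≤ 2 ^ n, gridPt T n j' = gridPt T m j := by
  refine ⟨j * 2 ^ (n - m), ?_, (gridPt_eq_of_le hmn j).symm⟩
  calc j * 2 ^ (n - m) ≤ 2 ^ m * 2 ^ (n - m) := Nat.mul_le_mul_right _ hj
    _ = 2 ^ n := by rw [← pow_add, Nat.add_sub_cancel' hmn]

theorem eventually_exists_gridPt_eq {q : Time T} (hq : q ∈ dyadics T) :
    ∀ᶠ n in atTop, ∃ j ≤ 2 ^ n, gridPt T n j = q := by
  obtain ⟨m, j, hj, rfl⟩ := hq
  exact eventually_atTop.2 ⟨m, fun n hn => exists_gridPt_eq_of_le hn hj⟩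

theorem HasUpcrossings.eventually_add_le_upcrossingsBefore {Ω : Type*} {X : Time T → Ω → ℝ} {ω : Ω}
    {a b : ℝ} (hab : a < b) {K : ℕ} {x : Time T}
    (h : HasUpcrossings (dyadics T) (fun t => X t ω) a b K x) :
    ∀ᶠ n in atTop, ∀ j ≤ 2 ^ n, gridPt T n j ≤ x →
      upcrossingsBefore a b (fun j => X (gridPt T n j)) (j + 1) ω + K ≤
        upcrossingsBefore a b (fun j => X (gridPt T n j)) (2 ^ n + 1) ω := by
  induction K generalizing x with
  | zero =>
    exact Eventually.of_forall fun n j hj _ => upcrossingsBefore_mono hab (Nat.succ_le_succ hj) ω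
  | succ K ih =>
    obtain ⟨p, hp, q, hq, hxp, hpq, hpa, hqb, h⟩ := h
    filter_upwards [ih h, eventually_exists_gridPt_eq hp, eventually_exists_gridPt_eq hq]
      with n upcrossings_after_q ⟨jp, _, hjp⟩ ⟨jq, hjq_le, hjq⟩ j _ hjx
    have hj_lt : j < jp := (gridPt_mono n).reflect_lt (hjx.trans_lt (hxp.trans_le hjp.ge))
    have hjp_lt : jp < jq := (gridPt_mono n).reflect_lt (by rwa [hjp, hjq])
    have upcrossing_between := upcrossingsBefore_lt_of_exists_upcrossing
      (f := fun j => X (gridPt T n j)) (ω := ω) hab (N := j + 1) (N₁ := jp) (N₂ := jq) hj_lt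
      (by simpa [hjp] using hpa) hjp_lt.le (by simpa [hjq] using hqb)
    have := upcrossings_after_q jq hjq_le hjq.le
    omega

end Dyadics

theorem measure_iInter_eq_zero_of_mul_le {Ω : Type*} [MeasurableSpace Ω] {P : Measure Ω}
    {C : ℝ≥0∞} (hC : C ≠ ∞) {S : ℕ → Set Ω} (h : ∀ m : ℕ, m * P (S m) ≤ C) : P (⋂ m, S m) = 0 := by
  by_contra hne
  obtain ⟨m, hm⟩ := ENNReal.exists_nat_mul_gt hne hC
  exact ((mul_le_mul_right (measure_mono (iInter_subset _ m)) _).trans (h m)).not_gt hm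

section Submartingale

variable {T : ℝ} [hT : Fact (0 < T)] {Ω : Type*} {mΩ : MeasurableSpace Ω} {P : Measure Ω}
  {f : Filtration (Time T) mΩ} {X : Time T → Ω → ℝ}

/-- A filtration sampled along the dyadic points of level `n`. -/
def gridFiltration (f : Filtration (Time T) mΩ) (n : ℕ) : Filtration ℕ mΩ where
  seq j := f (gridPt T n j)
  mono' _ _ h := f.mono (gridPt_mono n h)
  le' _ := f.le _

theorem submartingale_grid (hX : Submartingale X f P) (n : ℕ) :
    Submartingale (fun j => X (gridPt T n j)) (gridFiltration f n) P :=
  ⟨fun _ => hX.1 _, fun _ _ h => hX.2.1 _ _ (gridPt_mono n h), fun _ => hX.2.2 _⟩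

variable [IsFiniteMeasure P]

theorem integral_le_integral_top (hX : Submartingale X f P) (t : Time T) :
    ∫ ω, X t ω ∂P ≤ ∫ ω, X ⊤ ω ∂P := by
  simpa using hX.setIntegral_le le_top MeasurableSet.univ

theorem mul_measure_exists_gridPt_le (hX : Submartingale X f P) (h0 : 0 ≤ X) (m n : ℕ) :
    m * P {ω | ∃ j ≤ 2 ^ n, (m : ℝ) ≤ X (gridPt T n j) ω} ≤ ENNReal.ofReal (∫ ω, X ⊤ ω ∂P) := by
  have doob := maximal_ineq (submartingale_grid hX n) (fun j => h0 _) (ε := (m : ℝ≥0)) (2 ^ n)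
  have subset_sup' : {ω | ∃ j ≤ 2 ^ n, (m : ℝ) ≤ X (gridPt T n j) ω} ⊆
      {ω | ((m : ℝ≥0) : ℝ) ≤ (Finset.range (2 ^ n + 1)).sup' Finset.nonempty_range_add_one
        fun k => X (gridPt T n k) ω} := by
    rintro ω ⟨j, hj, hω⟩
    rw [mem_ofPred_eq, Finset.le_sup'_iff]
    exact ⟨j, Finset.mem_range.2 (Nat.lt_succ_of_le hj), hω⟩
  refine (mul_le_mul' (by simp) (measure_mono subset_sup')).trans (doob.trans ?_)
  rw [gridPt_pow]
  exact ENNReal.ofReal_le_ofReal (setIntegral_le_integral (hX.2.2 ⊤) (Eventually.of_forall (h0 ⊤)))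

theorem ae_exists_le_on_dyadics (hX : Submartingale X f P) (h0 : 0 ≤ X) :
    ∀ᵐ ω ∂P, ∃ R : ℝ, ∀ t ∈ dyadics T, X t ω ≤ R := by
  let S : ℕ → ℕ → Set Ω := fun m n => {ω | ∃ j ≤ 2 ^ n, (m : ℝ) ≤ X (gridPt T n j) ω}
  have monotone_S : ∀ m, Monotone (S m) := by
    rintro m n n' hnn' ω ⟨j, hj, hω⟩
    obtain ⟨j', hj', heq⟩ := exists_gridPt_eq_of_le (T := T) hnn' hj
    exact ⟨j', hj', by rwa [heq]⟩
  have mul_measure_iUnion_le : ∀ m : ℕ, m * P (⋃ n, S m n) ≤ ENNReal.ofReal (∫ ω, X ⊤ ω ∂P) := by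
    intro m
    rw [(monotone_S m).measure_iUnion, ENNReal.mul_iSup]
    exact iSup_le (mul_measure_exists_gridPt_le hX h0 m)
  filter_upwards [measure_eq_zero_iff_ae_notMem.1
    (measure_iInter_eq_zero_of_mul_le ENNReal.ofReal_ne_top mul_measure_iUnion_le)] with ω hω
  simp only [mem_iInter, mem_iUnion, not_forall, not_exists] at hω
  obtain ⟨m, hm⟩ := hω
  refine ⟨m, ?_⟩
  rintro t ⟨n, j, hj, rfl⟩
  by_contra! h
  exact hm n ⟨j, hj, h.le⟩

theorem integral_upcrossingsBefore_grid_le (hX : Submartingale X f P) {a b : ℝ} (hab : a < b)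
    (n : ℕ) :
    ∫ ω, (upcrossingsBefore a b (fun j => X (gridPt T n j)) (2 ^ n + 1) ω : ℝ) ∂P ≤
      (∫ ω, (X ⊤ ω - a)⁺ ∂P) / (b - a) := by
  rw [le_div_iff₀' (sub_pos.2 hab)]
  have doob :=
    (submartingale_grid hX n).mul_integral_upcrossingsBefore_le_integral_pos_part a b (2 ^ n + 1)
  have submartingale_pos : Submartingale (fun t ω => (X t ω - a)⁺) f P :=
    (hX.sub_martingale (martingale_const f P a)).pos
  exact doob.trans (integral_le_integral_top submartingale_pos _)

theorem ae_exists_not_hasUpcrossings (hX : Submartingale X f P) {a b : ℝ} (hab : a < b) :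
    ∀ᵐ ω ∂P, ∃ K, ∀ x, ¬ HasUpcrossings (dyadics T) (fun t => X t ω) a b K x := by
  let U : ℕ → Ω → ℕ := fun n ω =>
    upcrossingsBefore a b (fun j => X (gridPt T n j)) (2 ^ n + 1) ω
  have adapted : ∀ n, StronglyAdapted (gridFiltration f n) fun j => X (gridPt T n j) := fun n =>
    (submartingale_grid hX n).stronglyAdapted
  have measurable_U : ∀ n, Measurable fun ω => (U n ω : ℝ≥0∞) := fun n =>
    (measurable_from_nat (f := fun m : ℕ => (m : ℝ≥0∞))).comp
      ((adapted n).measurable_upcrossingsBefore hab)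
  set C : ℝ≥0∞ := ENNReal.ofReal ((∫ ω, (X ⊤ ω - a)⁺ ∂P) / (b - a))
  have lintegral_U_le : ∀ n, ∫⁻ ω, (U n ω : ℝ≥0∞) ∂P ≤ C := by
    intro n
    calc ∫⁻ ω, (U n ω : ℝ≥0∞) ∂P = ∫⁻ ω, ENNReal.ofReal (U n ω : ℝ) ∂P := by simp
      _ = ENNReal.ofReal (∫ ω, (U n ω : ℝ) ∂P) :=
          (ofReal_integral_eq_lintegral_ofReal ((adapted n).integrable_upcrossingsBefore hab)
            (Eventually.of_forall fun ω => Nat.cast_nonneg _)).symm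
      _ ≤ C := ENNReal.ofReal_le_ofReal (integral_upcrossingsBefore_grid_le hX hab n)
  have lintegral_liminf_ne_top : ∫⁻ ω, liminf (fun n => (U n ω : ℝ≥0∞)) atTop ∂P ≠ ∞ := by
    refine ne_top_of_le_ne_top (b := C) ENNReal.ofReal_ne_top
      ((lintegral_liminf_le measurable_U).trans ?_)
    simpa using liminf_le_liminf (f := atTop) (Eventually.of_forall lintegral_U_le)
  filter_upwards [ae_lt_top (Measurable.liminf measurable_U) lintegral_liminf_ne_top] with ω hω
  by_contra! unbounded
  refine hω.ne (ENNReal.eq_top_of_forall_nnreal_le fun r => ?_)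
  obtain ⟨K, hK⟩ := exists_nat_ge r
  obtain ⟨x, hx⟩ := unbounded K
  refine le_liminf_of_le (by isBoundedDefault) ?_
  filter_upwards [hx.eventually_add_le_upcrossingsBefore (X := X) hab] with n hn
  have hKU : K ≤ U n ω :=
    (Nat.le_add_left _ _).trans (hn 0 (Nat.zero_le _) (by rw [gridPt_zero]; exact bot_le))
  calc (r : ℝ≥0∞) ≤ ((K : ℝ≥0) : ℝ≥0∞) := by exact_mod_cast hK
    _ ≤ U n ω := by exact_mod_cast hKU

theorem ae_hasSideLimits_of_martingale (hX : Martingale X f P) :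
    ∀ᵐ ω ∂P, HasSideLimits (dyadics T) fun t => X t ω := by
  have not_hasUpcrossings : ∀ᵐ ω ∂P, ∀ a b : ℚ, (a : ℝ) < b →
      ∃ K, ∀ x, ¬ HasUpcrossings (dyadics T) (fun t => X t ω) a b K x := by
    refine ae_all_iff.2 fun a => ae_all_iff.2 fun b => ?_
    by_cases hab : (a : ℝ) < b
    · filter_upwards [ae_exists_not_hasUpcrossings hX.submartingale hab] with ω hω _ using hω
    · exact Eventually.of_forall fun ω h => absurd h hab
  have submartingale_abs : Submartingale (X ⊔ -X) f P :=
    hX.submartingale.sup hX.neg.submartingale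
  filter_upwards [not_hasUpcrossings,
    ae_exists_le_on_dyadics submartingale_abs fun t ω => abs_nonneg (X t ω)] with ω hup ⟨R, hR⟩
  exact hasSideLimits_of_bounded_of_not_hasUpcrossings hR hup

end Submartingale

theorem ae_eq_condExp_of_tendsto {Ω : Type*} {m mΩ : MeasurableSpace Ω} {P : Measure Ω}
    [IsFiniteMeasure P] (hm : m ≤ mΩ) {Z : Ω → ℝ} (hZ : Integrable Z P)
    {ms : ℕ → MeasurableSpace Ω} (hms : ∀ n, ms n ≤ mΩ) (hmm : ∀ n, m ≤ ms n) {M : Ω → ℝ}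
    (hM : Measurable[m] M)
    (hlim : ∀ᵐ ω ∂P, Tendsto (fun n => P[Z | ms n] ω) atTop (𝓝 (M ω))) :
    M =ᵐ[P] P[Z | m] := by
  have uniformIntegrable : UniformIntegrable (fun n => P[Z | ms n]) 1 P :=
    hZ.uniformIntegrable_condExp hms
  have integrable_M : Integrable M P := uniformIntegrable.integrable_of_ae_tendsto hlim
  have tendsto_L1 : Tendsto (fun n => eLpNorm (P[Z | ms n] - M) 1 P) atTop (𝓝 0) :=
    tendsto_Lp_finite_of_tendsto_ae le_rfl ENNReal.one_ne_top
      uniformIntegrable.aestronglyMeasurable (memLp_one_iff_integrable.2 integrable_M)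
      uniformIntegrable.unifIntegrable hlim
  refine ae_eq_condExp_of_forall_setIntegral_eq hm hZ (fun s _ _ => integrable_M.integrableOn)
    (fun s hs _ => ?_) hM.stronglyMeasurable.aestronglyMeasurable
  refine tendsto_nhds_unique (tendsto_setIntegral_of_L1' M integrable_M.aestronglyMeasurable
    (Eventually.of_forall fun n => integrable_condExp) tendsto_L1 s) ?_
  simp_rw [fun n => setIntegral_condExp (hms n) hZ (hmm n s hs)]
  exact tendsto_const_nhds

theorem exists_modification_of_ae {ι β Ω : Type*} [Preorder ι] [MeasurableSpace β]
    {mΩ : MeasurableSpace Ω} {P : Measure Ω} {f : Filtration ι mΩ}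
    (hnull : ∀ t S, MeasurableSet S → P S = 0 → MeasurableSet[f t] S) {u : Ω → ι → β}
    (hm : ∀ t, Measurable[f t] fun ω => u ω t) {p : (ι → β) → Prop} {y : β} (hy : p fun _ => y)
    (hu : ∀ᵐ ω ∂P, p (u ω)) :
    ∃ v : Ω → ι → β, (∀ ω, p (v ω)) ∧ (∀ t, Measurable[f t] fun ω => v ω t) ∧
      ∀ᵐ ω ∂P, v ω = u ω := by
  classical
  obtain ⟨G, hG, measurableSet_G, measure_G⟩ := exists_measurable_superset_of_null hu
  refine ⟨fun ω => if ω ∈ G then fun _ => y else u ω, fun ω => ?_, fun t => ?_, ?_⟩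
  · by_cases hω : ω ∈ G
    · simpa only [hω, if_true] using hy
    · simp only [hω, if_false]
      by_contra h
      exact hω (hG h)
  · simp only [ite_apply]
    exact Measurable.ite (hnull t G measurableSet_G measure_G) measurable_const (hm t)
  · filter_upwards [measure_eq_zero_iff_ae_notMem.1 measure_G] with ω hω using if_neg hω

theorem exists_cadlag_condExp {T : ℝ} [Fact (0 < T)] {N : ℕ} {Ω : Type*} {mΩ : MeasurableSpace Ω}
    {P : Measure Ω} [IsFiniteMeasure P] (f : Filtration (Time T) mΩ) [f.IsRightContinuous]
    (hnull : ∀ t S, MeasurableSet S → P S = 0 → MeasurableSet[f t] S) {Z : Ω → E N}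
    (hZ : Integrable Z P) :
    ∃ M : Ω → Time T → E N, (∀ ω, IsCadlag (M ω)) ∧ (∀ t, Measurable[f t] fun ω => M ω t) ∧
      ∀ t i, (fun ω => M ω t i) =ᵐ[P] P[fun ω => Z ω i | f t] := by
  let X : Ω → Time T → E N := fun ω t => WithLp.toLp 2 fun i => P[fun ω => Z ω i | f t] ω
  have measurable_X : ∀ t, Measurable[f t] fun ω => X ω t := fun t =>
    (@measurable_euclidean_iff _ _ (f t) _).2 fun i => stronglyMeasurable_condExp.measurable
  have hasSideLimits_X : ∀ᵐ ω ∂P, HasSideLimits (dyadics T) (X ω) := by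
    filter_upwards [ae_all_iff.2 fun i =>
      ae_hasSideLimits_of_martingale (martingale_condExp (fun ω => Z ω i) f P)] with ω hω t
    choose l hl using fun i => (hω i t).1
    choose l' hl' using fun i => (hω i t).2
    exact ⟨⟨WithLp.toLp 2 l, tendsto_euclidean_iff.2 hl⟩,
      ⟨WithLp.toLp 2 l', tendsto_euclidean_iff.2 hl'⟩⟩
  obtain ⟨u, hu, measurable_u, hux⟩ :=
    exists_modification_of_ae hnull measurable_X (p := HasSideLimits (dyadics T)) (y := 0)
      (fun _ => ⟨⟨0, tendsto_const_nhds⟩, ⟨0, tendsto_const_nhds⟩⟩) hasSideLimits_X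
  have measurable_M := measurable_regularize dense_dyadics top_mem_dyadics hu
    fun q _ => measurable_u q
  refine ⟨fun ω => regularize (dyadics T) (u ω), fun ω => isCadlag_regularize dense_dyadics (hu ω),
    measurable_M, fun t i => ?_⟩
  rcases eq_or_lt_of_le (le_top (a := t)) with rfl | ht
  · filter_upwards [hux] with ω hω
    simp [regularize_top, hω, X]
  · obtain ⟨q, hq, hlim⟩ := exists_seq_tendsto_nhdsWithin_inter_Ioi (dense_dyadics (T := T)) ht
    refine ae_eq_condExp_of_tendsto (f.le t) (integrable_piLp_iff.1 hZ i) (fun n => f.le (q n))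
      (fun n => f.mono (hq n).2.1.le)
      ((@measurable_euclidean_iff _ _ (f t) _).1 (measurable_M t) i) ?_
    filter_upwards [hux] with ω hω
    have condExp_eq : ∀ n, P[fun ω => Z ω i | f (q n)] ω = u ω (q n) i := fun n => by simp [hω, X]
    simp_rw [condExp_eq]
    exact (tendsto_euclidean_iff.1 (tendsto_regularize (hu ω) ht) i).comp hlim

/-! ### Convex functions on the orthant -/

section Convex

variable {d k : ℕ}

theorem convex_orthant : Convex ℝ (orthant k) := fun a ha b hb r s hr hs _ i => by
  simpa using add_nonneg (mul_nonneg hr (ha i)) (mul_nonneg hs (hb i))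

theorem add_mem_orthant {a b : E k} (ha : a ∈ orthant k) (hb : b ∈ orthant k) :
    a + b ∈ orthant k :=
  fun i => add_nonneg (ha i) (hb i)

theorem smul_mem_orthant {r : ℝ} (hr : 0 ≤ r) {a : E k} (ha : a ∈ orthant k) :
    r • a ∈ orthant k :=
  fun i => mul_nonneg hr (ha i)

theorem single_mem_orthant (i : Fin k) {r : ℝ} (hr : 0 ≤ r) :
    EuclideanSpace.single i r ∈ orthant k := fun j => by
  rw [PiLp.single_apply]
  split_ifs <;> simp [hr]

/-- The metric projection onto the orthant. Precomposing with it turns functions which are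
measurable on the orthant into functions which are measurable on the whole space. -/
def toOrthant (a : E k) : E k := WithLp.toLp 2 fun i => max (a i) 0

theorem toOrthant_mem (a : E k) : toOrthant a ∈ orthant k := fun _ => le_max_right _ _

theorem toOrthant_eq {a : E k} (ha : a ∈ orthant k) : toOrthant a = a := by
  ext i
  exact max_eq_left (ha i)

theorem measurable_toOrthant : Measurable (toOrthant (k := k)) :=
  measurable_euclidean_iff.2 fun i =>
    (by fun_prop : Measurable fun a : E k => a i).max measurable_const

variable {φ : E d → E k → ℝ}

theorem hasFDerivWithinAt_grad (hφ : IsC1InControl φ) (l : E d) {a : E k} (ha : a ∈ orthant k) :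
    HasFDerivWithinAt (φ l) (InnerProductSpace.toDual ℝ (E k) (grad φ l a)) (orthant k) a :=
  (((hφ l).differentiableOn one_ne_zero) a ha).hasGradientWithinAt.hasFDerivWithinAt

theorem tendsto_slope_grad (hφ : IsC1InControl φ) (l : E d) {a y : E k} (ha : a ∈ orthant k)
    (hy : a + y ∈ orthant k) :
    Tendsto (fun r : ℝ => (φ l (a + r • y) - φ l a) / r) (𝓝[>] 0)
      (𝓝 (inner ℝ (grad φ l a) y)) := by
  have segment_deriv : HasDerivWithinAt (fun r : ℝ => a + r • y) y (Icc 0 1) 0 := by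
    simpa using (((hasDerivAt_id (0 : ℝ)).smul_const y).const_add a).hasDerivWithinAt
  have segment_mem : MapsTo (fun r : ℝ => a + r • y) (Icc 0 1) (orthant k) :=
    fun r hr => convex_orthant.add_smul_mem ha hy hr
  have φ_deriv : HasFDerivWithinAt (φ l) (InnerProductSpace.toDual ℝ (E k) (grad φ l a))
      (orthant k) (a + (0 : ℝ) • y) := by
    simpa using hasFDerivWithinAt_grad hφ l ha
  have nhdsGT_le : 𝓝[>] (0 : ℝ) ≤ 𝓝[Icc 0 1 \ {0}] (0 : ℝ) :=
    nhdsWithin_le_iff.2 (mem_of_superset (Ioo_mem_nhdsGT one_pos)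
      fun r hr => ⟨Ioo_subset_Icc_self hr, hr.1.ne'⟩)
  refine ((hasDerivWithinAt_iff_tendsto_slope.1
    (φ_deriv.comp_hasDerivWithinAt (0 : ℝ) segment_deriv segment_mem)).mono_left
      nhdsGT_le).congr fun r => ?_
  simp [slope_def_field]

theorem inner_grad_le (hφ : IsC1InControl φ) (hconv : ∀ l, ConvexOn ℝ (orthant k) (φ l)) (l : E d)
    {a y : E k} (ha : a ∈ orthant k) (hy : a + y ∈ orthant k) :
    inner ℝ (grad φ l a) y ≤ φ l (a + y) - φ l a := by
  refine le_of_tendsto (tendsto_slope_grad hφ l ha hy) ?_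
  filter_upwards [Ioo_mem_nhdsGT (one_pos (α := ℝ))] with r hr
  have convex_le : φ l ((1 - r) • a + r • (a + y)) ≤ (1 - r) * φ l a + r * φ l (a + y) :=
    (hconv l).2 ha hy (sub_nonneg.2 hr.2.le) hr.1.le (by ring)
  rw [show (1 - r) • a + r • (a + y) = a + r • y by module] at convex_le
  rw [div_le_iff₀ hr.1]
  linarith

theorem measurable_comp_toOrthant (hm : Measurable fun p : E d × orthant k => φ p.1 p.2) :
    Measurable fun p : E d × E k => φ p.1 (toOrthant p.2) :=
  hm.comp (g := fun p : E d × orthant k => φ p.1 p.2)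
    (f := fun p : E d × E k => (p.1, (⟨toOrthant p.2, toOrthant_mem p.2⟩ : orthant k)))
    (measurable_fst.prodMk (measurable_toOrthant.comp measurable_snd).subtype_mk)

theorem measurable_grad_toOrthant (hφ : IsC1InControl φ)
    (hm : Measurable fun p : E d × orthant k => φ p.1 p.2) :
    Measurable fun p : E d × E k => grad φ p.1 (toOrthant p.2) := by
  refine measurable_euclidean_iff.2 fun i => ?_
  let e : E k := EuclideanSpace.single i 1
  have add_smul_mem (a : E k) {r : ℝ} (hr : 0 ≤ r) : toOrthant a + r • e ∈ orthant k :=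
    add_mem_orthant (toOrthant_mem a) (smul_mem_orthant hr (single_mem_orthant i zero_le_one))
  let δ (n : ℕ) : ℝ := 1 / ((n : ℝ) + 1)
  have δ_pos (n : ℕ) : 0 < δ n := Nat.one_div_pos_of_nat
  have tendsto_δ : Tendsto δ atTop (𝓝[>] 0) :=
    tendsto_nhdsWithin_iff.2
      ⟨tendsto_one_div_add_atTop_nhds_zero_nat, Eventually.of_forall δ_pos⟩
  have measurable_φ := measurable_comp_toOrthant hm
  refine measurable_of_tendsto_metrizable (f := fun n (p : E d × E k) =>
    (φ p.1 (toOrthant (toOrthant p.2 + δ n • e)) - φ p.1 (toOrthant p.2)) / δ n)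
    (fun n => ?_) (tendsto_pi_nhds.2 fun p => ?_)
  · exact ((measurable_φ.comp (measurable_fst.prodMk
      ((measurable_toOrthant.comp measurable_snd).add_const _))).sub measurable_φ).div_const _
  · have slope_tendsto := (tendsto_slope_grad hφ p.1 (toOrthant_mem p.2)
      (by simpa using add_smul_mem p.2 zero_le_one)).comp tendsto_δ
    have inner_eq : inner ℝ (grad φ p.1 (toOrthant p.2)) e = grad φ p.1 (toOrthant p.2) i := by
      simp [e, EuclideanSpace.inner_single_right]
    rw [inner_eq] at slope_tendsto
    refine slope_tendsto.congr fun n => ?_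
    simp only [Function.comp, toOrthant_eq (add_smul_mem p.2 (δ_pos n).le)]

section Composition

variable {X : Type*} [MeasurableSpace X] (hm : Measurable fun p : E d × orthant k => φ p.1 p.2)
  {l : X → E d} {x : X → E k} (hl : Measurable l) (hx : Measurable x)
  (hmem : ∀ ω, x ω ∈ orthant k)

include hm hl hx hmem

theorem measurable_comp_of_mem : Measurable fun ω => φ (l ω) (x ω) := by
  simpa [Function.comp_def, toOrthant_eq (hmem _)]
    using (measurable_comp_toOrthant hm).comp (hl.prodMk hx)

theorem measurable_grad_comp_of_mem (hφ : IsC1InControl φ) :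
    Measurable fun ω => grad φ (l ω) (x ω) := by
  simpa [Function.comp_def, toOrthant_eq (hmem _)]
    using (measurable_grad_toOrthant hφ hm).comp (hl.prodMk hx)

theorem integrable_grad (hφ : IsC1InControl φ) {Φ : E d → ℝ≥0} {M : ℝ≥0}
    (hgrowth : ∀ l, ∀ a ∈ orthant k, ‖grad φ l a‖ ≤ Φ l + M * φ l a) {ν : Measure X}
    (hΦ : Integrable (fun ω => (Φ (l ω) : ℝ)) ν) (hint : Integrable (fun ω => φ (l ω) (x ω)) ν) :
    Integrable (fun ω => grad φ (l ω) (x ω)) ν :=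
  Integrable.mono' (hΦ.add (hint.const_mul M))
    (measurable_grad_comp_of_mem hm hl hx hmem hφ).aestronglyMeasurable
    (Eventually.of_forall fun ω => hgrowth _ _ (hmem ω))

end Composition

theorem eventually_nhdsGT_pos_le_one_mul_le_half (C : ℝ) :
    ∀ᶠ ε : ℝ in 𝓝[>] 0, 0 < ε ∧ ε ≤ 1 ∧ ε * C ≤ 1 / 2 := by
  have tendsto_mul : Tendsto (fun ε : ℝ => ε * C) (𝓝[>] 0) (𝓝 0) := by
    simpa using (tendsto_id (x := 𝓝 (0 : ℝ))).mul_const C |>.mono_left nhdsWithin_le_nhds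
  filter_upwards [tendsto_mul.eventually_le_const (by norm_num : (0 : ℝ) < 1 / 2),
    Ioo_mem_nhdsGT (one_pos (α := ℝ))] with ε hC hε
  exact ⟨hε.1, hε.2.le, hC⟩

section Growth

variable {Φ : E d → ℝ≥0} {M : ℝ≥0}
  (hgrowth : ∀ l, ∀ a ∈ orthant k, ‖grad φ l a‖ ≤ Φ l + M * φ l a)

include hgrowth

theorem abs_inner_grad_le (l : E d) {a y : E k} {R : ℝ} (ha : a ∈ orthant k) (hy : ‖y‖ ≤ R) :
    |inner ℝ (grad φ l a) y| ≤ R * (Φ l + M * φ l a) := by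
  rw [mul_comm R]
  exact (abs_real_inner_le_norm _ _).trans (mul_le_mul (hgrowth l a ha) hy (norm_nonneg _)
    ((norm_nonneg _).trans (hgrowth l a ha)))

variable (hφ : IsC1InControl φ) (hconv : ∀ l, ConvexOn ℝ (orthant k) (φ l))
  (hnonneg : ∀ l, ∀ a ∈ orthant k, 0 ≤ φ l a)

include hφ hconv

theorem abs_slope_le_max {R ε : ℝ} (hε : 0 < ε) {l : E d} {a y : E k} (ha : a ∈ orthant k)
    (hy : a + ε • y ∈ orthant k) (hyR : ‖y‖ ≤ R) :
    |(φ l (a + ε • y) - φ l a) / ε| ≤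
      max (R * (Φ l + M * φ l a)) (R * (Φ l + M * φ l (a + ε • y))) := by
  have inner_le : inner ℝ (grad φ l a) y ≤ (φ l (a + ε • y) - φ l a) / ε := by
    rw [le_div_iff₀' hε, ← real_inner_smul_right]
    exact inner_grad_le hφ hconv l ha hy
  have le_inner : (φ l (a + ε • y) - φ l a) / ε ≤ inner ℝ (grad φ l (a + ε • y)) y := by
    have h := inner_grad_le hφ hconv l hy (y := -(ε • y)) (by simpa using ha)
    rw [inner_neg_right, real_inner_smul_right, add_neg_cancel_right] at h
    rw [div_le_iff₀' hε]
    linarith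
  exact (abs_le_max_abs_abs inner_le le_inner).trans
    (max_le_max (abs_inner_grad_le hgrowth l ha hyR) (abs_inner_grad_le hgrowth l hy hyR))

include hnonneg

/-- The bound at `a + εy` given by the gradient there is absorbed into the left-hand side, since
`ε R M ≤ 1/2`. -/
theorem apply_add_smul_le {R ε : ℝ} (hR : 0 ≤ R) (hε : 0 < ε) (hε1 : ε ≤ 1)
    (hεM : ε * (R * M) ≤ 1 / 2) {l : E d} {a y : E k} (ha : a ∈ orthant k)
    (hy : a + ε • y ∈ orthant k) (hyR : ‖y‖ ≤ R) :
    φ l (a + ε • y) ≤ 2 * φ l a + 2 * R * Φ l := by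
  have hu := hnonneg l _ hy
  have RΦ_nonneg : 0 ≤ R * Φ l := mul_nonneg hR (Φ l).2
  rcases le_total (φ l (a + ε • y)) (φ l a) with hle | hle
  · linarith [hnonneg l _ ha]
  have slope_le : (φ l (a + ε • y) - φ l a) / ε ≤ R * (Φ l + M * φ l (a + ε • y)) :=
    ((le_abs_self _).trans (abs_slope_le_max hgrowth hφ hconv hε ha hy hyR)).trans
      (max_le (by gcongr) le_rfl)
  rw [div_le_iff₀' hε] at slope_le
  have absorb : ε * (R * M) * φ l (a + ε • y) ≤ 1 / 2 * φ l (a + ε • y) := by gcongr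
  have ε_mul_le : ε * (R * Φ l) ≤ 1 * (R * Φ l) := by gcongr
  linarith

theorem abs_slope_le {R ε : ℝ} (hR : 0 ≤ R) (hε : 0 < ε) (hε1 : ε ≤ 1)
    (hεM : ε * (R * M) ≤ 1 / 2) {l : E d} {a y : E k} (ha : a ∈ orthant k)
    (hy : a + ε • y ∈ orthant k) (hyR : ‖y‖ ≤ R) :
    |(φ l (a + ε • y) - φ l a) / ε| ≤ R * (Φ l + M * (2 * φ l a + 2 * R * Φ l)) := by
  have apply_le : φ l a ≤ 2 * φ l a + 2 * R * Φ l := by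
    linarith [hnonneg l _ ha, mul_nonneg hR (Φ l).coe_nonneg]
  refine (abs_slope_le_max hgrowth hφ hconv hε ha hy hyR).trans (max_le ?_ ?_)
  · gcongr
  · gcongr
    exact apply_add_smul_le hgrowth hφ hconv hnonneg hR hε hε1 hεM ha hy hyR

section Integral

variable {X : Type*} [MeasurableSpace X] {ν : Measure X}
  (hm : Measurable fun p : E d × orthant k => φ p.1 p.2) {l : X → E d} {x y : X → E k} {R : ℝ}
  (hR : 0 ≤ R) (hl : Measurable l) (hx : Measurable x) (hy : Measurable y)
  (hmem : ∀ ω, x ω ∈ orthant k) (hmem' : ∀ ε : ℝ, 0 ≤ ε → ε ≤ 1 → ∀ ω, x ω + ε • y ω ∈ orthant k)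
  (hyR : ∀ ω, ‖y ω‖ ≤ R) (hΦ : Integrable (fun ω => (Φ (l ω) : ℝ)) ν)
  (hint : Integrable (fun ω => φ (l ω) (x ω)) ν)

include hm hR hl hx hy hmem hmem' hyR hΦ hint

theorem eventually_integrable_comp_add_smul :
    ∀ᶠ ε : ℝ in 𝓝[>] 0, Integrable (fun ω => φ (l ω) (x ω + ε • y ω)) ν := by
  filter_upwards [eventually_nhdsGT_pos_le_one_mul_le_half (R * M)] with ε ⟨hε, hε1, hεM⟩
  have mem := hmem' ε hε.le hε1
  refine Integrable.mono' ((hint.const_mul 2).add (hΦ.const_mul (2 * R)))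
    (measurable_comp_of_mem hm hl (hx.add (hy.const_smul ε)) mem).aestronglyMeasurable
    (Eventually.of_forall fun ω => ?_)
  rw [Real.norm_of_nonneg (hnonneg _ _ (mem ω))]
  exact apply_add_smul_le hgrowth hφ hconv hnonneg hR hε hε1 hεM (hmem ω) (mem ω) (hyR ω)

theorem tendsto_slope_integral :
    Tendsto (fun ε : ℝ => ((∫ ω, φ (l ω) (x ω + ε • y ω) ∂ν) - ∫ ω, φ (l ω) (x ω) ∂ν) / ε) (𝓝[>] 0)
      (𝓝 (∫ ω, inner ℝ (grad φ (l ω) (x ω)) (y ω) ∂ν)) := by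
  have small := eventually_nhdsGT_pos_le_one_mul_le_half (R * M)
  have tendsto_integral_slope :
      Tendsto (fun ε : ℝ => ∫ ω, (φ (l ω) (x ω + ε • y ω) - φ (l ω) (x ω)) / ε ∂ν) (𝓝[>] 0)
        (𝓝 (∫ ω, inner ℝ (grad φ (l ω) (x ω)) (y ω) ∂ν)) := by
    refine tendsto_integral_filter_of_dominated_convergence
      (fun ω => R * (Φ (l ω) + M * (2 * φ (l ω) (x ω) + 2 * R * Φ (l ω)))) ?_ ?_ ?_ ?_
    · filter_upwards [small] with ε ⟨hε, hε1, _⟩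
      exact (((measurable_comp_of_mem hm hl (hx.add (hy.const_smul ε)) (hmem' ε hε.le hε1)).sub
        (measurable_comp_of_mem hm hl hx hmem)).div_const ε).aestronglyMeasurable
    · filter_upwards [small] with ε ⟨hε, hε1, hεM⟩
      exact Eventually.of_forall fun ω => abs_slope_le hgrowth hφ hconv hnonneg hR hε hε1 hεM
        (hmem ω) (hmem' ε hε.le hε1 ω) (hyR ω)
    · exact (hΦ.add (((hint.const_mul 2).add (hΦ.const_mul (2 * R))).const_mul _)).const_mul _
    · exact Eventually.of_forall fun ω => tendsto_slope_grad hφ (l ω) (hmem ω)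
        (by simpa using hmem' 1 zero_le_one le_rfl ω)
  refine tendsto_integral_slope.congr' ?_
  filter_upwards [eventually_integrable_comp_add_smul hgrowth hφ hconv hnonneg hm hR hl hx hy hmem
    hmem' hyR hΦ hint] with ε hε
  rw [integral_div, integral_sub hε hint]

end Integral

end Growth

end Convex

/-! ### Conditional independence and admissible controls -/

section CondIndependent

theorem isPiSystem_image2_inter {Ω : Type*} (m₁ m₂ : MeasurableSpace Ω) :
    IsPiSystem (image2 (· ∩ ·) {V | MeasurableSet[m₁] V} {W | MeasurableSet[m₂] W}) := by
  rintro _ ⟨V, hV, W, hW, rfl⟩ _ ⟨V', hV', W', hW', rfl⟩ -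
  exact ⟨V ∩ V', hV.inter hV', W ∩ W', hW.inter hW', inter_inter_inter_comm _ _ _ _⟩

theorem generateFrom_image2_inter {Ω : Type*} (m₁ m₂ : MeasurableSpace Ω) :
    MeasurableSpace.generateFrom
      (image2 (· ∩ ·) {V | MeasurableSet[m₁] V} {W | MeasurableSet[m₂] W}) = m₁ ⊔ m₂ := by
  refine le_antisymm (MeasurableSpace.generateFrom_le ?_) (sup_le (fun V hV => ?_) fun W hW => ?_)
  · rintro _ ⟨V, hV, W, hW, rfl⟩
    exact MeasurableSet.inter (le_sup_left (b := m₂) V hV) (le_sup_right (a := m₁) W hW)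
  · exact MeasurableSpace.measurableSet_generateFrom
      ⟨V, hV, univ, MeasurableSet.univ, inter_univ V⟩
  · exact MeasurableSpace.measurableSet_generateFrom
      ⟨univ, MeasurableSet.univ, W, hW, univ_inter W⟩

theorem indicator_one_mul_eq {Ω : Type*} (S : Set Ω) (f : Ω → ℝ) :
    (S.indicator fun _ => (1 : ℝ)) * f = S.indicator f := by
  ext ω
  by_cases h : ω ∈ S <;> simp [h]

theorem setIntegral_eq_of_isPiSystem {Ω : Type*} {mΩ : MeasurableSpace Ω} {P : Measure Ω}
    {C : Set (Set Ω)} (hC : IsPiSystem C) (huniv : univ ∈ C)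
    (hm : MeasurableSpace.generateFrom C ≤ mΩ) {f g : Ω → ℝ} (hf : Integrable f P)
    (hg : Integrable g P) (h : ∀ S ∈ C, ∫ ω in S, f ω ∂P = ∫ ω in S, g ω ∂P) {S : Set Ω}
    (hS : MeasurableSet[MeasurableSpace.generateFrom C] S) :
    ∫ ω in S, f ω ∂P = ∫ ω in S, g ω ∂P := by
  have integral_eq : ∫ ω, f ω ∂P = ∫ ω, g ω ∂P := by simpa using h univ huniv
  induction S, hS using MeasurableSpace.induction_on_inter (s := C) rfl hC with
  | empty => simp
  | basic S hS => exact h S hS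
  | compl S hS ih =>
    rw [setIntegral_compl (hm S hS) hf, setIntegral_compl (hm S hS) hg, integral_eq, ih]
  | iUnion F hd hF ih =>
    rw [integral_iUnion (fun n => hm _ (hF n)) hd hf.integrableOn,
      integral_iUnion (fun n => hm _ (hF n)) hd hg.integrableOn]
    exact tsum_congr ih

variable {Ω : Type*} {m m₁ m₂ mΩ : MeasurableSpace Ω} {P : Measure Ω} [IsFiniteMeasure P]

theorem integrable_indicator_one {S : Set Ω} (hS : MeasurableSet[mΩ] S) :
    Integrable (S.indicator fun _ => (1 : ℝ)) P :=
  (integrable_const _).indicator hS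

theorem condExp_indicator_condExp {S : Set Ω} (hS : MeasurableSet[mΩ] S) (f : Ω → ℝ) :
    P[S.indicator P[f | m] | m] =ᵐ[P] P⟦S | m⟧ * P[f | m] := by
  rw [← indicator_one_mul_eq]
  refine condExp_mul_of_stronglyMeasurable_right stronglyMeasurable_condExp ?_
    (integrable_indicator_one hS)
  rw [indicator_one_mul_eq]
  exact integrable_condExp.indicator hS

theorem setIntegral_condExp_eq_integral_mul (hm : m ≤ mΩ) {S : Set Ω} (hS : MeasurableSet[mΩ] S)
    (f : Ω → ℝ) : ∫ ω in S, P[f | m] ω ∂P = ∫ ω, (P⟦S | m⟧) ω * P[f | m] ω ∂P := by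
  rw [← integral_indicator hS, ← integral_condExp hm]
  exact integral_congr_ae (condExp_indicator_condExp hS f)

namespace CondIndependent

theorem setIntegral_indicator_eq {m₀ : MeasurableSpace Ω} (h : CondIndependent m m₁ m₂ P)
    (hm : m ≤ mΩ) (hm₀ : m₀ ≤ m) (hm₁ : m₁ ≤ mΩ) (hm₂ : m₂ ≤ mΩ) {U : Set Ω}
    (hU : MeasurableSet[m₂] U) {S : Set Ω} (hS : MeasurableSet[m₀ ⊔ m₁] S) :
    ∫ ω in S, U.indicator (fun _ => (1 : ℝ)) ω ∂P = ∫ ω in S, (P⟦U | m⟧) ω ∂P := by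
  have hU' := hm₂ U hU
  rw [← generateFrom_image2_inter m₀ m₁] at hS
  refine setIntegral_eq_of_isPiSystem (isPiSystem_image2_inter m₀ m₁)
    ⟨univ, MeasurableSet.univ, univ, MeasurableSet.univ, inter_univ _⟩
    ((generateFrom_image2_inter m₀ m₁).trans_le (sup_le (hm₀.trans hm) hm₁))
    (integrable_indicator_one hU') integrable_condExp ?_ hS
  rintro _ ⟨V, hV, W, hW, rfl⟩
  have hV' := hm₀ V hV
  have hW' := hm₁ W hW
  calc ∫ ω in V ∩ W, U.indicator (fun _ => (1 : ℝ)) ω ∂P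
      = ∫ ω in V, (W ∩ U).indicator (fun _ => (1 : ℝ)) ω ∂P := by
        rw [← setIntegral_indicator hW', indicator_indicator]
    _ = ∫ ω in V, (P⟦W ∩ U | m⟧) ω ∂P :=
        (setIntegral_condExp hm (integrable_indicator_one (hW'.inter hU')) hV').symm
    _ = ∫ ω in V, P[W.indicator (P⟦U | m⟧) | m] ω ∂P := by
        refine setIntegral_congr_ae (hm _ hV') ?_
        filter_upwards [h W U hW hU, condExp_indicator_condExp (m := m) hW'
          (P := P) (U.indicator fun _ => (1 : ℝ))] with ω prod_eq pull_out _
        rw [prod_eq, pull_out]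
    _ = ∫ ω in V, W.indicator (P⟦U | m⟧) ω ∂P :=
        setIntegral_condExp hm (integrable_condExp.indicator hW') hV'
    _ = ∫ ω in V ∩ W, (P⟦U | m⟧) ω ∂P := by rw [setIntegral_indicator hW']

theorem condExp_indicator_eq {m₀ : MeasurableSpace Ω} (h : CondIndependent m m₁ m₂ P)
    (hm₀ : m₀ ≤ m) (hm : m ≤ m₂) (hm₁ : m₁ ≤ mΩ) (hm₂ : m₂ ≤ mΩ) {S : Set Ω}
    (hS : MeasurableSet[m₀ ⊔ m₁] S) : P⟦S | m⟧ =ᵐ[P] P⟦S | m₂⟧ := by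
  have hmΩ := hm.trans hm₂
  have hS' := sup_le (hm₀.trans hmΩ) hm₁ S hS
  refine ae_eq_condExp_of_forall_setIntegral_eq hm₂ (integrable_indicator_one hS')
    (fun _ _ _ => integrable_condExp.integrableOn) (fun U hU _ => ?_)
    (stronglyMeasurable_condExp.mono hm).aestronglyMeasurable
  have hU' := hm₂ U hU
  calc ∫ ω in U, (P⟦S | m⟧) ω ∂P = ∫ ω in S, (P⟦U | m⟧) ω ∂P := by
        rw [setIntegral_condExp_eq_integral_mul hmΩ hU',
          setIntegral_condExp_eq_integral_mul hmΩ hS']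
        simp_rw [mul_comm]
    _ = ∫ ω in S, U.indicator (fun _ => (1 : ℝ)) ω ∂P :=
        (h.setIntegral_indicator_eq hmΩ hm₀ hm₁ hm₂ hU hS).symm
    _ = ∫ ω in U, S.indicator (fun _ => (1 : ℝ)) ω ∂P := by
        rw [setIntegral_indicator hU', setIntegral_indicator hS', inter_comm]

end CondIndependent

theorem condIndependent_of_condExp_eq (hm : m ≤ m₂) (hm₁ : m₁ ≤ mΩ) (hm₂ : m₂ ≤ mΩ)
    (h : ∀ S, MeasurableSet[m₁] S → ∃ w : Ω → ℝ, Measurable[m] w ∧ P⟦S | m₂⟧ =ᵐ[P] w) :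
    CondIndependent m m₁ m₂ P := by
  intro S U hS hU
  obtain ⟨w, hw, condExp_eq_w⟩ := h S hS
  have hS' := hm₁ S hS
  have hU' := hm₂ U hU
  have integrable_w : Integrable w P := integrable_condExp.congr condExp_eq_w
  have integrable_mul {f : Ω → ℝ} (hf : Integrable f P) :
      Integrable (f * U.indicator fun _ => (1 : ℝ)) P := by
    rw [mul_comm, indicator_one_mul_eq]
    exact hf.indicator hU'
  have condExp_S : P⟦S | m⟧ =ᵐ[P] w :=
    calc P⟦S | m⟧ =ᵐ[P] P[P⟦S | m₂⟧ | m] := (condExp_condExp_of_le hm hm₂).symm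
      _ =ᵐ[P] P[w | m] := condExp_congr_ae condExp_eq_w
      _ = w := condExp_of_stronglyMeasurable (hm.trans hm₂) hw.stronglyMeasurable integrable_w
  have condExp_inter : P⟦S ∩ U | m₂⟧ =ᵐ[P] w * U.indicator fun _ => (1 : ℝ) := by
    rw [← indicator_indicator, ← indicator_one_mul_eq]
    refine (condExp_mul_of_stronglyMeasurable_right
      (stronglyMeasurable_const.indicator hU) (integrable_mul (integrable_indicator_one hS'))
      (integrable_indicator_one hS')).trans ?_
    filter_upwards [condExp_eq_w] with ω hω
    simp only [Pi.mul_apply, hω]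
  calc P⟦S ∩ U | m⟧ =ᵐ[P] P[P⟦S ∩ U | m₂⟧ | m] := (condExp_condExp_of_le hm hm₂).symm
    _ =ᵐ[P] P[w * U.indicator (fun _ => (1 : ℝ)) | m] := condExp_congr_ae condExp_inter
    _ =ᵐ[P] w * P⟦U | m⟧ := condExp_mul_of_stronglyMeasurable_left hw.stronglyMeasurable
        (integrable_mul integrable_w) (integrable_indicator_one hU')
    _ =ᵐ[P] P⟦S | m⟧ * P⟦U | m⟧ := condExp_S.symm.mul (ae_eq_refl _)

theorem condExp_map_eq (hm : m ≤ mΩ) {j : Ω → Ω} (hj : Measurable j)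
    (hpre : ∀ V, MeasurableSet[m] V → j ⁻¹' V = V) {f w : Ω → ℝ}
    (hf : Integrable f (P.map j)) (hw : Measurable[m] w) (h : P[f ∘ j | m] =ᵐ[P] w) :
    (P.map j)[f | m] =ᵐ[P.map j] w := by
  have measurable_w := hw.mono hm le_rfl
  have w_comp (ω : Ω) : w (j ω) = w ω := by
    have hω : ω ∈ j ⁻¹' (w ⁻¹' {w (j ω)}) := rfl
    rw [hpre _ (hw (measurableSet_singleton _))] at hω
    exact hω.symm
  have integrable_w : Integrable w (P.map j) := by
    rw [integrable_map_measure measurable_w.aestronglyMeasurable hj.aemeasurable]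
    exact (integrable_condExp.congr h).congr (Eventually.of_forall fun ω => (w_comp ω).symm)
  refine (ae_eq_condExp_of_forall_setIntegral_eq hm hf (fun _ _ _ => integrable_w.integrableOn)
    (fun V hV _ => ?_) hw.stronglyMeasurable.aestronglyMeasurable).symm
  rw [setIntegral_map (hm V hV) measurable_w.aestronglyMeasurable hj.aemeasurable,
    setIntegral_map (hm V hV) hf.1 hj.aemeasurable, hpre V hV]
  calc ∫ ω in V, w (j ω) ∂P = ∫ ω in V, P[f ∘ j | m] ω ∂P := by
        refine setIntegral_congr_ae (hm V hV) ?_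
        filter_upwards [h] with ω hω _
        rw [w_comp, hω]
    _ = ∫ ω in V, f (j ω) ∂P := setIntegral_condExp hm (hf.comp_measurable hj) hV

end CondIndependent

section Admissible

/-- The completion of a filtration by the null sets of the ambient σ-algebra. -/
def completeFiltration {Ω ι : Type*} [Preorder ι] {mΩ : MeasurableSpace Ω} (P : Measure Ω)
    (f : Filtration ι mΩ) : Filtration ι mΩ where
  seq t := eventuallyMeasurableSpace (f t) (ae P) ⊓ mΩ
  mono' _ _ hst := inf_le_inf_right _ fun _ ⟨S', h, h'⟩ => ⟨S', f.mono hst S' h, h'⟩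
  le' _ := inf_le_right

theorem measurableSet_completeFiltration {Ω ι : Type*} [Preorder ι] {mΩ : MeasurableSpace Ω}
    {P : Measure Ω} {f : Filtration ι mΩ} {t : ι} {S : Set Ω} :
    MeasurableSet[completeFiltration P f t] S ↔
      (∃ S', MeasurableSet[f t] S' ∧ S =ᵐ[P] S') ∧ MeasurableSet[mΩ] S :=
  MeasurableSpace.measurableSet_inf

theorem rightCont_top {ι Ω : Type*} [LinearOrder ι] [OrderTop ι] {mΩ : MeasurableSpace Ω}
    (f : Filtration ι mΩ) : f.rightCont ⊤ = f ⊤ :=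
  f.rightCont_eq_of_isMax isMax_top

variable {T : ℝ} [Fact (0 < T)] {d k : ℕ}

/-- The canonical space of pairs `(L,A)`. -/
abbrev Pair (T : ℝ) [Fact (0 < T)] (d k : ℕ) : Type := Skorokhod T d × IncSkorokhod T k

theorem measurable_eval_filtL {s t : Time T} (hst : s ≤ t) :
    Measurable[filtL T d k t] fun ω : Pair T d k => ω.1 s :=
  Measurable.of_comap_le (le_iSup₂_of_le s hst le_rfl)

theorem measurable_eval_filtA {s t : Time T} (hst : s ≤ t) :
    Measurable[filtA T d k t] fun ω : Pair T d k => ω.2 s :=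
  Measurable.of_comap_le (le_iSup₂_of_le s hst le_rfl)

theorem filtL_le_comap (t : Time T) :
    filtL T d k t ≤ MeasurableSpace.comap Prod.fst inferInstance := by
  refine iSup₂_le fun s _ =>
    le_trans ?_ (MeasurableSpace.comap_mono (Skorokhod.measurable_eval s).comap_le)
  rw [MeasurableSpace.comap_comp]
  exact le_rfl

theorem rightCont_filtL_le (t : Time T) : (filtL T d k).rightCont t ≤ filtL T d k ⊤ :=
  ((filtL T d k).rightCont.mono le_top).trans_eq (rightCont_top _)

/-- The usual augmentation, under `P`, of the filtration generated by `(L,A)`. -/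
def augFiltration (P : Measure (Pair T d k)) :
    Filtration (Time T) (inferInstance : MeasurableSpace (Pair T d k)) :=
  (completeFiltration P (filtL T d k ⊔ filtA T d k)).rightCont

instance (P : Measure (Pair T d k)) : (augFiltration P).IsRightContinuous := by
  unfold augFiltration; infer_instance

theorem le_augFiltration (P : Measure (Pair T d k)) (t : Time T) :
    filtL T d k t ⊔ filtA T d k t ≤ augFiltration P t := fun S hS =>
  Filtration.le_rightCont _ t S (measurableSet_completeFiltration.2
    ⟨⟨S, hS, ae_eq_refl _⟩, (filtL T d k ⊔ filtA T d k).le t S hS⟩)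

theorem measurableSet_augFiltration_of_null {P : Measure (Pair T d k)} (t : Time T)
    {S : Set (Pair T d k)} (hS : MeasurableSet S) (h0 : P S = 0) :
    MeasurableSet[augFiltration P t] S :=
  Filtration.le_rightCont _ t S (measurableSet_completeFiltration.2
    ⟨⟨∅, ((filtL T d k ⊔ filtA T d k) t).measurableSet_empty, ae_eq_empty.2 h0⟩, hS⟩)

theorem exists_measurableSet_of_augFiltration {P : Measure (Pair T d k)} {t s : Time T}
    (hts : t < s) {S : Set (Pair T d k)} (hS : MeasurableSet[augFiltration P t] S) :
    ∃ S', MeasurableSet[filtL T d k s ⊔ filtA T d k s] S' ∧ S =ᵐ[P] S' := by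
  have := nhdsGT_neBot_of_lt_top (hts.trans_le le_top)
  rw [augFiltration, Filtration.rightCont_eq_of_neBot_nhdsGT] at hS
  simp only [MeasurableSpace.measurableSet_iInf] at hS
  exact (measurableSet_completeFiltration.1 (hS s hts)).1

theorem measurable_fst_eval_augFiltration (P : Measure (Pair T d k)) (t : Time T) :
    Measurable[augFiltration P t] fun ω => ω.1 t :=
  (measurable_eval_filtL le_rfl).mono (le_sup_left.trans (le_augFiltration P t)) le_rfl

variable {P₀ : Measure (Skorokhod T d)} {P : Measure (Pair T d k)}

theorem Admissible.exists_condExp_eq_of_lt (hP : Admissible P₀ P) {t s : Time T} (hts : t < s)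
    {S : Set (Pair T d k)} (hS : MeasurableSet[augFiltration P t] S) :
    ∃ w : Pair T d k → ℝ, Measurable[(filtL T d k).rightCont s] w ∧
      P⟦S | filtL T d k ⊤⟧ =ᵐ[P] w := by
  have := hP.isProbabilityMeasure
  obtain ⟨S', hS', S_ae_eq⟩ := exists_measurableSet_of_augFiltration hts hS
  exact ⟨P⟦S' | (filtL T d k).rightCont s⟧, stronglyMeasurable_condExp.measurable,
    (condExp_congr_ae (indicator_ae_eq_of_ae_eq_set S_ae_eq)).trans
      ((hP.condIndep s).condExp_indicator_eq ((filtL T d k).le_rightCont s)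
        (rightCont_filtL_le s) ((filtA T d k).le s) ((filtL T d k).le ⊤) hS').symm⟩

/-- The augmented filtration still does not anticipate `L`: conditional independence at the times
`s > t` passes to the limit `s ↓ t`. -/
theorem Admissible.exists_condExp_eq (hP : Admissible P₀ P) {t : Time T} {S : Set (Pair T d k)}
    (hS : MeasurableSet[augFiltration P t] S) :
    ∃ w : Pair T d k → ℝ, Measurable[(filtL T d k).rightCont t] w ∧
      P⟦S | filtL T d k ⊤⟧ =ᵐ[P] w := by
  rcases eq_or_lt_of_le (le_top (a := t)) with rfl | ht
  · refine ⟨_, ?_, ae_eq_refl _⟩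
    rw [rightCont_top]
    exact stronglyMeasurable_condExp.measurable
  obtain ⟨s, -, hts, s_tendsto⟩ := exists_seq_strictAnti_tendsto' ht
  choose w hw condExp_eq using fun n => hP.exists_condExp_eq_of_lt (hts n).1 hS
  refine ⟨fun ω => limsup (fun n => w n ω) atTop, measurable_of_forall_gt ht fun r hr => ?_, ?_⟩
  · obtain ⟨n₀, hn₀⟩ := eventually_atTop.1 (s_tendsto.eventually (gt_mem_nhds hr))
    simp_rw [← fun ω => limsup_nat_add (fun n => w n ω) n₀]
    exact Measurable.limsup fun n => (hw _).mono
      ((filtL T d k).rightCont.mono (hn₀ _ (Nat.le_add_left _ _)).le) le_rfl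
  · filter_upwards [ae_all_iff.2 condExp_eq] with ω hω
    simp [← hω]

/-- A control: a random nondecreasing path on the space of pairs `(L,A)`, adapted to the augmented
filtration. -/
def IsControl (P : Measure (Pair T d k)) (a : Pair T d k → IncSkorokhod T k) : Prop :=
  ∀ t, Measurable[augFiltration P t] fun ω => a ω t

theorem isControl_snd : IsControl P fun ω => ω.2 := fun t =>
  (measurable_eval_filtA le_rfl).mono (le_sup_right.trans (le_augFiltration P t)) le_rfl

namespace IsControl

variable {a : Pair T d k → IncSkorokhod T k} (ha : IsControl P a)

include ha

theorem measurable_eval (t : Time T) : Measurable fun ω => a ω t :=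
  (ha t).mono ((augFiltration P).le t) le_rfl

theorem measurable : Measurable a := IncSkorokhod.measurable_iff.2 ha.measurable_eval

theorem measurable_prodMk : Measurable fun ω => (ω.1, a ω) := measurable_fst.prodMk ha.measurable

theorem measurableSet_preimage_prodMk {t : Time T} {S : Set (Pair T d k)}
    (hS : MeasurableSet[filtA T d k t] S) :
    MeasurableSet[augFiltration P t] ((fun ω => (ω.1, a ω)) ⁻¹' S) := by
  have le_map : filtA T d k t ≤ (augFiltration P t).map fun ω => (ω.1, a ω) := by
    refine iSup₂_le fun s hs => ?_
    rw [MeasurableSpace.comap_le_iff_le_map]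
    exact ((ha s).mono ((augFiltration P).mono hs) le_rfl).le_map
  exact le_map S hS

theorem admissible_map (hP : Admissible P₀ P) : Admissible P₀ (P.map fun ω => (ω.1, a ω)) := by
  have := hP.isProbabilityMeasure
  have measurable_j := ha.measurable_prodMk
  set j : Pair T d k → Pair T d k := fun ω => (ω.1, a ω)
  have isProbabilityMeasure : IsProbabilityMeasure (P.map j) :=
    Measure.isProbabilityMeasure_map measurable_j.aemeasurable
  refine ⟨isProbabilityMeasure, ?_, fun t => ?_⟩
  · rw [Measure.map_map measurable_fst measurable_j]
    exact hP.marginal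
  have preimage_eq (V : Set (Pair T d k)) (hV : MeasurableSet[filtL T d k ⊤] V) :
      j ⁻¹' V = V := by
    obtain ⟨B, -, rfl⟩ := filtL_le_comap ⊤ V hV
    rfl
  refine condIndependent_of_condExp_eq (rightCont_filtL_le t) ((filtA T d k).le t)
    ((filtL T d k).le ⊤) fun S hS => ?_
  obtain ⟨w, hw, condExp_eq_w⟩ := hP.exists_condExp_eq (ha.measurableSet_preimage_prodMk hS)
  exact ⟨w, hw, condExp_map_eq ((filtL T d k).le ⊤) measurable_j preimage_eq
    (integrable_indicator_one ((filtA T d k).le t S hS)) (hw.mono (rightCont_filtL_le t) le_rfl)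
    condExp_eq_w⟩

end IsControl

end Admissible

/-! ### The cost functional -/

section WeakConvergence

theorem lipschitzWith_integral {X : Type*} [TopologicalSpace X] [CompactSpace X]
    [MeasurableSpace X] [BorelSpace X] {μ : Measure X} [IsFiniteMeasure μ] {C : ℝ≥0}
    (hμ : μ.real univ ≤ C) : LipschitzWith C fun f : C(X, ℝ) => ∫ x, f x ∂μ := by
  refine LipschitzWith.of_dist_le_mul fun f g => ?_
  have integrable_coe (f : C(X, ℝ)) : Integrable f μ :=
    f.continuous.integrable_of_hasCompactSupport (HasCompactSupport.of_compactSpace f)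
  rw [dist_eq_norm, ← integral_sub (integrable_coe f) (integrable_coe g), mul_comm]
  refine (norm_integral_le_of_norm_le_const (C := dist f g) (.of_forall fun x => ?_)).trans
    (mul_le_mul_of_nonneg_left hμ dist_nonneg)
  exact (dist_eq_norm (f x) (g x)).symm.trans_le (ContinuousMap.dist_apply_le_dist x)

theorem setIntegral_Ici_leb {T : ℝ} (ψ : ℝ → ℝ) (t : Time T) :
    ∫ s in Ici t, ψ s ∂leb T = ∫ s in t..T, ψ s := by
  have image_Ici : Subtype.val '' Ici t = Icc (t : ℝ) T := by
    ext s
    exact ⟨by rintro ⟨s, hs, rfl⟩; exact ⟨hs, s.2.2⟩,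
      fun hs => ⟨⟨s, t.2.1.trans hs.1, hs.2⟩, hs.1, rfl⟩⟩
  have embedding := MeasurableEmbedding.subtype_coe (measurableSet_Icc : MeasurableSet (Icc 0 T))
  rw [intervalIntegral.integral_of_le t.2.2, ← integral_Icc_eq_integral_Ioc, ← image_Ici, leb,
    embedding.restrict_comap, ← embedding.integral_map, embedding.map_comap,
    Measure.restrict_restrict embedding.measurableSet_range,
    inter_eq_right.2 (image_subset_range _ _)]

variable {T : ℝ} [Fact (0 < T)] {k : ℕ} {a : ℕ → IncSkorokhod T k} {A : IncSkorokhod T k}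
  {i : Fin k}

namespace IncSkorokhod

theorem tendsto_integral_mul (htop : Tendsto (fun n => a n ⊤ i) atTop (𝓝 (A ⊤ i)))
    (hae : ∀ᵐ s ∂leb T, Tendsto (fun n => a n s i) atTop (𝓝 (A s i))) {ψ : Time T → ℝ}
    (hψ : Integrable ψ (leb T)) :
    Tendsto (fun n => ∫ s, ψ s * a n s i ∂leb T) atTop (𝓝 (∫ s, ψ s * A s i ∂leb T)) := by
  obtain ⟨R, hR⟩ := htop.bddAbove_range
  refine tendsto_integral_of_dominated_convergence (fun s => ‖ψ s‖ * R)
    (fun n => hψ.aestronglyMeasurable.mul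
      (measurable_euclidean_iff.1 (a n).2.1.measurable i).aestronglyMeasurable)
    (hψ.norm.mul_const R) (fun n => .of_forall fun s => ?_) ?_
  · rw [norm_mul, Real.norm_of_nonneg ((a n).nonneg i s)]
    exact mul_le_mul_of_nonneg_left (((a n).apply_le_apply_top i s).trans (hR ⟨n, rfl⟩))
      (norm_nonneg _)
  · filter_upwards [hae] with s hs using hs.const_mul _

theorem integral_polynomial (A : IncSkorokhod T k) (i : Fin k) (p : Polynomial ℝ) :
    ∫ t, p.eval (t : ℝ) ∂(A.dMeasure i) =
      p.eval T * A ⊤ i - ∫ s, p.derivative.eval (s : ℝ) * A s i ∂leb T := by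
  have integrable_of_continuous {ψ : Time T → ℝ} (hψ : Continuous ψ) (μ : Measure (Time T))
      [IsFiniteMeasure μ] : Integrable ψ μ :=
    hψ.integrable_of_hasCompactSupport (HasCompactSupport.of_compactSpace ψ)
  have primitive (t : Time T) :
      ∫ s in Ici t, p.derivative.eval (s : ℝ) ∂leb T = p.eval T - p.eval (t : ℝ) := by
    rw [setIntegral_Ici_leb fun s => p.derivative.eval s]
    exact intervalIntegral.integral_eq_sub_of_hasDerivAt (fun s _ => p.hasDerivAt s)
      (p.derivative.continuous.intervalIntegrable _ _)
  have hp : Continuous fun t : Time T => p.eval (t : ℝ) :=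
    p.continuous.comp continuous_subtype_val
  have hp' : Continuous fun t : Time T => p.derivative.eval (t : ℝ) :=
    p.derivative.continuous.comp continuous_subtype_val
  rw [← A.integral_setIntegral_Ici i (integrable_of_continuous hp' _)]
  simp only [primitive]
  rw [integral_sub (integrable_const _) (integrable_of_continuous hp _), integral_const,
    A.dMeasure_real_univ, smul_eq_mul, mul_comm, sub_sub_cancel]

/-- By the Weierstrass theorem it is enough to test the convergence on polynomials, which are
integrated by parts. -/
theorem tendsto_integral_of_tendsto (htop : Tendsto (fun n => a n ⊤ i) atTop (𝓝 (A ⊤ i)))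
    (hae : ∀ᵐ s ∂leb T, Tendsto (fun n => a n s i) atTop (𝓝 (A s i))) {f : Time T → ℝ}
    (hf : Continuous f) :
    Tendsto (fun n => ∫ t, f t ∂((a n).dMeasure i)) atTop (𝓝 (∫ t, f t ∂(A.dMeasure i))) := by
  obtain ⟨R, hR⟩ := htop.bddAbove_range
  have mass_le (n : ℕ) : ((a n).dMeasure i).real univ ≤ R.toNNReal := by
    rw [(a n).dMeasure_real_univ]
    exact (hR ⟨n, rfl⟩).trans (Real.le_coe_toNNReal R)
  let good : Set C(Time T, ℝ) := {f | Tendsto (fun n => ∫ t, f t ∂((a n).dMeasure i)) atTop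
    (𝓝 (∫ t, f t ∂(A.dMeasure i)))}
  have isClosed_good : IsClosed good :=
    (LipschitzWith.uniformEquicontinuous _ _ fun n =>
      lipschitzWith_integral (mass_le n)).equicontinuous.isClosed_setOfPred_tendsto
      (lipschitzWith_integral (C := ((A.dMeasure i).real univ).toNNReal)
        (Real.le_coe_toNNReal _)).continuous
  have polynomial_mem_good : (polynomialFunctions (Icc 0 T) : Set C(Time T, ℝ)) ⊆ good := by
    rw [polynomialFunctions_coe]
    rintro _ ⟨p, rfl⟩
    change Tendsto (fun n => ∫ t : Time T, p.eval (t : ℝ) ∂((a n).dMeasure i)) atTop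
      (𝓝 (∫ t : Time T, p.eval (t : ℝ) ∂(A.dMeasure i)))
    simp_rw [integral_polynomial]
    exact (htop.const_mul _).sub (tendsto_integral_mul htop hae
      ((p.derivative.continuous.comp continuous_subtype_val).integrable_of_hasCompactSupport
        (HasCompactSupport.of_compactSpace _)))
  have mem_closure :
      (⟨f, hf⟩ : C(Time T, ℝ)) ∈ (polynomialFunctions (Icc 0 T)).topologicalClosure :=
    polynomialFunctions_closure_eq_top 0 T ▸ trivial
  exact closure_minimal polynomial_mem_good isClosed_good mem_closure

end IncSkorokhod

end WeakConvergence

section Measurability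

variable {T : ℝ} [Fact (0 < T)] {d k : ℕ} {Ω : Type*} [MeasurableSpace Ω]
  {L : Ω → Skorokhod T d} {a : Ω → IncSkorokhod T k}

theorem measurable_riemannSum (n : ℕ) {y b : Ω → Time T → ℝ}
    (hy : ∀ t, Measurable fun ω => y ω t) (hb : ∀ t, Measurable fun ω => b ω t) :
    Measurable fun ω => riemannSum n (y ω) (b ω) := by
  refine Finset.measurable_fun_sum _ fun j _ => Measurable.mul ?_ (hy _)
  cases j with
  | zero => exact hb _
  | succ j => exact (hb _).sub (hb _)

theorem measurable_integral_dMeasure {N : ℕ} {y : Ω → Time T → E N} (ha : Measurable a)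
    (hy : ∀ ω, IsCadlag (y ω)) (hym : ∀ t, Measurable fun ω => y ω t) (i : Fin k) (l : Fin N) :
    Measurable fun ω => ∫ t, y ω t l ∂((a ω).dMeasure i) :=
  measurable_of_tendsto_metrizable
    (fun n => measurable_riemannSum n (fun t => measurable_euclidean_iff.1 (hym t) l)
      fun t => measurable_euclidean_iff.1 (IncSkorokhod.measurable_iff.1 ha t) i)
    (tendsto_pi_nhds.2 fun ω => (a ω).tendsto_riemannSum i (hy ω) l)

theorem measurable_uncurry_skorokhod (hL : Measurable L) :
    Measurable fun p : Ω × Time T => L p.1 p.2 :=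
  measurable_uncurry_of_isCadlag (fun ω => (L ω).2) (Skorokhod.measurable_iff.1 hL)

theorem measurable_uncurry_incSkorokhod (ha : Measurable a) :
    Measurable fun p : Ω × Time T => a p.1 p.2 :=
  measurable_uncurry_of_isCadlag (fun ω => (a ω).2.1) (IncSkorokhod.measurable_iff.1 ha)

end Measurability

section Cost

variable {T : ℝ} {d k : ℕ}

theorem CostData.continuous_f_apply (c : CostData T d k) (i : Fin k) :
    Continuous fun t => c.f t i :=
  (by fun_prop : Continuous fun a : E k => a i).comp c.f_continuous

variable [Fact (0 < T)]

/-- The midpoint of two nondecreasing paths. -/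
def IncSkorokhod.mid (A B : IncSkorokhod T k) : IncSkorokhod T k :=
  ⟨fun t => (1 / 2 : ℝ) • A t + (1 / 2 : ℝ) • B t,
    A.2.1.map₂ B.2.1 (F := fun a b => (1 / 2 : ℝ) • a + (1 / 2 : ℝ) • b) (by fun_prop),
    fun i s t hst => add_le_add (mul_le_mul_of_nonneg_left (A.2.2.1 i hst) (by norm_num))
      (mul_le_mul_of_nonneg_left (B.2.2.1 i hst) (by norm_num)),
    fun i => add_nonneg (mul_nonneg (by norm_num) (A.nonneg i ⊥))
      (mul_nonneg (by norm_num) (B.nonneg i ⊥))⟩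

theorem IncSkorokhod.mid_apply (A B : IncSkorokhod T k) (t : Time T) (i : Fin k) :
    A.mid B t i = 1 / 2 * A t i + 1 / 2 * B t i := rfl

theorem inv_two_eq_ofReal_half : (2⁻¹ : ℝ≥0∞) = ENNReal.ofReal (1 / 2) := by
  rw [one_div, ENNReal.ofReal_inv_of_pos two_pos, ENNReal.ofReal_ofNat]

theorem ofReal_convex_mid {F : Type*} [AddCommMonoid F] [Module ℝ F] {s : Set F} {φ : F → ℝ}
    (hφ : ConvexOn ℝ s φ) (hnonneg : ∀ a ∈ s, 0 ≤ φ a) {a b : F} (ha : a ∈ s) (hb : b ∈ s) :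
    ENNReal.ofReal (φ ((1 / 2 : ℝ) • a + (1 / 2 : ℝ) • b)) ≤
      2⁻¹ * ENNReal.ofReal (φ a) + 2⁻¹ * ENNReal.ofReal (φ b) := by
  rw [inv_two_eq_ofReal_half, ← ENNReal.ofReal_mul (by norm_num),
    ← ENNReal.ofReal_mul (by norm_num),
    ← ENNReal.ofReal_add (mul_nonneg (by norm_num) (hnonneg a ha))
      (mul_nonneg (by norm_num) (hnonneg b hb))]
  exact ENNReal.ofReal_le_ofReal (hφ.2 ha hb (by norm_num) (by norm_num) (by norm_num))

namespace CostData

variable (c : CostData T d k)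

/-- The part `∫_{[0,T]} f dA` of the cost. -/
def fInt (A : IncSkorokhod T k) : ℝ := ∑ i, ∫ t, c.f t i ∂(A.dMeasure i)

theorem integrable_f_apply (A : IncSkorokhod T k) (i : Fin k) :
    Integrable (fun t => c.f t i) (A.dMeasure i) :=
  (isCadlag_of_continuous c.f_continuous).integrable_apply i _

theorem fInt_nonneg (A : IncSkorokhod T k) : 0 ≤ c.fInt A :=
  Finset.sum_nonneg fun i _ => integral_nonneg fun t => c.f_mem t i

theorem fInt_linear {A B C : IncSkorokhod T k} {α β : ℝ} (hα : 0 ≤ α) (hβ : 0 ≤ β)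
    (h : ∀ t i, C t i = α * A t i + β * B t i) : c.fInt C = α * c.fInt A + β * c.fInt B := by
  rw [fInt, fInt, fInt, Finset.mul_sum, Finset.mul_sum, ← Finset.sum_add_distrib]
  refine Finset.sum_congr rfl fun i _ => ?_
  rw [IncSkorokhod.dMeasure_eq_of_linear hα hβ fun t => h t i,
    integral_add_measure ((c.integrable_f_apply A i).smul_measure ENNReal.ofReal_ne_top)
      ((c.integrable_f_apply B i).smul_measure ENNReal.ofReal_ne_top),
    integral_smul_measure, integral_smul_measure, ENNReal.toReal_ofReal hα,
    ENNReal.toReal_ofReal hβ, smul_eq_mul, smul_eq_mul]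

theorem cost_eq (L : Skorokhod T d) (A : IncSkorokhod T k) :
    c.cost L A = ENNReal.ofReal (c.fInt A) + (∫⁻ t, ENNReal.ofReal (c.h (L t) (A t)) ∂leb T)
      + ENNReal.ofReal (c.g (L ⊤) (A ⊤)) := by
  rw [cost, fInt, ENNReal.ofReal_sum_of_nonneg fun i _ => integral_nonneg fun t => c.f_mem t i]
  congr 2
  exact Finset.sum_congr rfl fun i _ => (ofReal_integral_eq_lintegral_ofReal
    (c.integrable_f_apply A i) (.of_forall fun t => c.f_mem t i)).symm

theorem measurable_h_path (L : Skorokhod T d) (A : IncSkorokhod T k) :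
    Measurable fun t => c.h (L t) (A t) :=
  measurable_comp_of_mem c.h_measurable L.2.measurable A.2.1.measurable A.mem_orthant

theorem cost_mid_le (L : Skorokhod T d) (A B : IncSkorokhod T k) :
    c.cost L (A.mid B) ≤ 2⁻¹ * c.cost L A + 2⁻¹ * c.cost L B := by
  have fInt_mid : ENNReal.ofReal (c.fInt (A.mid B)) =
      2⁻¹ * ENNReal.ofReal (c.fInt A) + 2⁻¹ * ENNReal.ofReal (c.fInt B) := by
    rw [c.fInt_linear (by norm_num) (by norm_num) (A.mid_apply B), inv_two_eq_ofReal_half,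
      ENNReal.ofReal_add (mul_nonneg (by norm_num) (c.fInt_nonneg A))
        (mul_nonneg (by norm_num) (c.fInt_nonneg B)),
      ENNReal.ofReal_mul (by norm_num), ENNReal.ofReal_mul (by norm_num)]
  have running_mid_le : ∫⁻ t, ENNReal.ofReal (c.h (L t) (A.mid B t)) ∂leb T ≤
      2⁻¹ * (∫⁻ t, ENNReal.ofReal (c.h (L t) (A t)) ∂leb T) +
        2⁻¹ * ∫⁻ t, ENNReal.ofReal (c.h (L t) (B t)) ∂leb T := by
    have hA := (c.measurable_h_path L A).ennreal_ofReal
    have hB := (c.measurable_h_path L B).ennreal_ofReal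
    rw [← lintegral_const_mul _ hA, ← lintegral_const_mul _ hB,
      ← lintegral_add_left (hA.const_mul _)]
    exact lintegral_mono fun t => ofReal_convex_mid (c.h_convex _) (c.h_nonneg _)
      (A.mem_orthant t) (B.mem_orthant t)
  have terminal_mid_le := ofReal_convex_mid (c.g_convex (L ⊤)) (c.g_nonneg _) (A.mem_orthant ⊤)
    (B.mem_orthant ⊤)
  rw [c.cost_eq, c.cost_eq, c.cost_eq, fInt_mid]
  refine (add_le_add (add_le_add le_rfl running_mid_le) terminal_mid_le).trans_eq ?_
  ring

variable {Ω : Type*} [MeasurableSpace Ω] {L : Ω → Skorokhod T d} {a : Ω → IncSkorokhod T k}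

theorem measurable_fInt (ha : Measurable a) : Measurable fun ω => c.fInt (a ω) :=
  Finset.measurable_fun_sum _ fun i _ => measurable_integral_dMeasure ha
    (fun _ => isCadlag_of_continuous c.f_continuous) (fun _ => measurable_const) i i

theorem measurable_h_uncurry (hL : Measurable L) (ha : Measurable a) :
    Measurable fun p : Ω × Time T => c.h (L p.1 p.2) (a p.1 p.2) :=
  measurable_comp_of_mem c.h_measurable (measurable_uncurry_skorokhod hL)
    (measurable_uncurry_incSkorokhod ha) fun p => (a p.1).mem_orthant p.2

theorem measurable_g_top (hL : Measurable L) (ha : Measurable a) :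
    Measurable fun ω => c.g (L ω ⊤) (a ω ⊤) :=
  measurable_comp_of_mem c.g_measurable (Skorokhod.measurable_iff.1 hL ⊤)
    (IncSkorokhod.measurable_iff.1 ha ⊤) fun ω => (a ω).mem_orthant ⊤

theorem measurable_cost (hL : Measurable L) (ha : Measurable a) :
    Measurable fun ω => c.cost (L ω) (a ω) := by
  simp_rw [c.cost_eq]
  exact ((c.measurable_fInt ha).ennreal_ofReal.add
    (c.measurable_h_uncurry hL ha).ennreal_ofReal.lintegral_prod_right').add
      (c.measurable_g_top hL ha).ennreal_ofReal

end CostData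

theorem tendsto_ofReal_apply_of_isC1InControl {φ : E d → E k → ℝ} (hφ : IsC1InControl φ) (l : E d)
    {a : ℕ → IncSkorokhod T k} {A : IncSkorokhod T k} {t : Time T}
    (h : ∀ i, Tendsto (fun n => a n t i) atTop (𝓝 (A t i))) :
    Tendsto (fun n => ENNReal.ofReal (φ l (a n t))) atTop (𝓝 (ENNReal.ofReal (φ l (A t)))) := by
  have tendsto_orthant : Tendsto (fun n => a n t) atTop (𝓝[orthant k] (A t)) :=
    tendsto_nhdsWithin_iff.2 ⟨tendsto_euclidean_iff.2 h, .of_forall fun n => (a n).mem_orthant t⟩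
  exact (ENNReal.continuous_ofReal.tendsto _).comp
    (((hφ l).continuousOn _ (A.mem_orthant t)).tendsto.comp tendsto_orthant)

theorem liminf_add_liminf_le (u v : ℕ → ℝ≥0∞) :
    liminf u atTop + liminf v atTop ≤ liminf (fun n => u n + v n) atTop := by
  have monotone_iInf (w : ℕ → ℝ≥0∞) : Monotone fun n => ⨅ i, w (i + n) := fun m n hmn =>
    le_iInf fun i => (iInf_le _ (i + (n - m))).trans_eq (by congr 1; omega)
  rw [liminf_eq_iSup_iInf_of_nat', liminf_eq_iSup_iInf_of_nat', liminf_eq_iSup_iInf_of_nat',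
    ENNReal.iSup_add_iSup_of_monotone (monotone_iInf u) (monotone_iInf v)]
  exact iSup_mono fun n => le_iInf fun i => add_le_add (iInf_le _ i) (iInf_le _ i)

theorem CostData.cost_le_liminf {c : CostData T d k} (hg : IsC1InControl c.g)
    (hh : IsC1InControl c.h) (L : Skorokhod T d) {a : ℕ → IncSkorokhod T k} {A : IncSkorokhod T k}
    (htop : ∀ i, Tendsto (fun n => a n ⊤ i) atTop (𝓝 (A ⊤ i)))
    (hae : ∀ᵐ t ∂leb T, ∀ i, Tendsto (fun n => a n t i) atTop (𝓝 (A t i))) :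
    c.cost L A ≤ liminf (fun n => c.cost L (a n)) atTop := by
  have tendsto_fInt : Tendsto (fun n => ENNReal.ofReal (c.fInt (a n))) atTop
      (𝓝 (ENNReal.ofReal (c.fInt A))) :=
    (ENNReal.continuous_ofReal.tendsto _).comp <| tendsto_finsetSum _ fun i _ =>
      IncSkorokhod.tendsto_integral_of_tendsto (htop i) (hae.mono fun t ht => ht i)
        (c.continuous_f_apply i)
  have running_le_liminf : ∫⁻ t, ENNReal.ofReal (c.h (L t) (A t)) ∂leb T ≤
      liminf (fun n => ∫⁻ t, ENNReal.ofReal (c.h (L t) (a n t)) ∂leb T) atTop := by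
    refine le_trans (lintegral_mono_ae ?_)
      (lintegral_liminf_le fun n => (c.measurable_h_path L (a n)).ennreal_ofReal)
    filter_upwards [hae] with t ht
    exact (tendsto_ofReal_apply_of_isC1InControl hh (L t) ht).liminf_eq.ge
  simp_rw [c.cost_eq]
  refine le_trans ?_ (liminf_add_liminf_le _ _)
  refine add_le_add (le_trans ?_ (liminf_add_liminf_le _ _))
    (tendsto_ofReal_apply_of_isC1InControl hg (L ⊤) htop).liminf_eq.ge
  exact add_le_add tendsto_fInt.liminf_eq.ge running_le_liminf

end Cost

/-! ### Almost sure selections from decreasing midpoint-convex sets -/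

section Komlos

theorem exists_seq_forall_add_sub_le {α : Type*} {K : ℕ → Set α} (hanti : Antitone K)
    (hne : ∀ n, (K n).Nonempty) {F : α → ℝ} {M : ℝ} (hF0 : ∀ x, 0 ≤ F x)
    (hFM : ∀ n, ∀ x ∈ K n, F x ≤ M) :
    ∃ (x : ℕ → α) (ε : ℕ → ℝ), (∀ n, x n ∈ K n) ∧ Tendsto ε atTop (𝓝 0) ∧
      ∀ N n m, N ≤ n → N ≤ m → ∀ y ∈ K N, F (x n) + F (x m) - 2 * F y ≤ ε N := by
  let I : ℕ → ℝ := fun n => sInf (F '' K n)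
  have bddBelow (n : ℕ) : BddBelow (F '' K n) := ⟨0, by rintro _ ⟨x, -, rfl⟩; exact hF0 x⟩
  have I_le (n : ℕ) {x : α} (hx : x ∈ K n) : I n ≤ F x := csInf_le (bddBelow n) ⟨x, hx, rfl⟩
  have monotone_I : Monotone I := fun m n hmn =>
    csInf_le_csInf (bddBelow m) ((hne n).image F) (image_mono (hanti hmn))
  have bddAbove_I : BddAbove (range I) := by
    refine ⟨M, ?_⟩
    rintro _ ⟨n, rfl⟩
    obtain ⟨x, hx⟩ := hne n
    exact (I_le n hx).trans (hFM n x hx)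
  have exists_lt (n : ℕ) : ∃ x ∈ K n, F x < I n + 1 / ((n : ℝ) + 1) := by
    obtain ⟨_, ⟨x, hx, rfl⟩, h⟩ := exists_lt_of_csInf_lt ((hne n).image F)
      (lt_add_of_pos_right (I n) (Nat.one_div_pos_of_nat (n := n)))
    exact ⟨x, hx, h⟩
  choose x hxK hxF using exists_lt
  refine ⟨x, fun N => 2 * ((⨆ n, I n) + 1 / ((N : ℝ) + 1) - I N), hxK, ?_, ?_⟩
  · simpa using ((tendsto_one_div_add_atTop_nhds_zero_nat.const_add (⨆ n, I n)).sub
      (tendsto_atTop_ciSup monotone_I bddAbove_I)).const_mul 2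
  · intro N n m hn hm y hy
    have F_le (j : ℕ) (hj : N ≤ j) : F (x j) ≤ (⨆ n, I n) + 1 / ((N : ℝ) + 1) :=
      (hxF j).le.trans (add_le_add (le_ciSup bddAbove_I j) (Nat.one_div_le_one_div hj))
    linarith [F_le n hn, F_le m hm, I_le N hy]

variable {S : Type*} [MeasurableSpace S] {μ : Measure S}

theorem exists_tendsto_of_tendsto_exp {x : ℕ → ℝ} {v : ℝ}
    (hv : Tendsto (fun n => Real.exp (-x n / 2)) atTop (𝓝 v))
    (hfin : liminf (fun n => ENNReal.ofReal (x n)) atTop < ∞) : ∃ y, Tendsto x atTop (𝓝 y) := by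
  rcases (ge_of_tendsto' hv fun n => (Real.exp_pos _).le).eq_or_lt with rfl | hpos
  · have tendsto_atTop : Tendsto x atTop atTop :=
      ((tendsto_neg_atBot_atTop.comp (Real.tendsto_exp_comp_nhds_zero.1 hv)).atTop_mul_const
        two_pos).congr fun n => by simp only [Function.comp]; ring
    exact absurd (ENNReal.tendsto_ofReal_atTop.comp tendsto_atTop).liminf_eq hfin.ne
  · refine ⟨-2 * Real.log v, ?_⟩
    refine (((Real.continuousAt_log hpos.ne').tendsto.comp hv).const_mul (-2)).congr fun n => ?_
    simp only [Function.comp, Real.log_exp]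
    ring

theorem ae_liminf_lt_top_of_lintegral_le {x : ℕ → S → ℝ≥0∞} (hx : ∀ n, Measurable (x n))
    {C : ℝ≥0∞} (hC : C < ∞) (hbdd : ∀ n, ∫⁻ s, x n s ∂μ ≤ C) :
    ∀ᵐ s ∂μ, liminf (fun n => x n s) atTop < ∞ := by
  refine ae_lt_top (Measurable.liminf hx) (((lintegral_liminf_le hx).trans ?_).trans_lt hC).ne
  refine liminf_le_of_le (by isBoundedDefault) fun b hb => ?_
  obtain ⟨n, hn⟩ := hb.exists
  exact hn.trans (hbdd n)

variable [IsFiniteMeasure μ]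

theorem integrable_exp_neg {x : S → ℝ} (hx : Measurable x) (h0 : ∀ s, 0 ≤ x s) :
    Integrable (fun s => Real.exp (-x s)) μ :=
  .of_bound (by fun_prop) 1 (.of_forall fun s => by
    rw [Real.norm_of_nonneg (Real.exp_nonneg _)]
    exact Real.exp_le_one_iff.2 (neg_nonpos.2 (h0 s)))

theorem memLp_exp_neg_half {x : S → ℝ} (hx : Measurable x) (h0 : ∀ s, 0 ≤ x s) :
    MemLp (fun s => Real.exp (-x s / 2)) 2 μ :=
  .of_bound (by fun_prop) 1 (.of_forall fun s => by
    rw [Real.norm_of_nonneg (Real.exp_nonneg _)]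
    exact Real.exp_le_one_iff.2 (by linarith [h0 s]))

/-- The strict convexity of `exp` in quantitative form:
`(e^{-x/2} - e^{-y/2})² = e^{-x} + e^{-y} - 2 e^{-(x+y)/2}`. -/
theorem norm_sq_toLp_sub {x y : S → ℝ} (hx : Measurable x) (hx0 : ∀ s, 0 ≤ x s)
    (hy : Measurable y) (hy0 : ∀ s, 0 ≤ y s) :
    ‖(memLp_exp_neg_half (μ := μ) hx hx0).toLp _ - (memLp_exp_neg_half (μ := μ) hy hy0).toLp _‖ ^ 2
      = (∫ s, Real.exp (-x s) ∂μ) + (∫ s, Real.exp (-y s) ∂μ)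
        - 2 * ∫ s, Real.exp (-((x s + y s) / 2)) ∂μ := by
  have integrable_mid : Integrable (fun s => 2 * Real.exp (-((x s + y s) / 2))) μ :=
    (integrable_exp_neg (x := fun s => (x s + y s) / 2) ((hx.add hy).div_const 2)
      fun s => div_nonneg (add_nonneg (hx0 s) (hy0 s)) zero_le_two).const_mul 2
  have integrable_add : Integrable (fun s => Real.exp (-x s) + Real.exp (-y s)) μ :=
    (integrable_exp_neg hx hx0).add (integrable_exp_neg hy hy0)
  have exp_neg_eq_sq (r : ℝ) : Real.exp (-r) = Real.exp (-r / 2) ^ 2 := by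
    rw [← Real.exp_nat_mul]; ring_nf
  have exp_mid_eq_mul (s : S) :
      Real.exp (-((x s + y s) / 2)) = Real.exp (-x s / 2) * Real.exp (-y s / 2) := by
    rw [← Real.exp_add]; ring_nf
  rw [← real_inner_self_eq_norm_sq, L2.inner_def, ← integral_const_mul, ← integral_add
    (integrable_exp_neg hx hx0) (integrable_exp_neg hy hy0),
    ← integral_sub integrable_add integrable_mid]
  refine integral_congr_ae ?_
  filter_upwards [Lp.coeFn_sub ((memLp_exp_neg_half (μ := μ) hx hx0).toLp _)
    ((memLp_exp_neg_half (μ := μ) hy hy0).toLp _), (memLp_exp_neg_half (μ := μ) hx hx0).coeFn_toLp,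
    (memLp_exp_neg_half (μ := μ) hy hy0).coeFn_toLp] with s hsub hxs hys
  rw [hsub, Pi.sub_apply, hxs, hys, real_inner_self_eq_norm_sq, Real.norm_eq_abs, sq_abs,
    exp_neg_eq_sq (x s), exp_neg_eq_sq (y s), exp_mid_eq_mul]
  ring

/-- A Komlós-type selection: the minimizers of the strictly convex functional `∫ exp (-x) dμ` over
the decreasing sets `K n` are Cauchy. -/
theorem exists_seq_ae_tendsto {K : ℕ → Set (S → ℝ)} (hanti : Antitone K)
    (hne : ∀ n, (K n).Nonempty) (hm : ∀ n, ∀ x ∈ K n, Measurable x)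
    (h0 : ∀ n, ∀ x ∈ K n, ∀ s, 0 ≤ x s)
    (hmid : ∀ n, ∀ x ∈ K n, ∀ y ∈ K n, (fun s => (x s + y s) / 2) ∈ K n) {C : ℝ≥0∞} (hC : C < ∞)
    (hbdd : ∀ n, ∀ x ∈ K n, ∫⁻ s, ENNReal.ofReal (x s) ∂μ ≤ C) :
    ∃ X : ℕ → S → ℝ, (∀ n, X n ∈ K n) ∧ ∀ᵐ s ∂μ, ∃ y, Tendsto (fun n => X n s) atTop (𝓝 y) := by
  obtain ⟨x, ε, hxK, hε, hle⟩ := exists_seq_forall_add_sub_le hanti hne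
    (F := fun x => ∫ s, Real.exp (-x s) ∂μ) (M := μ.real univ)
    (fun x => integral_nonneg fun s => (Real.exp_pos _).le) fun n x hx =>
      (integral_mono (integrable_exp_neg (hm n x hx) (h0 n x hx)) (integrable_const _)
        fun s => Real.exp_le_one_iff.2 (neg_nonpos.2 (h0 n x hx s))).trans_eq (by simp)
  have hmem (n : ℕ) := memLp_exp_neg_half (μ := μ) (hm n _ (hxK n)) (h0 n _ (hxK n))
  have cauchySeq : CauchySeq fun n => (hmem n).toLp _ := by
    refine cauchySeq_of_le_tendsto_0 (fun N => √(ε N)) (fun n m N hn hm' => ?_)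
      (by simpa using hε.sqrt)
    rw [dist_eq_norm]
    refine Real.le_sqrt_of_sq_le ?_
    rw [norm_sq_toLp_sub (hm n _ (hxK n)) (h0 n _ (hxK n)) (hm m _ (hxK m)) (h0 m _ (hxK m))]
    exact hle N n m hn hm' _ (hmid N _ (hanti hn (hxK n)) _ (hanti hm' (hxK m)))
  obtain ⟨v, hv⟩ := cauchySeq_tendsto_of_complete cauchySeq
  obtain ⟨ns, hns, hae⟩ := (tendstoInMeasure_of_tendsto_Lp hv).exists_seq_tendsto_ae
  refine ⟨fun n => x (ns n), fun n => hanti hns.le_apply (hxK (ns n)), ?_⟩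
  filter_upwards [hae, ae_liminf_lt_top_of_lintegral_le
    (fun n => (hm _ _ (hxK (ns n))).ennreal_ofReal) hC fun n => hbdd _ _ (hxK (ns n)),
    ae_all_iff.2 fun n => (hmem (ns n)).coeFn_toLp] with s hs hliminf hcoe
  simp_rw [hcoe] at hs
  exact exists_tendsto_of_tendsto_exp hs hliminf

end Komlos

/-! ### Existence of an optimal control -/

section Optimal

variable {T : ℝ} [Fact (0 < T)] {d k : ℕ} {P : Measure (Pair T d k)}

/-- The expected cost of a control. -/
def CostData.controlCost (c : CostData T d k) (P : Measure (Pair T d k))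
    (a : Pair T d k → IncSkorokhod T k) : ℝ≥0∞ :=
  ∫⁻ ω, c.cost ω.1 (a ω) ∂P

theorem CostData.expCost_map (c : CostData T d k) {a : Pair T d k → IncSkorokhod T k}
    (ha : IsControl P a) : c.expCost (P.map fun ω => (ω.1, a ω)) = c.controlCost P a :=
  lintegral_map (c.measurable_cost measurable_fst measurable_snd) ha.measurable_prodMk

theorem IsControl.mid {a b : Pair T d k → IncSkorokhod T k} (ha : IsControl P a)
    (hb : IsControl P b) : IsControl P fun ω => (a ω).mid (b ω) := fun t =>
  ((ha t).const_smul (1 / 2 : ℝ)).add ((hb t).const_smul (1 / 2 : ℝ))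

theorem CostData.controlCost_mid_le (c : CostData T d k) {a b : Pair T d k → IncSkorokhod T k}
    (ha : IsControl P a) (hb : IsControl P b) {v : ℝ≥0∞} (hav : c.controlCost P a ≤ v)
    (hbv : c.controlCost P b ≤ v) : c.controlCost P (fun ω => (a ω).mid (b ω)) ≤ v := by
  have measurable_cost_a := c.measurable_cost (L := Prod.fst) measurable_fst ha.measurable
  have measurable_cost_b := c.measurable_cost (L := Prod.fst) measurable_fst hb.measurable
  calc c.controlCost P (fun ω => (a ω).mid (b ω))
      ≤ ∫⁻ ω, (2⁻¹ * c.cost ω.1 (a ω) + 2⁻¹ * c.cost ω.1 (b ω)) ∂P :=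
        lintegral_mono fun ω => c.cost_mid_le _ _ _
    _ = 2⁻¹ * c.controlCost P a + 2⁻¹ * c.controlCost P b := by
        rw [lintegral_add_left (measurable_cost_a.const_mul _),
          lintegral_const_mul _ measurable_cost_a, lintegral_const_mul _ measurable_cost_b]
        rfl
    _ ≤ 2⁻¹ * v + 2⁻¹ * v := by gcongr
    _ = v := by rw [← add_mul, ENNReal.inv_two_add_inv_two, one_mul]

theorem CostData.LinearlyCoercive.exists_forall_lintegral_top_le {P₀ : Measure (Skorokhod T d)}
    {c : CostData T d k} (hc : c.LinearlyCoercive P₀) (hP : Admissible P₀ P) {v : ℝ≥0∞}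
    (hv : v < ∞) :
    ∃ C < ∞, ∀ a, IsControl P a → c.controlCost P a ≤ v → ∫⁻ ω, ‖a ω ⊤‖ₑ ∂P ≤ C := by
  obtain ⟨κ, K, hκ, -, coercive⟩ := hc
  have hκ0 : ENNReal.ofReal κ ≠ 0 := (ENNReal.ofReal_pos.2 hκ).ne'
  refine ⟨max (ENNReal.ofReal K) (v / ENNReal.ofReal κ),
    max_lt ENNReal.ofReal_lt_top (ENNReal.div_lt_top hv.ne hκ0), fun a ha hav => ?_⟩
  have lintegral_map_top :
      ∫⁻ ω, ‖ω.2 ⊤‖ₑ ∂(P.map fun ω => (ω.1, a ω)) = ∫⁻ ω, ‖a ω ⊤‖ₑ ∂P :=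
    lintegral_map ((IncSkorokhod.measurable_eval ⊤).comp measurable_snd).enorm ha.measurable_prodMk
  have coercive_a := coercive _ (ha.admissible_map hP)
  rw [lintegral_map_top, c.expCost_map ha] at coercive_a
  rcases le_total (ENNReal.ofReal K) (∫⁻ ω, ‖a ω ⊤‖ₑ ∂P) with large | small
  · refine le_max_of_le_right ((ENNReal.le_div_iff_mul_le (Or.inl hκ0)
      (Or.inl ENNReal.ofReal_ne_top)).2 ?_)
    rw [mul_comm]
    exact (coercive_a large).trans hav
  · exact le_max_of_le_left small

theorem exists_countable_dense_of_ae {p : Time T → Prop} (h : ∀ᵐ t ∂leb T, p t) (htop : p ⊤) :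
    ∃ D : Set (Time T), D.Countable ∧ Dense D ∧ ⊤ ∈ D ∧ ∀ t ∈ D, p t := by
  obtain ⟨D, hDp, hDc, hDd⟩ := (Measure.dense_of_ae h).exists_countable_dense_subset
  exact ⟨insert ⊤ D, hDc.insert _, hDd.mono (subset_insert _ _), mem_insert _ _,
    forall_mem_insert.2 ⟨htop, hDp⟩⟩

theorem IsControl.measurable_uncurry_apply {a : Pair T d k → IncSkorokhod T k}
    (ha : IsControl P a) :
    Measurable fun s : Fin k × Time T × Pair T d k => a s.2.2 s.2.1 s.1 :=
  measurable_from_prod_countable_right <| measurable_euclidean_iff.1 <|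
    (measurable_uncurry_incSkorokhod ha.measurable).comp measurable_swap

theorem lintegral_snd_prod {α β : Type*} [MeasurableSpace α] [MeasurableSpace β] (μ : Measure α)
    (ν : Measure β) [SFinite ν] {g : β → ℝ≥0∞} (hg : Measurable g) :
    ∫⁻ s, g s.2 ∂μ.prod ν = μ univ * ∫⁻ y, g y ∂ν := by
  rw [← lintegral_map hg measurable_snd, Measure.map_snd_prod, lintegral_smul_measure, smul_eq_mul]

theorem IsControl.lintegral_ofReal_apply_le [SFinite P] {a : Pair T d k → IncSkorokhod T k}
    (ha : IsControl P a) (κ : Measure (Fin k)) (ν : Measure (Time T)) [SFinite ν] :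
    ∫⁻ s, ENNReal.ofReal (a s.2.2 s.2.1 s.1) ∂κ.prod (ν.prod P) ≤
      κ univ * (ν univ * ∫⁻ ω, ‖a ω ⊤‖ₑ ∂P) := by
  have measurable_norm_top : Measurable fun ω => ‖a ω ⊤‖ₑ := (ha.measurable_eval ⊤).enorm
  calc ∫⁻ s, ENNReal.ofReal (a s.2.2 s.2.1 s.1) ∂κ.prod (ν.prod P)
      ≤ ∫⁻ s, ‖a s.2.2 ⊤‖ₑ ∂κ.prod (ν.prod P) := by
        refine lintegral_mono fun s => ?_
        rw [← ofReal_norm]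
        exact ENNReal.ofReal_le_ofReal (((a s.2.2).apply_le_apply_top _ _).trans
          ((le_abs_self _).trans (PiLp.norm_apply_le (a s.2.2 ⊤) s.1)))
    _ = κ univ * ∫⁻ p : Time T × Pair T d k, ‖a p.2 ⊤‖ₑ ∂ν.prod P :=
        lintegral_snd_prod κ (ν.prod P) (measurable_norm_top.comp measurable_snd)
    _ = κ univ * (ν univ * ∫⁻ ω, ‖a ω ⊤‖ₑ ∂P) :=
        congrArg _ (lintegral_snd_prod ν P measurable_norm_top)

theorem exists_controls_ae_tendsto {P₀ : Measure (Skorokhod T d)} {c : CostData T d k}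
    (hc : c.LinearlyCoercive P₀) (hP : Admissible P₀ P) {v : ℕ → ℝ≥0∞} (hv : Antitone v)
    (hv0 : v 0 < ∞) (hne : ∀ n, ∃ a, IsControl P a ∧ c.controlCost P a ≤ v n)
    (ν : Measure (Time T)) [IsFiniteMeasure ν] :
    ∃ a : ℕ → Pair T d k → IncSkorokhod T k,
      (∀ n, IsControl P (a n)) ∧ (∀ n, c.controlCost P (a n) ≤ v n) ∧
      ∀ᵐ t ∂ν, ∀ᵐ ω ∂P, ∀ i, ∃ y, Tendsto (fun n => a n ω t i) atTop (𝓝 y) := by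
  have := hP.isProbabilityMeasure
  obtain ⟨C, hC, lintegral_top_le⟩ := hc.exists_forall_lintegral_top_le hP hv0
  let κ : Measure (Fin k) := Measure.count
  let K : ℕ → Set (Fin k × Time T × Pair T d k → ℝ) := fun n =>
    {x | ∃ a, IsControl P a ∧ c.controlCost P a ≤ v n ∧ x = fun s => a s.2.2 s.2.1 s.1}
  have exists_seq : ∃ X : ℕ → Fin k × Time T × Pair T d k → ℝ, (∀ n, X n ∈ K n) ∧
      ∀ᵐ s ∂κ.prod (ν.prod P), ∃ y, Tendsto (fun n => X n s) atTop (𝓝 y) := by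
    refine exists_seq_ae_tendsto (C := κ univ * (ν univ * C)) ?_ ?_ ?_ ?_ ?_
      (ENNReal.mul_lt_top (measure_lt_top κ _) (ENNReal.mul_lt_top (measure_lt_top ν _) hC)) ?_
    · rintro m n hmn x ⟨a, ha, hav, rfl⟩
      exact ⟨a, ha, hav.trans (hv hmn), rfl⟩
    · intro n
      obtain ⟨a, ha, hav⟩ := hne n
      exact ⟨_, a, ha, hav, rfl⟩
    · rintro n _ ⟨a, ha, -, rfl⟩
      exact ha.measurable_uncurry_apply
    · rintro n _ ⟨a, -, -, rfl⟩ s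
      exact (a _).nonneg _ _
    · rintro n _ ⟨a, ha, hav, rfl⟩ _ ⟨b, hb, hbv, rfl⟩
      refine ⟨_, ha.mid hb, c.controlCost_mid_le ha hb hav hbv, funext fun s => ?_⟩
      rw [IncSkorokhod.mid_apply]
      ring
    · rintro n _ ⟨a, ha, hav, rfl⟩
      refine (ha.lintegral_ofReal_apply_le κ ν).trans ?_
      gcongr
      exact lintegral_top_le a ha (hav.trans (hv (Nat.zero_le n)))
  obtain ⟨X, hXK, hX⟩ := exists_seq
  choose a ha hav hXa using hXK
  refine ⟨a, ha, hav, ?_⟩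
  simp only [hXa] at hX
  filter_upwards [ae_all_iff.2 fun i => Measure.ae_ae_of_ae_prod
    (Measure.ae_count_iff.1 (Measure.ae_ae_of_ae_prod hX) i)] with t ht
  exact ae_all_iff.2 ht

theorem exists_adapted_limit {a : ℕ → Pair T d k → IncSkorokhod T k}
    (ha : ∀ n, IsControl P (a n)) {D : Set (Time T)} (hDc : D.Countable)
    (hlim : ∀ t ∈ D, ∀ᵐ ω ∂P, ∀ i, ∃ y, Tendsto (fun n => a n ω t i) atTop (𝓝 y)) :
    ∃ u : Pair T d k → Time T → E k, (∀ t, Measurable[augFiltration P t] fun ω => u ω t) ∧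
      (∀ ω i, MonotoneOn (fun t => u ω t i) D) ∧ (∀ ω, ∀ t ∈ D, ∀ i, 0 ≤ u ω t i) ∧
      ∀ᵐ ω ∂P, ∀ t ∈ D, ∀ i, Tendsto (fun n => a n ω t i) atTop (𝓝 (u ω t i)) := by
  classical
  obtain ⟨G, hGsub, hGm, hG0⟩ := exists_measurable_superset_of_null ((ae_ball_iff hDc).2 hlim)
  let u : Pair T d k → Time T → E k := fun ω t =>
    if ω ∈ G then 0 else WithLp.toLp 2 fun i => limsup (fun n => a n ω t i) atTop
  have u_eq_zero {ω} (hω : ω ∈ G) (t i) : u ω t i = 0 := by simp [u, hω]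
  have tendsto_u {ω} (hω : ω ∉ G) (t) (ht : t ∈ D) (i) :
      Tendsto (fun n => a n ω t i) atTop (𝓝 (u ω t i)) := by
    obtain ⟨y, hy⟩ := not_not.1 (notMem_subset hGsub hω) t ht i
    simpa only [u, if_neg hω, hy.limsup_eq] using hy
  refine ⟨u, fun t => ?_, fun ω i s hs t ht hst => ?_, fun ω t ht i => ?_, ?_⟩
  · refine Measurable.ite (measurableSet_augFiltration_of_null t hGm hG0) measurable_const ?_
    refine (@measurable_euclidean_iff _ _ (augFiltration P t) _).2 fun i => ?_
    exact Measurable.limsup fun n =>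
      (@measurable_euclidean_iff _ _ (augFiltration P t) _).1 (ha n t) i
  · by_cases hω : ω ∈ G
    · simp only [u_eq_zero hω, le_rfl]
    · exact le_of_tendsto_of_tendsto' (tendsto_u hω s hs i) (tendsto_u hω t ht i)
        fun n => (a n ω).2.2.1 i hst
  · by_cases hω : ω ∈ G
    · exact (u_eq_zero hω t i).ge
    · exact ge_of_tendsto' (tendsto_u hω t ht i) fun n => (a n ω).nonneg i t
  · filter_upwards [measure_eq_zero_iff_ae_notMem.1 hG0] with ω hω using tendsto_u hω

theorem ae_tendsto_incRegularize {D : Set (Time T)} (hD : Dense D) (htop : ⊤ ∈ D)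
    {u : Time T → E k} (hmono : ∀ i, MonotoneOn (fun t => u t i) D)
    (h0 : ∀ t ∈ D, ∀ i, 0 ≤ u t i) {a : ℕ → IncSkorokhod T k}
    (hlim : ∀ t ∈ D, ∀ i, Tendsto (fun n => a n t i) atTop (𝓝 (u t i))) :
    ∀ᵐ t ∂leb T, ∀ i,
      Tendsto (fun n => a n t i) atTop (𝓝 (incRegularize hD htop hmono h0 t i)) := by
  have countable_discontinuities (i : Fin k) :=
    ((incRegularize hD htop hmono h0).2.2.1 i).countable_not_continuousAt
  filter_upwards [(countable_singleton (⊥ : Time T)).ae_notMem (leb T),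
    (countable_singleton (⊤ : Time T)).ae_notMem (leb T),
    ae_all_iff.2 fun i => (countable_discontinuities i).ae_notMem (leb T)]
    with t hbot hne_top hcont i
  exact tendsto_of_tendsto_dense hD (fun n => (a n).2.2.1 i) (fun q hq => hlim q hq i)
    (fun t q hq hqt => le_regularize_of_le hD htop hmono h0 hq hqt i)
    (fun t q hq htq => regularize_le_of_lt hD htop hmono h0 hq htq i)
    (bot_lt_iff_ne_bot.2 hbot) (lt_top_iff_ne_top.2 hne_top) (not_not.1 (hcont i))

theorem exists_control_of_tendsto {a : ℕ → Pair T d k → IncSkorokhod T k}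
    (ha : ∀ n, IsControl P (a n)) {D : Set (Time T)} (hDc : D.Countable) (hD : Dense D)
    (htop : ⊤ ∈ D)
    (hlim : ∀ t ∈ D, ∀ᵐ ω ∂P, ∀ i, ∃ y, Tendsto (fun n => a n ω t i) atTop (𝓝 y)) :
    ∃ A, IsControl P A ∧ ∀ᵐ ω ∂P, (∀ i, Tendsto (fun n => a n ω ⊤ i) atTop (𝓝 (A ω ⊤ i))) ∧
      ∀ᵐ t ∂leb T, ∀ i, Tendsto (fun n => a n ω t i) atTop (𝓝 (A ω t i)) := by
  obtain ⟨u, adapted_u, hmono, h0, hu⟩ := exists_adapted_limit ha hDc hlim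
  refine ⟨fun ω => incRegularize hD htop (hmono ω) (h0 ω), measurable_regularize hD htop
    (fun ω => hasSideLimits_of_monotoneOn htop (hmono ω) (h0 ω)) fun q _ => adapted_u q, ?_⟩
  filter_upwards [hu] with ω hω
  refine ⟨fun i => ?_, ae_tendsto_incRegularize hD htop (hmono ω) (h0 ω) hω⟩
  rw [show incRegularize hD htop (hmono ω) (h0 ω) ⊤ = u ω ⊤ from regularize_top D (u ω)]
  exact hω ⊤ htop i

theorem exists_optimal_control {P₀ : Measure (Skorokhod T d)} {c : CostData T d k}
    (hg : IsC1InControl c.g) (hh : IsC1InControl c.h) (hc : c.LinearlyCoercive P₀)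
    (hP : Admissible P₀ P) (hfin : c.expCost P < ∞) :
    ∃ A, IsControl P A ∧ c.controlCost P A < ∞ ∧
      ∀ b, IsControl P b → c.controlCost P A ≤ c.controlCost P b := by
  let V : ℝ≥0∞ := ⨅ (a) (_ : IsControl P a), c.controlCost P a
  have V_le (b) (hb : IsControl P b) : V ≤ c.controlCost P b := iInf₂_le b hb
  have V_lt_top : V < ∞ := (V_le _ isControl_snd).trans_lt hfin
  obtain ⟨v, strictAnti_v, V_lt_v, tendsto_v⟩ := exists_seq_strictAnti_tendsto' V_lt_top
  have exists_control_le (n : ℕ) : ∃ a, IsControl P a ∧ c.controlCost P a ≤ v n := by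
    have V_lt_v_n := (V_lt_v n).1
    simp only [V, iInf_lt_iff] at V_lt_v_n
    obtain ⟨a, ha, hav⟩ := V_lt_v_n
    exact ⟨a, ha, hav.le⟩
  obtain ⟨a, ha, hav, hlim⟩ := exists_controls_ae_tendsto hc hP strictAnti_v.antitone (V_lt_v 0).2
    exists_control_le (leb T + Measure.dirac ⊤)
  rw [ae_add_measure_iff, ae_dirac_eq] at hlim
  obtain ⟨D, hDc, hD, htop, hlimD⟩ := exists_countable_dense_of_ae hlim.1 hlim.2
  obtain ⟨A, hA, hlimA⟩ := exists_control_of_tendsto ha hDc hD htop hlimD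
  have cost_A_le : c.controlCost P A ≤ V := by
    calc c.controlCost P A ≤ ∫⁻ ω, liminf (fun n => c.cost ω.1 (a n ω)) atTop ∂P := by
          refine lintegral_mono_ae ?_
          filter_upwards [hlimA] with ω hω
          exact CostData.cost_le_liminf hg hh ω.1 hω.1 hω.2
      _ ≤ liminf (fun n => c.controlCost P (a n)) atTop :=
          lintegral_liminf_le fun n => c.measurable_cost measurable_fst (ha n).measurable
      _ ≤ liminf v atTop := liminf_le_liminf (Eventually.of_forall hav)
      _ = V := tendsto_v.liminf_eq
  exact ⟨A, hA, cost_A_le.trans_lt V_lt_top, fun b hb => cost_A_le.trans (V_le b hb)⟩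

end Optimal

/-! ### First-order conditions -/

section Primitive

variable {X F : Type*} [TopologicalSpace X] [LinearOrder X] [OrderTopology X]
  [MeasurableSpace X] [OpensMeasurableSpace X] {ν : Measure X}
  [NullSingletonClass ν] [NormedAddCommGroup F] [NormedSpace ℝ F] {ψ : X → F}

theorem setIntegral_Ici_eq_sub (hψ : Integrable ψ ν) (t : X) :
    ∫ s in Ici t, ψ s ∂ν = ∫ s, ψ s ∂ν - ∫ s in Iic t, ψ s ∂ν := by
  rw [eq_sub_iff_add_eq', ← integral_add_compl (measurableSet_Iic (a := t)) hψ, compl_Iic,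
    setIntegral_congr_set Ioi_ae_eq_Ici]

variable [FirstCountableTopology X]

theorem continuous_setIntegral_Iic (hψ : Integrable ψ ν) :
    Continuous fun t : X => ∫ s in Iic t, ψ s ∂ν := by
  simp_rw [← integral_indicator measurableSet_Iic]
  refine continuous_iff_continuousAt.2 fun t => continuousAt_of_dominated (bound := fun s => ‖ψ s‖)
    (Eventually.of_forall fun r => hψ.1.indicator measurableSet_Iic)
    (Eventually.of_forall fun r => Eventually.of_forall fun s => norm_indicator_le_norm_self _ _)
    hψ.norm ?_
  filter_upwards [measure_eq_zero_iff_ae_notMem.1 (measure_singleton (μ := ν) t)] with s hs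
  rcases lt_or_gt_of_ne hs with hst | hts
  · refine (continuousAt_const (y := ψ s)).congr ?_
    filter_upwards [lt_mem_nhds hst] with r hr
    rw [indicator_of_mem (mem_Iic.2 hr.le)]
  · refine (continuousAt_const (y := (0 : F))).congr ?_
    filter_upwards [gt_mem_nhds hts] with r hr
    rw [indicator_of_notMem (notMem_Iic.2 hr)]

theorem continuous_setIntegral_Ici (hψ : Integrable ψ ν) :
    Continuous fun t : X => ∫ s in Ici t, ψ s ∂ν := by
  simp_rw [setIntegral_Ici_eq_sub hψ]
  exact continuous_const.sub (continuous_setIntegral_Iic hψ)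

end Primitive

section EuclideanIntegral

variable {X : Type*} [MeasurableSpace X] {ν : Measure X} {N : ℕ} {u v : X → E N} {R : ℝ}

theorem integrable_inner_of_norm_le (hu : Integrable u ν) (hv : Measurable v)
    (hR : ∀ x, ‖v x‖ ≤ R) : Integrable (fun x => inner ℝ (u x) (v x)) ν :=
  Integrable.mono' (hu.norm.mul_const R) (hu.1.inner hv.aestronglyMeasurable)
    (Eventually.of_forall fun x =>
      (norm_inner_le_norm _ _).trans (mul_le_mul_of_nonneg_left (hR x) (norm_nonneg _)))

theorem inner_eq_sum_mul (a b : E N) : inner ℝ a b = ∑ i, a i * b i := by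
  simp only [PiLp.inner_apply, RCLike.inner_apply, conj_trivial, mul_comm]

theorem integral_inner_eq_sum (hu : Integrable u ν) (hv : Measurable v) (hR : ∀ x, ‖v x‖ ≤ R) :
    ∫ x, inner ℝ (u x) (v x) ∂ν = ∑ i, ∫ x, u x i * v x i ∂ν := by
  simp only [inner_eq_sum_mul]
  exact integral_finsetSum _ fun i _ => (integrable_piLp_iff.1 hu i).mul_bdd
    (measurable_euclidean_iff.1 hv i).aestronglyMeasurable
    (Eventually.of_forall fun x => (PiLp.norm_apply_le (v x) i).trans (hR x))

theorem integrable_of_lintegral_ofReal_ne_top {u : X → ℝ} (hu : Measurable u) (h0 : ∀ x, 0 ≤ u x)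
    (h : ∫⁻ x, ENNReal.ofReal (u x) ∂ν ≠ ∞) : Integrable u ν :=
  (lintegral_ofReal_ne_top_iff_integrable hu.aestronglyMeasurable (Eventually.of_forall h0)).1 h

end EuclideanIntegral

section MarginalCost

variable {T : ℝ} [Fact (0 < T)] {d k : ℕ}

/-- The gradient of the cost with respect to an additional push at the time `t`. -/
def CostData.marginalCost (c : CostData T d k) (L : Skorokhod T d) (A : IncSkorokhod T k)
    (t : Time T) : E k :=
  c.f t + grad c.g (L ⊤) (A ⊤) + ∫ s in Ici t, grad c.h (L s) (A s) ∂leb T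

variable {c : CostData T d k} {L : Skorokhod T d} {A : IncSkorokhod T k}
  (hψ : Integrable (fun s => grad c.h (L s) (A s)) (leb T))

include hψ

theorem CostData.continuous_marginalCost : Continuous (c.marginalCost L A) :=
  (c.f_continuous.add_const _).add (continuous_setIntegral_Ici hψ)

theorem CostData.marginalCost_apply (t : Time T) (i : Fin k) :
    c.marginalCost L A t i =
      c.f t i + grad c.g (L ⊤) (A ⊤) i + ∫ s in Ici t, grad c.h (L s) (A s) i ∂leb T := by
  rw [← eval_integral_piLp (integrable_piLp_iff.1 hψ.integrableOn)]
  rfl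

theorem CostData.integral_marginalCost_apply (b : IncSkorokhod T k) (i : Fin k) :
    ∫ t, c.marginalCost L A t i ∂(b.dMeasure i) =
      ∫ t, c.f t i ∂(b.dMeasure i) + ∫ s, grad c.h (L s) (A s) i * b s i ∂leb T
        + grad c.g (L ⊤) (A ⊤) i * b ⊤ i := by
  have hψi := integrable_piLp_iff.1 hψ i
  have integrable_tail : Integrable (fun t => ∫ s in Ici t, grad c.h (L s) (A s) i ∂leb T)
      (b.dMeasure i) :=
    (continuous_setIntegral_Ici hψi).integrable_of_hasCompactSupport
      (HasCompactSupport.of_compactSpace _)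
  simp_rw [c.marginalCost_apply hψ]
  rw [integral_add ((c.integrable_f_apply b i).fun_add (integrable_const _)) integrable_tail,
    integral_add (c.integrable_f_apply b i) (integrable_const _), integral_const,
    b.integral_setIntegral_Ici i hψi, b.dMeasure_real_univ, smul_eq_mul]
  ring

theorem CostData.sum_integral_marginalCost (b : IncSkorokhod T k) :
    ∑ i, ∫ t, c.marginalCost L A t i ∂(b.dMeasure i) =
      c.fInt b + ∫ s, inner ℝ (grad c.h (L s) (A s)) (b s) ∂leb T
        + inner ℝ (grad c.g (L ⊤) (A ⊤)) (b ⊤) := by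
  obtain ⟨R, hR⟩ := b.2.1.exists_norm_le
  rw [integral_inner_eq_sum hψ b.2.1.measurable hR, inner_eq_sum_mul, CostData.fInt]
  simp only [c.integral_marginalCost_apply hψ, Finset.sum_add_distrib]

end MarginalCost

section FirstOrder

variable {T : ℝ} [Fact (0 < T)] {d k : ℕ} {Ω : Type*} [MeasurableSpace Ω] {P : Measure Ω}
  {c : CostData T d k} {L : Ω → Skorokhod T d} {a : Ω → IncSkorokhod T k}

/-- Each of the three parts of the cost of the pair `(L,a)` is integrable. -/
structure CostData.FiniteCost (c : CostData T d k) (P : Measure Ω) (L : Ω → Skorokhod T d)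
    (a : Ω → IncSkorokhod T k) : Prop where
  fInt : Integrable (fun ω => c.fInt (a ω)) P
  h : Integrable (fun p : Ω × Time T => c.h (L p.1 p.2) (a p.1 p.2)) (P.prod (leb T))
  g : Integrable (fun ω => c.g (L ω ⊤) (a ω ⊤)) P

/-- The expected cost of the pair `(L,a)`, as a real number. It is meaningful only under
`CostData.FiniteCost`, since the integral of a nonintegrable part is `0`. -/
def CostData.meanCost (c : CostData T d k) (P : Measure Ω) (L : Ω → Skorokhod T d)
    (a : Ω → IncSkorokhod T k) : ℝ :=
  ∫ ω, c.fInt (a ω) ∂P + ∫ p : Ω × Time T, c.h (L p.1 p.2) (a p.1 p.2) ∂P.prod (leb T)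
    + ∫ ω, c.g (L ω ⊤) (a ω ⊤) ∂P

/-- The integrated form of the gradient growth condition. -/
structure CostData.IntegrableGrowth (c : CostData T d k) (P : Measure Ω)
    (L : Ω → Skorokhod T d) (Φg Φh : E d → ℝ≥0) (M : ℝ≥0) : Prop where
  integrable_g : Integrable (fun ω => (Φg (L ω ⊤) : ℝ)) P
  integrable_h : Integrable (fun p : Ω × Time T => (Φh (L p.1 p.2) : ℝ)) (P.prod (leb T))
  g_le : ∀ l, ∀ a ∈ orthant k, ‖grad c.g l a‖ ≤ Φg l + M * c.g l a
  h_le : ∀ l, ∀ a ∈ orthant k, ‖grad c.h l a‖ ≤ Φh l + M * c.h l a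

theorem CostData.meanCost_nonneg : 0 ≤ c.meanCost P L a :=
  add_nonneg (add_nonneg (integral_nonneg fun _ => c.fInt_nonneg _)
    (integral_nonneg fun p => c.h_nonneg _ _ ((a p.1).mem_orthant _)))
    (integral_nonneg fun ω => c.g_nonneg _ _ ((a ω).mem_orthant _))

theorem CostData.lintegral_cost (hL : Measurable L) (ha : Measurable a) :
    ∫⁻ ω, c.cost (L ω) (a ω) ∂P = ∫⁻ ω, ENNReal.ofReal (c.fInt (a ω)) ∂P
      + ∫⁻ p : Ω × Time T, ENNReal.ofReal (c.h (L p.1 p.2) (a p.1 p.2)) ∂P.prod (leb T)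
      + ∫⁻ ω, ENNReal.ofReal (c.g (L ω ⊤) (a ω ⊤)) ∂P := by
  simp_rw [c.cost_eq]
  rw [lintegral_add_right _ (c.measurable_g_top hL ha).ennreal_ofReal,
    lintegral_add_left (c.measurable_fInt ha).ennreal_ofReal,
    lintegral_prod _ (c.measurable_h_uncurry hL ha).ennreal_ofReal.aemeasurable]

theorem CostData.finiteCost (hL : Measurable L) (ha : Measurable a)
    (hfin : ∫⁻ ω, c.cost (L ω) (a ω) ∂P < ∞) : c.FiniteCost P L a := by
  rw [c.lintegral_cost hL ha, ENNReal.add_lt_top, ENNReal.add_lt_top] at hfin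
  obtain ⟨⟨fInt_lt_top, h_lt_top⟩, g_lt_top⟩ := hfin
  exact ⟨integrable_of_lintegral_ofReal_ne_top (c.measurable_fInt ha)
      (fun _ => c.fInt_nonneg _) fInt_lt_top.ne,
    integrable_of_lintegral_ofReal_ne_top (c.measurable_h_uncurry hL ha)
      (fun p => c.h_nonneg _ _ ((a p.1).mem_orthant _)) h_lt_top.ne,
    integrable_of_lintegral_ofReal_ne_top (c.measurable_g_top hL ha)
      (fun ω => c.g_nonneg _ _ ((a ω).mem_orthant _)) g_lt_top.ne⟩

theorem CostData.FiniteCost.lintegral_cost (h : c.FiniteCost P L a) (hL : Measurable L)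
    (ha : Measurable a) :
    ∫⁻ ω, c.cost (L ω) (a ω) ∂P = ENNReal.ofReal (c.meanCost P L a) := by
  have fInt_nonneg : 0 ≤ᵐ[P] fun ω => c.fInt (a ω) := Eventually.of_forall fun ω => c.fInt_nonneg _
  have h_nonneg : 0 ≤ᵐ[P.prod (leb T)] fun p : Ω × Time T => c.h (L p.1 p.2) (a p.1 p.2) :=
    Eventually.of_forall fun p => c.h_nonneg _ _ ((a p.1).mem_orthant _)
  have g_nonneg : 0 ≤ᵐ[P] fun ω => c.g (L ω ⊤) (a ω ⊤) :=
    Eventually.of_forall fun ω => c.g_nonneg _ _ ((a ω).mem_orthant _)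
  rw [c.lintegral_cost hL ha, CostData.meanCost,
    ENNReal.ofReal_add (add_nonneg (integral_nonneg_of_ae fInt_nonneg)
      (integral_nonneg_of_ae h_nonneg)) (integral_nonneg_of_ae g_nonneg),
    ENNReal.ofReal_add (integral_nonneg_of_ae fInt_nonneg) (integral_nonneg_of_ae h_nonneg),
    ofReal_integral_eq_lintegral_ofReal h.fInt fInt_nonneg,
    ofReal_integral_eq_lintegral_ofReal h.h h_nonneg,
    ofReal_integral_eq_lintegral_ofReal h.g g_nonneg]

variable {Φg Φh : E d → ℝ≥0} {M : ℝ≥0} {A b : Ω → IncSkorokhod T k}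

section Gradients

variable (hfin : c.FiniteCost P L A) (hΦ : c.IntegrableGrowth P L Φg Φh M) (hL : Measurable L)
  (hA : Measurable A)

include hfin hΦ hL hA

theorem CostData.FiniteCost.integrable_grad_h (hh : IsC1InControl c.h) :
    Integrable (fun p : Ω × Time T => grad c.h (L p.1 p.2) (A p.1 p.2)) (P.prod (leb T)) :=
  integrable_grad c.h_measurable (measurable_uncurry_skorokhod hL)
    (measurable_uncurry_incSkorokhod hA) (fun p => (A p.1).mem_orthant _) hh hΦ.h_le
    hΦ.integrable_h hfin.h

theorem CostData.FiniteCost.integrable_grad_g (hg : IsC1InControl c.g) :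
    Integrable (fun ω => grad c.g (L ω ⊤) (A ω ⊤)) P :=
  integrable_grad c.g_measurable (Skorokhod.measurable_iff.1 hL ⊤)
    (IncSkorokhod.measurable_iff.1 hA ⊤) (fun ω => (A ω).mem_orthant _) hg hΦ.g_le
    hΦ.integrable_g hfin.g

end Gradients

theorem CostData.exists_abs_fInt_le (c : CostData T d k) (R : ℝ) :
    ∃ C, ∀ b : IncSkorokhod T k, (∀ t, ‖b t‖ ≤ R) → ‖c.fInt b‖ ≤ C := by
  obtain ⟨K, hK⟩ := (isCadlag_of_continuous c.f_continuous).exists_norm_le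
  refine ⟨∑ _i : Fin k, K * R, fun b hb => ?_⟩
  have K_nonneg : 0 ≤ K := (norm_nonneg _).trans (hK ⊥)
  refine (norm_sum_le _ _).trans (Finset.sum_le_sum fun i _ => ?_)
  refine (norm_integral_le_of_norm_le_const (Eventually.of_forall fun t =>
    (PiLp.norm_apply_le (c.f t) i).trans (hK t))).trans ?_
  rw [b.dMeasure_real_univ]
  exact mul_le_mul_of_nonneg_left ((le_abs_self _).trans
    ((PiLp.norm_apply_le (b ⊤) i).trans (hb ⊤))) K_nonneg

variable [IsFiniteMeasure P]

theorem CostData.integrable_fInt (c : CostData T d k) (hb : Measurable b) {R : ℝ}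
    (hbR : ∀ ω t, ‖b ω t‖ ≤ R) : Integrable (fun ω => c.fInt (b ω)) P := by
  obtain ⟨C, hC⟩ := c.exists_abs_fInt_le R
  exact Integrable.of_bound (c.measurable_fInt hb).aestronglyMeasurable C
    (Eventually.of_forall fun ω => hC _ (hbR ω))

section Derivative

variable (hfin : c.FiniteCost P L A) (hg : IsC1InControl c.g) (hh : IsC1InControl c.h)
  (hΦ : c.IntegrableGrowth P L Φg Φh M) (hL : Measurable L) (hA : Measurable A)
  (hb : Measurable b) {R : ℝ} (hbR : ∀ ω t, ‖b ω t‖ ≤ R)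

include hfin hg hh hΦ hL hA hb hbR

theorem CostData.FiniteCost.integral_sum_integral_marginalCost :
    ∫ ω, ∑ i, ∫ t, c.marginalCost (L ω) (A ω) t i ∂((b ω).dMeasure i) ∂P =
      ∫ ω, c.fInt (b ω) ∂P
        + ∫ p : Ω × Time T, inner ℝ (grad c.h (L p.1 p.2) (A p.1 p.2)) (b p.1 p.2) ∂P.prod (leb T)
        + ∫ ω, inner ℝ (grad c.g (L ω ⊤) (A ω ⊤)) (b ω ⊤) ∂P := by
  have integrable_grad_h := hfin.integrable_grad_h hΦ hL hA hh
  have integrable_f := c.integrable_fInt (P := P) hb hbR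
  have integrable_h := integrable_inner_of_norm_le integrable_grad_h
    (measurable_uncurry_incSkorokhod hb) fun p => hbR p.1 p.2
  have integrable_g := integrable_inner_of_norm_le (hfin.integrable_grad_g hΦ hL hA hg)
    (IncSkorokhod.measurable_iff.1 hb ⊤) fun ω => hbR ω ⊤
  rw [integral_prod _ integrable_h, ← integral_add integrable_f integrable_h.integral_prod_left,
    ← integral_add (integrable_f.fun_add integrable_h.integral_prod_left) integrable_g]
  refine integral_congr_ae ?_
  filter_upwards [integrable_grad_h.prod_right_ae] with ω hω
  exact CostData.sum_integral_marginalCost hω (b ω)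

end Derivative

theorem CostData.fInt_add_smul (c : CostData T d k) {A b C : IncSkorokhod T k} {r : ℝ}
    (h : ∀ t, C t = A t + r • b t) : c.fInt C = c.fInt A + r * c.fInt b := by
  have apply_eq (t : Time T) (i : Fin k) : C t i = A t i + r * b t i := by rw [h t]; rfl
  rcases le_total 0 r with hr | hr
  · rw [c.fInt_linear (A := A) (B := b) zero_le_one hr fun t i => by rw [apply_eq, one_mul],
      one_mul]
  · rw [c.fInt_linear (A := C) (B := b) (C := A) zero_le_one (neg_nonneg.2 hr)
      fun t i => by rw [apply_eq]; ring]
    ring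

section Perturbation

variable (hfin : c.FiniteCost P L A) (hg : IsC1InControl c.g) (hh : IsC1InControl c.h)
  (hΦ : c.IntegrableGrowth P L Φg Φh M) (hL : Measurable L) (hA : Measurable A)
  (hb : Measurable b) {R : ℝ} (hR : 0 ≤ R) (hbR : ∀ ω t, ‖b ω t‖ ≤ R) {σ : ℝ}
  {a : ℝ → Ω → IncSkorokhod T k}
  (hab : ∀ ε, 0 ≤ ε → ε ≤ 1 → ∀ ω t, a ε ω t = A ω t + ε • (σ • b ω t))

include hfin hg hh hΦ hL hA hb hR hbR hab

theorem CostData.FiniteCost.eventually_finiteCost_add_smul :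
    ∀ᶠ ε : ℝ in 𝓝[>] 0, c.FiniteCost P L (a ε) := by
  have mem (ε : ℝ) (h0 : 0 ≤ ε) (h1 : ε ≤ 1) ω t : A ω t + ε • (σ • b ω t) ∈ orthant k :=
    hab ε h0 h1 ω t ▸ (a ε ω).mem_orthant t
  have norm_le ω t : ‖σ • b ω t‖ ≤ |σ| * R :=
    (norm_smul σ (b ω t)).trans_le (mul_le_mul_of_nonneg_left (hbR ω t) (abs_nonneg σ))
  have integrable_h := eventually_integrable_comp_add_smul (l := fun p : Ω × Time T => L p.1 p.2)
    (x := fun p => A p.1 p.2) (y := fun p => σ • b p.1 p.2) hΦ.h_le hh c.h_convex c.h_nonneg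
    c.h_measurable (mul_nonneg (abs_nonneg σ) hR) (measurable_uncurry_skorokhod hL)
    (measurable_uncurry_incSkorokhod hA) ((measurable_uncurry_incSkorokhod hb).const_smul σ)
    (fun p => (A p.1).mem_orthant _) (fun ε h0 h1 p => mem ε h0 h1 _ _) (fun p => norm_le _ _)
    hΦ.integrable_h hfin.h
  have integrable_g := eventually_integrable_comp_add_smul (l := fun ω => L ω ⊤)
    (x := fun ω => A ω ⊤) (y := fun ω => σ • b ω ⊤) hΦ.g_le hg c.g_convex c.g_nonneg c.g_measurable
    (mul_nonneg (abs_nonneg σ) hR) (Skorokhod.measurable_iff.1 hL ⊤)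
    (IncSkorokhod.measurable_iff.1 hA ⊤) ((IncSkorokhod.measurable_iff.1 hb ⊤).const_smul σ)
    (fun ω => (A ω).mem_orthant _) (fun ε h0 h1 ω => mem ε h0 h1 _ _) (fun ω => norm_le _ _)
    hΦ.integrable_g hfin.g
  filter_upwards [integrable_h, integrable_g, Ioo_mem_nhdsGT (one_pos (α := ℝ))]
    with ε hεh hεg ⟨hε0, hε1⟩
  have apply_eq := hab ε hε0.le hε1.le
  refine ⟨?_, by simpa only [apply_eq] using hεh, by simpa only [apply_eq] using hεg⟩
  refine (hfin.fInt.add ((c.integrable_fInt hb hbR).const_mul (ε * σ))).congr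
    (Eventually.of_forall fun ω => ?_)
  exact (c.fInt_add_smul fun t => by rw [apply_eq, smul_smul]).symm

theorem CostData.FiniteCost.tendsto_slope_meanCost :
    Tendsto (fun ε : ℝ => (c.meanCost P L (a ε) - c.meanCost P L A) / ε) (𝓝[>] 0)
      (𝓝 (σ * ∫ ω, ∑ i, ∫ t, c.marginalCost (L ω) (A ω) t i ∂((b ω).dMeasure i) ∂P)) := by
  have mem (ε : ℝ) (h0 : 0 ≤ ε) (h1 : ε ≤ 1) ω t : A ω t + ε • (σ • b ω t) ∈ orthant k :=
    hab ε h0 h1 ω t ▸ (a ε ω).mem_orthant t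
  have norm_le ω t : ‖σ • b ω t‖ ≤ |σ| * R :=
    (norm_smul σ (b ω t)).trans_le (mul_le_mul_of_nonneg_left (hbR ω t) (abs_nonneg σ))
  have tendsto_h := tendsto_slope_integral (l := fun p : Ω × Time T => L p.1 p.2)
    (x := fun p => A p.1 p.2) (y := fun p => σ • b p.1 p.2) hΦ.h_le hh c.h_convex c.h_nonneg
    c.h_measurable (mul_nonneg (abs_nonneg σ) hR) (measurable_uncurry_skorokhod hL)
    (measurable_uncurry_incSkorokhod hA) ((measurable_uncurry_incSkorokhod hb).const_smul σ)
    (fun p => (A p.1).mem_orthant _) (fun ε h0 h1 p => mem ε h0 h1 _ _) (fun p => norm_le _ _)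
    hΦ.integrable_h hfin.h
  have tendsto_g := tendsto_slope_integral (l := fun ω => L ω ⊤) (x := fun ω => A ω ⊤)
    (y := fun ω => σ • b ω ⊤) hΦ.g_le hg c.g_convex c.g_nonneg c.g_measurable
    (mul_nonneg (abs_nonneg σ) hR) (Skorokhod.measurable_iff.1 hL ⊤)
    (IncSkorokhod.measurable_iff.1 hA ⊤) ((IncSkorokhod.measurable_iff.1 hb ⊤).const_smul σ)
    (fun ω => (A ω).mem_orthant _) (fun ε h0 h1 ω => mem ε h0 h1 _ _) (fun ω => norm_le _ _)
    hΦ.integrable_g hfin.g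
  simp only [inner_smul_right, integral_const_mul] at tendsto_h tendsto_g
  rw [hfin.integral_sum_integral_marginalCost hg hh hΦ hL hA hb hbR, mul_add, mul_add]
  refine ((tendsto_h.const_add (σ * ∫ ω, c.fInt (b ω) ∂P)).add tendsto_g).congr' ?_
  filter_upwards [Ioo_mem_nhdsGT (one_pos (α := ℝ))] with ε ⟨hε0, hε1⟩
  have apply_eq := hab ε hε0.le hε1.le
  have fInt_eq : ∫ ω, c.fInt (a ε ω) ∂P = ∫ ω, c.fInt (A ω) ∂P + ε * σ * ∫ ω, c.fInt (b ω) ∂P := by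
    rw [← integral_const_mul,
      ← integral_add hfin.fInt ((c.integrable_fInt hb hbR).const_mul (ε * σ))]
    exact integral_congr_ae (Eventually.of_forall fun ω =>
      c.fInt_add_smul fun t => by rw [apply_eq, smul_smul])
  simp only [CostData.meanCost, fInt_eq, apply_eq]
  field_simp
  ring

theorem CostData.FiniteCost.first_order
    (hopt : ∀ ε, 0 ≤ ε → ε ≤ 1 →
      ∫⁻ ω, c.cost (L ω) (A ω) ∂P ≤ ∫⁻ ω, c.cost (L ω) (a ε ω) ∂P) :
    0 ≤ σ * ∫ ω, ∑ i, ∫ t, c.marginalCost (L ω) (A ω) t i ∂((b ω).dMeasure i) ∂P := by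
  refine ge_of_tendsto (hfin.tendsto_slope_meanCost hg hh hΦ hL hA hb hR hbR hab) ?_
  filter_upwards [hfin.eventually_finiteCost_add_smul hg hh hΦ hL hA hb hR hbR hab,
    Ioo_mem_nhdsGT (one_pos (α := ℝ))] with ε hfinε ⟨hε0, hε1⟩
  have measurable_a : Measurable (a ε) := IncSkorokhod.measurable_iff.2 fun t => by
    simp only [hab ε hε0.le hε1.le]
    exact (IncSkorokhod.measurable_iff.1 hA t).add
      (((IncSkorokhod.measurable_iff.1 hb t).const_smul σ).const_smul ε)
  have cost_le := hopt ε hε0.le hε1.le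
  rw [hfin.lintegral_cost hL hA, hfinε.lintegral_cost hL measurable_a,
    ENNReal.ofReal_le_ofReal_iff CostData.meanCost_nonneg] at cost_le
  exact div_nonneg (sub_nonneg.2 cost_le) hε0.le

end Perturbation

end FirstOrder

section Directions

theorem norm_le_norm_of_abs_apply_le {N : ℕ} {x y : E N} (h : ∀ i, |x i| ≤ |y i|) : ‖x‖ ≤ ‖y‖ := by
  rw [EuclideanSpace.norm_eq, EuclideanSpace.norm_eq]
  exact Real.sqrt_le_sqrt (Finset.sum_le_sum fun i _ => sq_le_sq.2 (by simpa using h i))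

theorem monotone_sub_mul_min (c : ℝ) {r : ℝ} (hr : r ≤ 1) :
    Monotone fun x : ℝ => x - r * min x c := fun x y hxy => by
  have min_le : min x c ≤ min y c := min_le_min_right c hxy
  have min_sub_le : min y c - min x c ≤ y - x := by
    rcases min_cases y c with hy | hy <;> rcases min_cases x c with hx | hx <;> linarith
  have mul_le : r * (min y c - min x c) ≤ min y c - min x c :=
    mul_le_of_le_one_left (sub_nonneg.2 min_le) hr
  change x - r * min x c ≤ y - r * min y c
  linarith

theorem isCadlag_indicator_Ici {T : ℝ} {N : ℕ} (t : Time T) (v : E N) :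
    IsCadlag ((Ici t).indicator fun _ => v) := by
  intro s
  rcases lt_or_ge s t with hst | hts
  · have eventually_eq : ∀ᶠ u in 𝓝 s, (0 : E N) = (Ici t).indicator (fun _ => v) u := by
      filter_upwards [gt_mem_nhds hst] with u hu
      rw [indicator_of_notMem (notMem_Ici.2 hu)]
    exact ⟨(continuousAt_const.congr eventually_eq).continuousWithinAt, 0,
      (tendsto_const_nhds.congr' eventually_eq).mono_left nhdsWithin_le_nhds⟩
  refine ⟨continuousWithinAt_const.congr (fun u hu => indicator_of_mem (mem_Ici.2 (hts.trans hu)) _)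
    (indicator_of_mem (mem_Ici.2 hts) _), ?_⟩
  rcases hts.eq_or_lt with rfl | hlt
  · refine ⟨0, tendsto_const_nhds.congr' ?_⟩
    filter_upwards [self_mem_nhdsWithin] with u hu
    rw [indicator_of_notMem (notMem_Ici.2 hu)]
  · refine ⟨v, (tendsto_const_nhds.congr' ?_).mono_left nhdsWithin_le_nhds⟩
    filter_upwards [lt_mem_nhds hlt] with u hu
    rw [indicator_of_mem (mem_Ici.2 hu.le)]

theorem indicator_Ici_single_apply {T : ℝ} {k : ℕ} (t s : Time T) (r : ℝ) (i j : Fin k) :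
    (Ici t).indicator (fun _ => (EuclideanSpace.single i r : E k)) s j =
      if t ≤ s ∧ j = i then r else 0 := by
  by_cases hts : t ≤ s <;> simp [hts, PiLp.single_apply]

variable {T : ℝ} [Fact (0 < T)] {d k : ℕ}

namespace IncSkorokhod

/-- The path `A + r b`. -/
def addSmul (A b : IncSkorokhod T k) (r : ℝ≥0) : IncSkorokhod T k :=
  ⟨fun t => A t + (r : ℝ) • b t,
    A.2.1.map₂ b.2.1 (F := fun x y => x + (r : ℝ) • y) (by fun_prop),
    fun i _ _ hst => add_le_add (A.2.2.1 i hst) (mul_le_mul_of_nonneg_left (b.2.2.1 i hst) r.2),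
    fun i => add_nonneg (A.nonneg i ⊥) (mul_nonneg r.2 (b.nonneg i ⊥))⟩

theorem addSmul_apply (A b : IncSkorokhod T k) (r : ℝ≥0) (t : Time T) :
    A.addSmul b r t = A t + (r : ℝ) • b t := rfl

/-- The componentwise minimum of a nondecreasing path and a constant. -/
def trunc (A : IncSkorokhod T k) (n : ℕ) : IncSkorokhod T k :=
  ⟨fun t => WithLp.toLp 2 fun i => min (A t i) n,
    A.2.1.map (F := fun a => WithLp.toLp 2 fun i => min (a i) (n : ℝ)) (by fun_prop),
    fun i _ _ hst => min_le_min_right _ (A.2.2.1 i hst),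
    fun i => le_min (A.nonneg i ⊥) n.cast_nonneg⟩

theorem norm_trunc_le (A : IncSkorokhod T k) (n : ℕ) (t : Time T) :
    ‖A.trunc n t‖ ≤ ‖(WithLp.toLp 2 fun _ => (n : ℝ) : E k)‖ :=
  norm_le_norm_of_abs_apply_le fun i =>
    abs_le_abs_of_nonneg ((A.trunc n).nonneg i t) (min_le_right _ _)

/-- The path `A - r min(A,n)`. It is nondecreasing since `r ≤ 1`. -/
def subTrunc (A : IncSkorokhod T k) (n : ℕ) (r : unitInterval) : IncSkorokhod T k :=
  ⟨fun t => A t - (r : ℝ) • A.trunc n t,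
    A.2.1.map₂ (A.trunc n).2.1 (F := fun x y => x - (r : ℝ) • y) (by fun_prop),
    fun i _ _ hst => monotone_sub_mul_min n r.2.2 (A.2.2.1 i hst),
    fun i => sub_nonneg.2 ((mul_le_of_le_one_left ((A.trunc n).nonneg i ⊥) r.2.2).trans
      (min_le_left _ _))⟩

theorem subTrunc_apply (A : IncSkorokhod T k) (n : ℕ) (r : unitInterval) (t : Time T) :
    A.subTrunc n r t = A t - (r : ℝ) • A.trunc n t := rfl

/-- The path which jumps from `0` to `r eᵢ` at the time `t`. -/
def jump (t : Time T) (r : ℝ≥0) (i : Fin k) : IncSkorokhod T k :=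
  ⟨(Ici t).indicator fun _ => EuclideanSpace.single i (r : ℝ), isCadlag_indicator_Ici t _,
    fun j s u hsu => by
      simp only [indicator_Ici_single_apply]
      split_ifs with hs hu hu
      · exact le_rfl
      · exact absurd ⟨hs.1.trans hsu, hs.2⟩ hu
      · exact r.2
      · exact le_rfl,
    fun j => by
      rw [indicator_Ici_single_apply]
      split_ifs
      · exact r.2
      · exact le_rfl⟩

theorem jump_apply (t s : Time T) (r : ℝ≥0) (i j : Fin k) :
    jump t r i s j = if t ≤ s ∧ j = i then (r : ℝ) else 0 :=
  indicator_Ici_single_apply t s r i j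

theorem norm_jump_le (t : Time T) (r : ℝ≥0) (i : Fin k) (s : Time T) : ‖jump t r i s‖ ≤ r :=
  calc ‖jump t r i s‖ = ‖(Ici t).indicator (fun _ => (EuclideanSpace.single i (r : ℝ) : E k)) s‖ :=
        rfl
    _ ≤ ‖(EuclideanSpace.single i (r : ℝ) : E k)‖ := norm_indicator_le_norm_self _ _
    _ = r := by rw [PiLp.norm_single, NNReal.norm_eq]

theorem dMeasure_jump (t : Time T) (r : ℝ≥0) (i j : Fin k) :
    (jump t r i).dMeasure j = (if j = i then (r : ℝ≥0∞) else 0) • Measure.dirac t := by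
  refine Measure.ext_of_Iic _ _ fun s => ?_
  rw [dMeasure_Iic, jump_apply, Measure.smul_apply, Measure.dirac_apply' _ measurableSet_Iic]
  by_cases hts : t ≤ s <;> by_cases hj : j = i <;> simp [hts, hj]

theorem sum_integral_jump (t : Time T) (r : ℝ≥0) (i : Fin k) (y : Time T → E k) :
    ∑ j, ∫ s, y s j ∂((jump t r i).dMeasure j) = r * y t i := by
  simp_rw [dMeasure_jump]
  rw [Finset.sum_eq_single i (fun j _ hj => by simp [hj]) (fun hi => absurd (Finset.mem_univ i) hi),
    if_pos rfl, integral_smul_measure, integral_dirac]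
  simp

end IncSkorokhod

variable {P : Measure (Pair T d k)} {A b : Pair T d k → IncSkorokhod T k}

theorem IsControl.addSmul (hA : IsControl P A) (hb : IsControl P b) (r : ℝ≥0) :
    IsControl P fun ω => (A ω).addSmul (b ω) r := fun t =>
  (hA t).add ((hb t).const_smul (r : ℝ))

theorem IsControl.trunc (hA : IsControl P A) (n : ℕ) : IsControl P fun ω => (A ω).trunc n :=
  fun t => (@measurable_euclidean_iff _ _ (augFiltration P t) _).2 fun i =>
    ((@measurable_euclidean_iff _ _ (augFiltration P t) _).1 (hA t) i).min measurable_const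

theorem IsControl.subTrunc (hA : IsControl P A) (n : ℕ) (r : unitInterval) :
    IsControl P fun ω => (A ω).subTrunc n r := fun t =>
  (hA t).sub ((hA.trunc n t).const_smul (r : ℝ))

theorem isControl_jump {t : Time T} {G : Set (Pair T d k)}
    (hG : MeasurableSet[augFiltration P t] G) (i : Fin k) :
    IsControl P fun ω => IncSkorokhod.jump t (G.indicator (fun _ => 1) ω) i := fun s =>
  (@measurable_euclidean_iff _ _ (augFiltration P s) _).2 fun j => by
    simp only [IncSkorokhod.jump_apply]
    split_ifs with hs
    · exact (measurable_const.indicator ((augFiltration P).mono hs.1 G hG)).coe_nnreal_real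
    · exact measurable_const

section Optimum

variable [IsFiniteMeasure P] {c : CostData T d k} {Φg Φh : E d → ℝ≥0} {M : ℝ≥0}
  (hg : IsC1InControl c.g) (hh : IsC1InControl c.h) (hΦ : c.IntegrableGrowth P Prod.fst Φg Φh M)
  (hA : IsControl P A) (hfin : c.controlCost P A < ∞)
  (hopt : ∀ b, IsControl P b → c.controlCost P A ≤ c.controlCost P b)

include hg hh hΦ hA hfin hopt

theorem setIntegral_marginalCost_nonneg {t : Time T} {G : Set (Pair T d k)}
    (hG : MeasurableSet[augFiltration P t] G) (i : Fin k) :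
    0 ≤ ∫ ω in G, c.marginalCost ω.1 (A ω) t i ∂P := by
  have jump_control := isControl_jump (P := P) hG i
  have derivative_nonneg := (c.finiteCost measurable_fst hA.measurable hfin).first_order hg hh hΦ
    measurable_fst hA.measurable jump_control.measurable zero_le_one (σ := 1)
    (a := fun ε ω => (A ω).addSmul (IncSkorokhod.jump t (G.indicator (fun _ => 1) ω) i) ε.toNNReal)
    (fun ω s => (IncSkorokhod.norm_jump_le _ _ _ _).trans (by by_cases hω : ω ∈ G <;> simp [hω]))
    (fun ε h0 _ ω s => by
      rw [one_smul, IncSkorokhod.addSmul_apply, Real.coe_toNNReal ε h0])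
    (fun ε _ _ => hopt _ (hA.addSmul jump_control _))
  simp_rw [IncSkorokhod.sum_integral_jump] at derivative_nonneg
  rw [one_mul] at derivative_nonneg
  rw [← integral_indicator ((augFiltration P).le t G hG)]
  refine derivative_nonneg.trans_eq (integral_congr_ae (Eventually.of_forall fun ω => ?_))
  by_cases hω : ω ∈ G <;> simp [hω]

theorem integral_marginalCost_trunc_nonpos (n : ℕ) :
    ∫ ω, ∑ i, ∫ t, c.marginalCost ω.1 (A ω) t i ∂(((A ω).trunc n).dMeasure i) ∂P ≤ 0 := by
  have derivative_nonneg := (c.finiteCost measurable_fst hA.measurable hfin).first_order hg hh hΦ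
    measurable_fst hA.measurable (hA.trunc n).measurable (norm_nonneg _) (σ := -1)
    (a := fun ε ω => (A ω).subTrunc n (projIcc 0 1 zero_le_one ε))
    (fun ω s => IncSkorokhod.norm_trunc_le _ _ _)
    (fun ε h0 h1 ω s => by
      rw [IncSkorokhod.subTrunc_apply, projIcc_of_mem zero_le_one ⟨h0, h1⟩, neg_one_smul, smul_neg,
        sub_eq_add_neg])
    (fun ε _ _ => hopt _ (hA.subTrunc n _))
  linarith

end Optimum

end Directions

/-! ### The dual process -/

section Dual

theorem integrable_setIntegral_prod {Ω X F : Type*} [MeasurableSpace Ω] [MeasurableSpace X]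
    [NormedAddCommGroup F] [NormedSpace ℝ F] {P : Measure Ω} {ν : Measure X} [SFinite ν]
    {ψ : Ω × X → F} (hψ : Integrable ψ (P.prod ν)) {S : Set X} (hS : MeasurableSet S) :
    Integrable (fun ω => ∫ s in S, ψ (ω, s) ∂ν) P := by
  simp_rw [← integral_indicator hS]
  exact (hψ.indicator (measurable_snd hS)).integral_prod_left

theorem ae_eq_condExp_of_forall_apply {ι Ω : Type*} [Fintype ι] {m mΩ : MeasurableSpace Ω}
    {P : Measure Ω} {N Z : Ω → EuclideanSpace ℝ ι} (hZ : Integrable Z P)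
    (h : ∀ i, (fun ω => N ω i) =ᵐ[P] P[fun ω => Z ω i | m]) : N =ᵐ[P] P[Z | m] := by
  have condExp_apply (i : ι) : ∀ᵐ ω ∂P, P[Z | m] ω i = P[fun ω => Z ω i | m] ω :=
    (EuclideanSpace.proj (𝕜 := ℝ) i : EuclideanSpace ℝ ι →L[ℝ] ℝ).comp_condExp_comm hZ
  filter_upwards [ae_all_iff.2 h, ae_all_iff.2 condExp_apply] with ω N_eq Z_eq
  ext i
  exact (N_eq i).trans (Z_eq i).symm

theorem martingale_of_ae_eq_condExp {ι Ω F : Type*} [Preorder ι] {mΩ : MeasurableSpace Ω}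
    [NormedAddCommGroup F] [NormedSpace ℝ F] [CompleteSpace F] {P : Measure Ω}
    {f : Filtration ι mΩ} [SigmaFiniteFiltration P f] {N : ι → Ω → F} {Z : Ω → F}
    (hN : StronglyAdapted f N) (h : ∀ t, N t =ᵐ[P] P[Z | f t]) : Martingale N f P :=
  ⟨hN, fun s t hst => (condExp_congr_ae (h t)).trans
    ((condExp_condExp_of_le (f.mono hst) (f.le t)).trans (h s).symm)⟩

variable {T : ℝ} [Fact (0 < T)] {d k : ℕ} {Ω : Type*} {mΩ : MeasurableSpace Ω}
  {c : CostData T d k}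

/-- The gradient of the running cost, accumulated up to the time `t`. -/
def CostData.accumulatedGrad (c : CostData T d k) (L : Skorokhod T d) (A : IncSkorokhod T k)
    (t : Time T) : E k :=
  ∫ s in Iic t, grad c.h (L s) (A s) ∂leb T

/-- The gradient of the terminal cost plus the accumulated gradient of the running cost. The dual
process is, up to an adapted process, the martingale which it closes. -/
def CostData.totalGrad (c : CostData T d k) (L : Skorokhod T d) (A : IncSkorokhod T k) : E k :=
  grad c.g (L ⊤) (A ⊤) + ∫ s, grad c.h (L s) (A s) ∂leb T

section Path

variable {L : Skorokhod T d} {A : IncSkorokhod T k}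

theorem CostData.marginalCost_eq (hψ : Integrable (fun s => grad c.h (L s) (A s)) (leb T))
    (t : Time T) :
    c.marginalCost L A t = c.totalGrad L A + (c.f t - c.accumulatedGrad L A t) := by
  rw [marginalCost, setIntegral_Ici_eq_sub hψ, totalGrad, accumulatedGrad]
  abel

theorem CostData.marginalCost_top (c : CostData T d k) (L : Skorokhod T d) (A : IncSkorokhod T k) :
    c.marginalCost L A ⊤ = c.f ⊤ + grad c.g (L ⊤) (A ⊤) := by
  rw [marginalCost, Ici_top, setIntegral_measure_zero _ (measure_singleton _), add_zero]

end Path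

theorem CostData.measurable_accumulatedGrad (hh : IsC1InControl c.h) {L : Ω → Skorokhod T d}
    {A : Ω → IncSkorokhod T k} {t : Time T} (hL : ∀ s ≤ t, Measurable fun ω => L ω s)
    (hA : ∀ s ≤ t, Measurable fun ω => A ω s) :
    Measurable fun ω => c.accumulatedGrad (L ω) (A ω) t := by
  have stopped_eq (ω : Ω) : c.accumulatedGrad (L ω) (A ω) t =
      ∫ s in Iic t, grad c.h (L ω (min s t)) (A ω (min s t)) ∂leb T :=
    setIntegral_congr_fun measurableSet_Iic fun s hs => by
      simp only [min_eq_left (mem_Iic.1 hs)]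
  simp_rw [stopped_eq]
  exact (measurable_grad_comp_of_mem c.h_measurable
    (measurable_uncurry_min_of_isCadlag (fun ω => (L ω).2) hL)
    (measurable_uncurry_min_of_isCadlag (fun ω => (A ω).2.1) hA)
    (fun p => (A p.1).mem_orthant _) hh).stronglyMeasurable.integral_prod_right'.measurable

theorem CostData.measurable_accumulatedGrad_of_adapted (hh : IsC1InControl c.h)
    {f : Filtration (Time T) mΩ} {L : Ω → Skorokhod T d} {A : Ω → IncSkorokhod T k}
    (hL : ∀ t, Measurable[f t] fun ω => L ω t) (hA : ∀ t, Measurable[f t] fun ω => A ω t)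
    (t : Time T) : Measurable[f t] fun ω => c.accumulatedGrad (L ω) (A ω) t :=
  @measurable_accumulatedGrad T _ d k Ω (f t) c hh L A t
    (fun s hs => (hL s).mono (f.mono hs) le_rfl) fun s hs => (hA s).mono (f.mono hs) le_rfl

theorem CostData.measurable_grad_g_top (hg : IsC1InControl c.g) {L : Ω → Skorokhod T d}
    {A : Ω → IncSkorokhod T k} (hL : Measurable fun ω => L ω ⊤)
    (hA : Measurable fun ω => A ω ⊤) : Measurable fun ω => grad c.g (L ω ⊤) (A ω ⊤) :=
  measurable_grad_comp_of_mem c.g_measurable hL hA (fun ω => (A ω).mem_orthant ⊤) hg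

variable {P : Measure Ω} {L : Ω → Skorokhod T d} {A : Ω → IncSkorokhod T k}

namespace CostData.FiniteCost

section Integrability

variable {Φg Φh : E d → ℝ≥0} {M : ℝ≥0} (hfin : c.FiniteCost P L A) (hg : IsC1InControl c.g)
  (hh : IsC1InControl c.h) (hΦ : c.IntegrableGrowth P L Φg Φh M) (hL : Measurable L)
  (hA : Measurable A)

section Gradient

include hfin hh hΦ hL hA

include hg in
theorem integrable_totalGrad : Integrable (fun ω => c.totalGrad (L ω) (A ω)) P :=
  (hfin.integrable_grad_g hΦ hL hA hg).add
    (hfin.integrable_grad_h hΦ hL hA hh).integral_prod_left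

theorem integrable_accumulatedGrad (t : Time T) :
    Integrable (fun ω => c.accumulatedGrad (L ω) (A ω) t) P :=
  integrable_setIntegral_prod (hfin.integrable_grad_h hΦ hL hA hh) measurableSet_Iic

theorem ae_integrable_grad_h [SFinite P] :
    ∀ᵐ ω ∂P, Integrable (fun s => grad c.h (L ω s) (A ω s)) (leb T) :=
  (hfin.integrable_grad_h hΦ hL hA hh).prod_right_ae

end Gradient

variable [IsFiniteMeasure P]

include hfin hg hh hΦ hL hA

theorem integrable_marginalCost (t : Time T) :
    Integrable (fun ω => c.marginalCost (L ω) (A ω) t) P :=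
  ((integrable_const _).add (hfin.integrable_grad_g hΦ hL hA hg)).add
    (integrable_setIntegral_prod (hfin.integrable_grad_h hΦ hL hA hh) measurableSet_Ici)

theorem exists_norm_marginalCost_le :
    ∃ B : Ω → ℝ, Integrable B P ∧ ∀ᵐ ω ∂P, ∀ t, ‖c.marginalCost (L ω) (A ω) t‖ ≤ B ω := by
  have integrable_grad_h := hfin.integrable_grad_h hΦ hL hA hh
  obtain ⟨K, hK⟩ := (isCadlag_of_continuous c.f_continuous).exists_norm_le
  refine ⟨fun ω => K + ‖grad c.g (L ω ⊤) (A ω ⊤)‖ + ∫ s, ‖grad c.h (L ω s) (A ω s)‖ ∂leb T,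
    ((integrable_const _).add (hfin.integrable_grad_g hΦ hL hA hg).norm).add
      integrable_grad_h.norm.integral_prod_left, ?_⟩
  filter_upwards [integrable_grad_h.prod_right_ae] with ω hω t
  refine (norm_add_le _ _).trans (add_le_add ((norm_add_le _ _).trans
    (add_le_add (hK t) le_rfl)) ?_)
  exact (norm_integral_le_integral_norm _).trans
    (setIntegral_le_integral hω.norm (Eventually.of_forall fun s => norm_nonneg _))

end Integrability

section Adapted

variable {Φg Φh : E d → ℝ≥0} {M : ℝ≥0} {f : Filtration (Time T) mΩ} [IsFiniteMeasure P]
  (hfin : c.FiniteCost P L A) (hg : IsC1InControl c.g)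
  (hh : IsC1InControl c.h) (hΦ : c.IntegrableGrowth P L Φg Φh M)
  (hL : ∀ t, Measurable[f t] fun ω => L ω t) (hA : ∀ t, Measurable[f t] fun ω => A ω t)

include hfin hg hh hΦ hL hA

theorem condExp_marginalCost (t : Time T) (i : Fin k) :
    P[fun ω => c.marginalCost (L ω) (A ω) t i | f t] =ᵐ[P] fun ω =>
      P[fun ω => c.totalGrad (L ω) (A ω) i | f t] ω
        + (c.f t - c.accumulatedGrad (L ω) (A ω) t) i := by
  have measurable_L := Skorokhod.measurable_iff.2 fun t => (hL t).mono (f.le t) le_rfl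
  have measurable_A := IncSkorokhod.measurable_iff.2 fun t => (hA t).mono (f.le t) le_rfl
  have marginalCost_ae_eq : (fun ω => c.marginalCost (L ω) (A ω) t i) =ᵐ[P]
      (fun ω => c.totalGrad (L ω) (A ω) i)
        + fun ω => (c.f t - c.accumulatedGrad (L ω) (A ω) t) i := by
    filter_upwards [hfin.ae_integrable_grad_h hh hΦ measurable_L measurable_A] with ω hω
    rw [CostData.marginalCost_eq hω]
    rfl
  have integrable_adapted : Integrable (fun ω => (c.f t - c.accumulatedGrad (L ω) (A ω) t) i) P :=
    integrable_piLp_iff.1 ((integrable_const _).sub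
      (hfin.integrable_accumulatedGrad hh hΦ measurable_L measurable_A t)) i
  have measurable_adapted :
      Measurable[f t] fun ω => (c.f t - c.accumulatedGrad (L ω) (A ω) t) i :=
    (@measurable_euclidean_iff _ _ (f t) _).1
      (measurable_const.sub (CostData.measurable_accumulatedGrad_of_adapted hh hL hA t)) i
  have integrable_totalGrad : Integrable (fun ω => c.totalGrad (L ω) (A ω) i) P :=
    integrable_piLp_iff.1 (hfin.integrable_totalGrad hg hh hΦ measurable_L measurable_A) i
  refine (condExp_congr_ae marginalCost_ae_eq).trans
    ((condExp_add integrable_totalGrad integrable_adapted _).trans ?_)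
  rw [condExp_of_stronglyMeasurable (f.le t) measurable_adapted.stronglyMeasurable
    integrable_adapted]
  rfl

theorem exists_dual_process [f.IsRightContinuous]
    (hnull : ∀ t S, MeasurableSet S → P S = 0 → MeasurableSet[f t] S) :
    ∃ Y : Ω → Skorokhod T k, (∀ t, Measurable[f t] fun ω => Y ω t) ∧
      (∀ t i, (fun ω => Y ω t i) =ᵐ[P] P[fun ω => c.marginalCost (L ω) (A ω) t i | f t]) ∧
      Martingale (fun t ω => Y ω t + c.accumulatedGrad (L ω) (A ω) t - c.f t) f P := by
  have measurable_L := Skorokhod.measurable_iff.2 fun t => (hL t).mono (f.le t) le_rfl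
  have measurable_A := IncSkorokhod.measurable_iff.2 fun t => (hA t).mono (f.le t) le_rfl
  have integrable_totalGrad := hfin.integrable_totalGrad hg hh hΦ measurable_L measurable_A
  obtain ⟨N, isCadlag_N, measurable_N, N_ae_eq⟩ :=
    exists_cadlag_condExp f hnull integrable_totalGrad
  have measurable_acc := CostData.measurable_accumulatedGrad_of_adapted hh hL hA
  have measurable_X (t : Time T) :
      Measurable[f t] fun ω => N ω t + (c.f t - c.accumulatedGrad (L ω) (A ω) t) :=
    (measurable_N t).add (measurable_const.sub (measurable_acc t))
  have isCadlag_X :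
      ∀ᵐ ω ∂P, IsCadlag fun t => N ω t + (c.f t - c.accumulatedGrad (L ω) (A ω) t) := by
    filter_upwards [hfin.ae_integrable_grad_h hh hΦ measurable_L measurable_A] with ω hω
    exact (isCadlag_N ω).map₂ (isCadlag_of_continuous
      (c.f_continuous.sub (continuous_setIntegral_Iic hω))) (F := fun x y => x + y) (by fun_prop)
  obtain ⟨Y, isCadlag_Y, measurable_Y, Y_ae_eq⟩ := exists_modification_of_ae hnull measurable_X
    (y := 0) (isCadlag_of_continuous continuous_const) isCadlag_X
  refine ⟨fun ω => ⟨Y ω, isCadlag_Y ω⟩, measurable_Y, fun t i => ?_,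
    martingale_of_ae_eq_condExp (fun t => (((measurable_Y t).add (measurable_acc t)).sub
      measurable_const).stronglyMeasurable)
      fun t => ae_eq_condExp_of_forall_apply integrable_totalGrad fun i => ?_⟩
  · filter_upwards [hfin.condExp_marginalCost hg hh hΦ hL hA t i, N_ae_eq t i, Y_ae_eq]
      with ω condExp_eq hN hY
    rw [condExp_eq, ← hN]
    exact congrArg (fun y => y t i) hY
  · filter_upwards [N_ae_eq t i, Y_ae_eq] with ω hN hY
    have Y_add_sub : Y ω t + c.accumulatedGrad (L ω) (A ω) t - c.f t = N ω t := by
      simp only [hY]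
      abel
    rw [← hN, ← Y_add_sub]

end Adapted

end CostData.FiniteCost

end Dual

/-! ### Complementary slackness -/

section Slackness

theorem condExp_nonneg_of_forall_setIntegral_nonneg {Ω : Type*} {m mΩ : MeasurableSpace Ω}
    {P : Measure Ω} (hm : m ≤ mΩ) [SigmaFinite (P.trim hm)] {γ : Ω → ℝ} (hγ : Integrable γ P)
    (h : ∀ G, MeasurableSet[m] G → 0 ≤ ∫ ω in G, γ ω ∂P) : 0 ≤ᵐ[P] P[γ | m] := by
  refine ae_le_of_ae_le_trim (hm := hm) (ae_nonneg_of_forall_setIntegral_nonneg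
    (integrable_condExp.trim hm stronglyMeasurable_condExp) fun G hG _ => ?_)
  rw [← setIntegral_trim hm stronglyMeasurable_condExp hG, setIntegral_condExp hm hγ hG]
  exact h G hG

theorem lintegral_ofReal_le_of_tendsto {Ω : Type*} [MeasurableSpace Ω] {P : Measure Ω}
    {u : ℕ → Ω → ℝ} {v : Ω → ℝ} {l : ℝ} (hu : ∀ n, Integrable (u n) P)
    (h0 : ∀ n, 0 ≤ᵐ[P] u n) (hv : ∀ᵐ ω ∂P, Tendsto (fun n => u n ω) atTop (𝓝 (v ω)))
    (hl : Tendsto (fun n => ∫ ω, u n ω ∂P) atTop (𝓝 l)) :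
    ∫⁻ ω, ENNReal.ofReal (v ω) ∂P ≤ ENNReal.ofReal l := by
  calc ∫⁻ ω, ENNReal.ofReal (v ω) ∂P
      = ∫⁻ ω, liminf (fun n => ENNReal.ofReal (u n ω)) atTop ∂P :=
        lintegral_congr_ae (hv.mono fun ω hω =>
          ((ENNReal.continuous_ofReal.tendsto _).comp hω).liminf_eq.symm)
    _ ≤ liminf (fun n => ∫⁻ ω, ENNReal.ofReal (u n ω) ∂P) atTop :=
        lintegral_liminf_le' fun n => (hu n).1.aemeasurable.ennreal_ofReal
    _ = liminf (fun n => ENNReal.ofReal (∫ ω, u n ω ∂P)) atTop := by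
        simp_rw [ofReal_integral_eq_lintegral_ofReal (hu _) (h0 _)]
    _ = ENNReal.ofReal l := ((ENNReal.continuous_ofReal.tendsto _).comp hl).liminf_eq

variable {T : ℝ} [Fact (0 < T)] {k : ℕ}

theorem Skorokhod.nonneg_of_forall_mem_dyadics (y : Skorokhod T k)
    (hy : ∀ t ∈ dyadics T, ∀ i, 0 ≤ y t i) (t : Time T) (i : Fin k) : 0 ≤ y t i :=
  ge_of_tendsto (((by fun_prop : Continuous fun a : E k => a i).tendsto _).comp
    (y.2.tendsto_comp_gridUp t)) (Eventually.of_forall fun n => hy _ (gridUp_mem_dyadics n t) i)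

theorem abs_gridIncr_le {b : Time T → ℝ} (hb : Monotone b) (h0 : 0 ≤ b ⊥) (n j : ℕ) :
    |gridIncr n b j| ≤ b ⊤ := by
  rw [abs_of_nonneg (gridIncr_nonneg n hb h0 j)]
  cases j with
  | zero => exact hb le_top
  | succ j => exact (sub_le_self _ (h0.trans (hb bot_le))).trans (hb le_top)

variable {Ω : Type*} {mΩ : MeasurableSpace Ω} {P : Measure Ω} {f : Filtration (Time T) mΩ}

theorem measurable_gridIncr {b : Ω → Time T → ℝ} (hb : ∀ t, Measurable[f t] fun ω => b ω t)
    (n j : ℕ) : Measurable[f (gridPt T n j)] fun ω => gridIncr n (b ω) j := by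
  cases j with
  | zero => exact hb _
  | succ j => exact (hb _).sub ((hb _).mono (f.mono (gridPt_mono n j.le_succ)) le_rfl)

section RiemannSum

variable {R : ℝ} {b : Ω → Time T → ℝ} (hb : ∀ t, Measurable[f t] fun ω => b ω t)
  (hmono : ∀ ω, Monotone (b ω)) (h0 : ∀ ω, 0 ≤ b ω ⊥) (hR : ∀ ω, b ω ⊤ ≤ R) {y γ : Ω → Time T → ℝ}

include hb hmono h0 hR

theorem integrable_gridIncr_mul {u : Ω → ℝ} (hu : Integrable u P) (n j : ℕ) :
    Integrable (fun ω => gridIncr n (b ω) j * u ω) P :=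
  hu.bdd_mul ((measurable_gridIncr hb n j).mono (f.le _) le_rfl).aestronglyMeasurable
    (Eventually.of_forall fun ω => (abs_gridIncr_le (hmono ω) (h0 ω) n j).trans (hR ω))

theorem integrable_riemannSum (hy : ∀ t, Integrable (fun ω => y ω t) P) (n : ℕ) :
    Integrable (fun ω => riemannSum n (y ω) (b ω)) P :=
  integrable_finsetSum _ fun j _ => integrable_gridIncr_mul hb hmono h0 hR (hy _) n j

theorem integral_riemannSum_eq_of_condExp [IsFiniteMeasure P]
    (hγ : ∀ t, Integrable (fun ω => γ ω t) P)
    (hy : ∀ t, (fun ω => y ω t) =ᵐ[P] P[fun ω => γ ω t | f t]) (n : ℕ) :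
    ∫ ω, riemannSum n (y ω) (b ω) ∂P = ∫ ω, riemannSum n (γ ω) (b ω) ∂P := by
  have integrable_y (t : Time T) : Integrable (fun ω => y ω t) P :=
    integrable_condExp.congr (hy t).symm
  unfold riemannSum
  rw [integral_finsetSum _ fun j _ => integrable_gridIncr_mul hb hmono h0 hR (integrable_y _) n j,
    integral_finsetSum _ fun j _ => integrable_gridIncr_mul hb hmono h0 hR (hγ _) n j]
  refine Finset.sum_congr rfl fun j _ => ?_
  rw [← integral_condExp (f.le (gridPt T n j)) (f := fun ω =>
    gridIncr n (b ω) j * γ ω (gridPt T n j))]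
  refine integral_congr_ae ?_
  filter_upwards [hy (gridPt T n j), condExp_mul_of_stronglyMeasurable_left (μ := P)
    (measurable_gridIncr hb n j).stronglyMeasurable
    (integrable_gridIncr_mul hb hmono h0 hR (hγ (gridPt T n j)) n j) (hγ (gridPt T n j))]
    with ω hω condExp_mul_eq
  rw [hω]
  exact condExp_mul_eq.symm

end RiemannSum

variable {a : Ω → IncSkorokhod T k} {Y : Ω → Skorokhod T k} {Γ : Ω → Time T → E k}

theorem ae_nonneg_of_condExp [IsFiniteMeasure P] (hΓi : ∀ t, Integrable (fun ω => Γ ω t) P)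
    (hY : ∀ t i, (fun ω => Y ω t i) =ᵐ[P] P[fun ω => Γ ω t i | f t])
    (hΓ : ∀ t G, MeasurableSet[f t] G → ∀ i, 0 ≤ ∫ ω in G, Γ ω t i ∂P) :
    ∀ᵐ ω ∂P, ∀ t i, 0 ≤ Y ω t i := by
  have ae_nonneg (t : Time T) (i : Fin k) : ∀ᵐ ω ∂P, 0 ≤ Y ω t i := by
    filter_upwards [hY t i, condExp_nonneg_of_forall_setIntegral_nonneg (f.le t)
      (integrable_piLp_iff.1 (hΓi t) i) fun G hG => hΓ t G hG i] with ω Y_eq condExp_nonneg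
    exact condExp_nonneg.trans_eq Y_eq.symm
  filter_upwards [(ae_ball_iff countable_dyadics).2 fun t _ => ae_all_iff.2 (ae_nonneg t)]
    with ω hω
  exact (Y ω).nonneg_of_forall_mem_dyadics hω

section BoundedControl

variable (ham : ∀ t, Measurable[f t] fun ω => a ω t) {R : ℝ} (haR : ∀ ω i, a ω ⊤ i ≤ R)

include ham haR

theorem integrable_riemannSum_incSkorokhod {y : Ω → Time T → ℝ}
    (hy : ∀ t, Integrable (fun ω => y ω t) P) (n : ℕ) (i : Fin k) :
    Integrable (fun ω => riemannSum n (y ω) fun t => a ω t i) P :=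
  integrable_riemannSum (fun t => (@measurable_euclidean_iff _ _ (f t) _).1 (ham t) i)
    (fun ω => (a ω).2.2.1 i) (fun ω => (a ω).nonneg i ⊥) (fun ω => haR ω i) hy n

theorem tendsto_integral_riemannSum (hΓi : ∀ t, Integrable (fun ω => Γ ω t) P)
    (hΓc : ∀ᵐ ω ∂P, IsCadlag (Γ ω)) {B : Ω → ℝ} (hB : Integrable B P)
    (hΓB : ∀ᵐ ω ∂P, ∀ t, ‖Γ ω t‖ ≤ B ω) :
    Tendsto (fun n => ∫ ω, ∑ i, riemannSum n (fun t => Γ ω t i) (fun t => a ω t i) ∂P) atTop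
      (𝓝 (∫ ω, ∑ i, ∫ t, Γ ω t i ∂((a ω).dMeasure i) ∂P)) := by
  refine tendsto_integral_of_dominated_convergence (fun ω => ∑ _i : Fin k, B ω * R)
    (fun n => (integrable_finsetSum _ fun i _ => integrable_riemannSum_incSkorokhod ham haR
      (fun t => integrable_piLp_iff.1 (hΓi t) i) n i).1)
    (integrable_finsetSum _ fun i _ => hB.mul_const _) (fun n => ?_) ?_
  · filter_upwards [hΓB] with ω hω
    refine (norm_sum_le _ _).trans (Finset.sum_le_sum fun i _ => ?_)
    refine (abs_riemannSum_le n (fun t => (PiLp.norm_apply_le (Γ ω t) i).trans (hω t))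
      ((a ω).2.2.1 i) ((a ω).nonneg i ⊥)).trans ?_
    exact mul_le_mul_of_nonneg_left (haR ω i) ((norm_nonneg _).trans (hω ⊤))
  · filter_upwards [hΓc] with ω hω
    exact tendsto_finsetSum _ fun i _ => (a ω).tendsto_riemannSum i hω i

variable [IsFiniteMeasure P]

theorem integral_sum_riemannSum_eq_of_condExp (hΓi : ∀ t, Integrable (fun ω => Γ ω t) P)
    (hY : ∀ t i, (fun ω => Y ω t i) =ᵐ[P] P[fun ω => Γ ω t i | f t]) (n : ℕ) :
    ∫ ω, ∑ i, riemannSum n (fun t => Y ω t i) (fun t => a ω t i) ∂P =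
      ∫ ω, ∑ i, riemannSum n (fun t => Γ ω t i) (fun t => a ω t i) ∂P := by
  have integrable_Γ (i : Fin k) (t : Time T) : Integrable (fun ω => Γ ω t i) P :=
    integrable_piLp_iff.1 (hΓi t) i
  have integrable_Y (i : Fin k) (t : Time T) : Integrable (fun ω => Y ω t i) P :=
    integrable_condExp.congr (hY t i).symm
  rw [integral_finsetSum _ fun i _ =>
      integrable_riemannSum_incSkorokhod ham haR (integrable_Y i) n i,
    integral_finsetSum _ fun i _ =>
      integrable_riemannSum_incSkorokhod ham haR (integrable_Γ i) n i]
  exact Finset.sum_congr rfl fun i _ => integral_riemannSum_eq_of_condExp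
    (fun t => (@measurable_euclidean_iff _ _ (f t) _).1 (ham t) i) (fun ω => (a ω).2.2.1 i)
    (fun ω => (a ω).nonneg i ⊥) (fun ω => haR ω i) (integrable_Γ i) (fun t => hY t i) n

variable (hΓi : ∀ t, Integrable (fun ω => Γ ω t) P)
  (hY : ∀ t i, (fun ω => Y ω t i) =ᵐ[P] P[fun ω => Γ ω t i | f t])
  (hY0 : ∀ᵐ ω ∂P, ∀ t i, 0 ≤ Y ω t i) (hΓc : ∀ᵐ ω ∂P, IsCadlag (Γ ω)) {B : Ω → ℝ}
  (hB : Integrable B P) (hΓB : ∀ᵐ ω ∂P, ∀ t, ‖Γ ω t‖ ≤ B ω)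

include hΓi hY hY0 hΓc hB hΓB

theorem lintegral_sum_integral_dMeasure_le :
    ∫⁻ ω, ENNReal.ofReal (∑ i, ∫ t, Y ω t i ∂((a ω).dMeasure i)) ∂P ≤
      ENNReal.ofReal (∫ ω, ∑ i, ∫ t, Γ ω t i ∂((a ω).dMeasure i) ∂P) := by
  refine lintegral_ofReal_le_of_tendsto
    (u := fun n ω => ∑ i, riemannSum n (fun t => Y ω t i) fun t => a ω t i)
    (fun n => integrable_finsetSum _ fun i _ => integrable_riemannSum_incSkorokhod ham haR
      (fun t => integrable_condExp.congr (hY t i).symm) n i) (fun n => ?_)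
    (ae_of_all _ fun ω => tendsto_finsetSum _ fun i _ => (a ω).tendsto_riemannSum i (Y ω).2 i) ?_
  · filter_upwards [hY0] with ω hω
    exact Finset.sum_nonneg fun i _ => riemannSum_nonneg n (fun t => hω t i)
      ((a ω).2.2.1 i) ((a ω).nonneg i ⊥)
  · simp_rw [integral_sum_riemannSum_eq_of_condExp ham haR hΓi hY]
    exact tendsto_integral_riemannSum ham haR hΓi hΓc hB hΓB

theorem ae_sum_integral_dMeasure_eq_zero (hYm : Measurable Y)
    (hle : ∫ ω, ∑ i, ∫ t, Γ ω t i ∂((a ω).dMeasure i) ∂P ≤ 0) :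
    ∀ᵐ ω ∂P, ∑ i, ∫ t, Y ω t i ∂((a ω).dMeasure i) = 0 := by
  have measurable_a := IncSkorokhod.measurable_iff.2 fun t => (ham t).mono (f.le t) le_rfl
  have measurable_sum : Measurable fun ω => ∑ i, ∫ t, Y ω t i ∂((a ω).dMeasure i) :=
    Finset.measurable_fun_sum _ fun i _ => measurable_integral_dMeasure measurable_a
      (fun ω => (Y ω).2) (Skorokhod.measurable_iff.1 hYm) i i
  have lintegral_eq_zero :
      ∫⁻ ω, ENNReal.ofReal (∑ i, ∫ t, Y ω t i ∂((a ω).dMeasure i)) ∂P = 0 :=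
    le_bot_iff.1 ((lintegral_sum_integral_dMeasure_le ham haR hΓi hY hY0 hΓc hB hΓB).trans_eq
      (ENNReal.ofReal_of_nonpos hle))
  filter_upwards [(lintegral_eq_zero_iff measurable_sum.ennreal_ofReal).1 lintegral_eq_zero, hY0]
    with ω sum_nonpos Y_nonneg
  exact le_antisymm (ENNReal.ofReal_eq_zero.1 sum_nonpos)
    (Finset.sum_nonneg fun i _ => integral_nonneg fun t => Y_nonneg t i)

end BoundedControl

theorem IncSkorokhod.exists_trunc_eq (A : IncSkorokhod T k) : ∃ n : ℕ, A.trunc n = A := by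
  obtain ⟨n, hn⟩ := exists_nat_ge ‖A ⊤‖
  refine ⟨n, Subtype.ext (funext fun t => ?_)⟩
  ext i
  exact min_eq_left ((A.apply_le_apply_top i t).trans ((le_abs_self _).trans
    ((PiLp.norm_apply_le (A ⊤) i).trans hn)))

end Slackness

/-! ### The law of the triple -/

section Law

section Martingale

variable {ι Ω Ω' F : Type*} [Preorder ι] {mΩ : MeasurableSpace Ω} {mΩ' : MeasurableSpace Ω'}
  [NormedAddCommGroup F] [NormedSpace ℝ F] [CompleteSpace F] {P : Measure Ω}
  {f : Filtration ι mΩ} {f' : Filtration ι mΩ'}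

theorem martingale_map [IsFiniteMeasure P] {j : Ω → Ω'} (hj : Measurable j)
    (hjf : ∀ t S, MeasurableSet[f' t] S → MeasurableSet[f t] (j ⁻¹' S)) {N : ι → Ω' → F}
    (hN : StronglyAdapted f' N) (h : Martingale (fun t ω => N t (j ω)) f P) :
    Martingale N f' (P.map j) := by
  have aestronglyMeasurable_N (t : ι) : AEStronglyMeasurable (N t) (P.map j) :=
    ((hN t).mono (f'.le t)).aestronglyMeasurable
  have integrable_N (t : ι) : Integrable (N t) (P.map j) :=
    (integrable_map_measure (aestronglyMeasurable_N t) hj.aemeasurable).2 (h.integrable t)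
  refine ⟨hN, fun s t hst => (ae_eq_condExp_of_forall_setIntegral_eq (f'.le s) (integrable_N t)
    (fun _ _ _ => (integrable_N s).integrableOn) (fun S hS _ => ?_)
    (hN s).aestronglyMeasurable).symm⟩
  rw [setIntegral_map (f'.le s S hS) (aestronglyMeasurable_N s) hj.aemeasurable,
    setIntegral_map (f'.le s S hS) (aestronglyMeasurable_N t) hj.aemeasurable]
  exact h.setIntegral_eq hst (hjf s S hS)

end Martingale

variable {T : ℝ} [Fact (0 < T)] {d k : ℕ} {c : CostData T d k}

/-- The process of the Pontryagin system which is required to be a martingale. -/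
def CostData.dualMartingale (c : CostData T d k) (t : Time T) (τ : Triple T d k) : E k :=
  τ.2.2 t + c.accumulatedGrad τ.1 τ.2.1 t - c.f t

theorem measurable_eval_filtLAY (t : Time T) :
    Measurable[filtLAY T d k t] fun τ : Triple T d k => (τ.1 t, τ.2.1 t, τ.2.2 t) :=
  Measurable.of_comap_le (le_iSup₂_of_le t le_rfl le_rfl)

theorem CostData.measurable_dualMartingale (hh : IsC1InControl c.h) (t : Time T) :
    Measurable[filtLAY T d k t] (c.dualMartingale t) := by
  have measurable_accumulatedGrad := measurable_accumulatedGrad_of_adapted hh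
    (f := filtLAY T d k) (L := Prod.fst) (A := fun τ => τ.2.1)
    (fun t => measurable_fst.comp (measurable_eval_filtLAY t))
    (fun t => (measurable_fst.comp measurable_snd).comp (measurable_eval_filtLAY t)) t
  exact (((measurable_snd.comp measurable_snd).comp (measurable_eval_filtLAY t)).add
    measurable_accumulatedGrad).sub measurable_const

theorem measurableSet_nonneg : MeasurableSet {y : Skorokhod T k | ∀ t i, 0 ≤ y t i} := by
  have eq_biInter : {y : Skorokhod T k | ∀ t i, 0 ≤ y t i} =
      ⋂ t ∈ dyadics T, ⋂ i, {y : Skorokhod T k | 0 ≤ y t i} := by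
    ext y
    simp only [mem_iInter, mem_ofPred_eq]
    exact ⟨fun h t _ i => h t i, y.nonneg_of_forall_mem_dyadics⟩
  rw [eq_biInter]
  exact MeasurableSet.biInter countable_dyadics fun t _ => MeasurableSet.iInter fun i =>
    measurableSet_le measurable_const (measurable_euclidean_iff.1 (Skorokhod.measurable_eval t) i)

section Transfer

variable {Ω : Type*} {mΩ : MeasurableSpace Ω} {P : Measure Ω} {f : Filtration (Time T) mΩ}
  {L : Ω → Skorokhod T d} {A : Ω → IncSkorokhod T k} {Y : Ω → Skorokhod T k}
  (hL : ∀ t, Measurable[f t] fun ω => L ω t) (hA : ∀ t, Measurable[f t] fun ω => A ω t)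
  (hY : ∀ t, Measurable[f t] fun ω => Y ω t)

include hL hA hY

theorem measurable_triple : Measurable fun ω => ((L ω, A ω, Y ω) : Triple T d k) :=
  (Skorokhod.measurable_iff.2 fun t => (hL t).mono (f.le t) le_rfl).prodMk
    ((IncSkorokhod.measurable_iff.2 fun t => (hA t).mono (f.le t) le_rfl).prodMk
      (Skorokhod.measurable_iff.2 fun t => (hY t).mono (f.le t) le_rfl))

theorem measurableSet_preimage_filtLAY (t : Time T) (S : Set (Triple T d k))
    (hS : MeasurableSet[filtLAY T d k t] S) :
    MeasurableSet[f t] ((fun ω => ((L ω, A ω, Y ω) : Triple T d k)) ⁻¹' S) := by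
  have le_map : filtLAY T d k t ≤ (f t).map fun ω => ((L ω, A ω, Y ω) : Triple T d k) := by
    refine iSup₂_le fun s hs => ?_
    rw [MeasurableSpace.comap_le_iff_le_map]
    exact (((hL s).prodMk ((hA s).prodMk (hY s))).mono (f.mono hs) le_rfl).le_map
  exact le_map S hS

theorem isPontryaginSolution_map [IsProbabilityMeasure P] {P₀ : Measure (Skorokhod T d)}
    (hg : IsC1InControl c.g) (hh : IsC1InControl c.h)
    (hadm : Admissible P₀ (P.map fun ω => (L ω, A ω))) (hY0 : ∀ᵐ ω ∂P, ∀ t i, 0 ≤ Y ω t i)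
    (hYA : ∀ᵐ ω ∂P, ∑ i, ∫ t, Y ω t i ∂((A ω).dMeasure i) = 0)
    (hgrad : ∀ᵐ ω ∂P, Integrable (fun t => grad c.h (L ω t) (A ω t)) (leb T))
    (hmart : Martingale (fun t ω => c.dualMartingale t (L ω, A ω, Y ω)) f P)
    (hYT : ∀ᵐ ω ∂P, Y ω ⊤ = c.f ⊤ + grad c.g (L ω ⊤) (A ω ⊤)) :
    IsPontryaginSolution c P₀ (P.map fun ω => (L ω, A ω, Y ω)) := by
  have measurable_LAY := measurable_triple hL hA hY
  have measurable_A : Measurable fun τ : Triple T d k => τ.2.1 :=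
    measurable_fst.comp measurable_snd
  have measurable_Y : Measurable fun τ : Triple T d k => τ.2.2 :=
    measurable_snd.comp measurable_snd
  refine ⟨Measure.isProbabilityMeasure_map measurable_LAY.aemeasurable, ?_,
    (ae_map_iff measurable_LAY.aemeasurable (measurable_Y measurableSet_nonneg)).2 hY0,
    (ae_map_iff measurable_LAY.aemeasurable (measurableSet_eq_fun ?_ measurable_const)).2 hYA,
    (ae_map_iff measurable_LAY.aemeasurable ?_).2 hgrad,
    martingale_map measurable_LAY (measurableSet_preimage_filtLAY hL hA hY)
      (fun t => (CostData.measurable_dualMartingale hh t).stronglyMeasurable) hmart,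
    (ae_map_iff measurable_LAY.aemeasurable (measurableSet_eq_fun
      (Skorokhod.measurable_iff.1 measurable_Y ⊤) ?_)).2 hYT⟩
  · rw [Measure.map_map (measurable_fst.prodMk measurable_A) measurable_LAY]
    exact hadm
  · exact Finset.measurable_fun_sum _ fun i _ => measurable_integral_dMeasure measurable_A
      (y := fun τ => τ.2.2) (fun τ => τ.2.2.2) (Skorokhod.measurable_iff.1 measurable_Y) i i
  · exact measurableSet_integrable (measurable_grad_comp_of_mem c.h_measurable
      (measurable_uncurry_skorokhod (L := fun τ : Triple T d k => τ.1) measurable_fst)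
      (measurable_uncurry_incSkorokhod measurable_A) (fun p => p.1.2.1.mem_orthant _)
      hh).stronglyMeasurable
  · exact (CostData.measurable_grad_g_top hg
      (Skorokhod.measurable_iff.1 (measurable_fst (α := Skorokhod T d)) ⊤)
      (IncSkorokhod.measurable_iff.1 measurable_A ⊤)).const_add _

end Transfer

end Law

section Solution

variable {T : ℝ} [Fact (0 < T)] {d k : ℕ} {P₀ : Measure (Skorokhod T d)} {c : CostData T d k}
  {Φg Φh : E d → ℝ≥0} {M : ℝ≥0}

section Terminal

variable {Ω : Type*} {mΩ : MeasurableSpace Ω} {P : Measure Ω} [IsFiniteMeasure P]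
  {f : Filtration (Time T) mΩ} {L : Ω → Skorokhod T d} {A : Ω → IncSkorokhod T k}
  {Y : Ω → Skorokhod T k}

theorem CostData.FiniteCost.ae_eq_terminal (hfin : c.FiniteCost P L A) (hg : IsC1InControl c.g)
    (hh : IsC1InControl c.h) (hΦ : c.IntegrableGrowth P L Φg Φh M)
    (hL : ∀ t, Measurable[f t] fun ω => L ω t) (hA : ∀ t, Measurable[f t] fun ω => A ω t)
    (hY : ∀ i, (fun ω => Y ω ⊤ i) =ᵐ[P] P[fun ω => c.marginalCost (L ω) (A ω) ⊤ i | f ⊤]) :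
    ∀ᵐ ω ∂P, Y ω ⊤ = c.f ⊤ + grad c.g (L ω ⊤) (A ω ⊤) := by
  have measurable_L := Skorokhod.measurable_iff.2 fun t => (hL t).mono (f.le t) le_rfl
  have measurable_A := IncSkorokhod.measurable_iff.2 fun t => (hA t).mono (f.le t) le_rfl
  have measurable_marginalCost (i : Fin k) :
      Measurable[f ⊤] fun ω => c.marginalCost (L ω) (A ω) ⊤ i := by
    simp_rw [CostData.marginalCost_top]
    exact (@measurable_euclidean_iff _ _ (f ⊤) _).1
      ((@CostData.measurable_grad_g_top T _ d k Ω (f ⊤) c hg L A (hL ⊤) (hA ⊤)).const_add _) i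
  have coord_eq (i : Fin k) : ∀ᵐ ω ∂P, Y ω ⊤ i = c.marginalCost (L ω) (A ω) ⊤ i := by
    have Y_eq := hY i
    rwa [condExp_of_stronglyMeasurable (f.le ⊤) (measurable_marginalCost i).stronglyMeasurable
      (integrable_piLp_iff.1
        (hfin.integrable_marginalCost hg hh hΦ measurable_L measurable_A ⊤) i)] at Y_eq
  filter_upwards [ae_all_iff.2 coord_eq] with ω hω
  rw [← CostData.marginalCost_top]
  ext i
  exact hω i

end Terminal

variable {P : Measure (Pair T d k)} {A : Pair T d k → IncSkorokhod T k}

theorem CostData.GradientGrowth.exists_integrableGrowth (hgrowth : c.GradientGrowth P₀)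
    (hP : Admissible P₀ P) : ∃ Φg Φh M, c.IntegrableGrowth P Prod.fst Φg Φh M := by
  have := hP.isProbabilityMeasure
  obtain ⟨Φg, Φh, M, hΦg, hΦh, lintegral_lt_top, g_le, h_le⟩ := hgrowth
  have measurable_Φg : Measurable fun L : Skorokhod T d => Φg (L ⊤) :=
    hΦg.comp (Skorokhod.measurable_eval ⊤)
  have measurable_Φh : Measurable fun p : Skorokhod T d × Time T => Φh (p.1 p.2) :=
    hΦh.comp (measurable_uncurry_skorokhod measurable_id)
  have measurable_Φg_pair : Measurable fun ω : Pair T d k => Φg (ω.1 ⊤) :=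
    measurable_Φg.comp measurable_fst
  have measurable_Φh_pair : Measurable fun p : Pair T d k × Time T => Φh (p.1.1 p.2) :=
    measurable_Φh.comp ((measurable_fst.comp measurable_fst).prodMk measurable_snd)
  have measurable_lintegral : Measurable fun L : Skorokhod T d =>
      (∫⁻ t, (Φh (L t) : ℝ≥0∞) ∂leb T) + Φg (L ⊤) :=
    measurable_Φh.coe_nnreal_ennreal.lintegral_prod_right'.add measurable_Φg.coe_nnreal_ennreal
  rw [← hP.marginal, lintegral_map measurable_lintegral measurable_fst, lintegral_add_right _
    measurable_Φg_pair.coe_nnreal_ennreal, ENNReal.add_lt_top] at lintegral_lt_top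
  refine ⟨Φg, Φh, M, ?_, ?_, g_le, h_le⟩
  · refine integrable_of_lintegral_ofReal_ne_top measurable_Φg_pair.coe_nnreal_real
      (fun _ => NNReal.coe_nonneg _) ?_
    simp only [ENNReal.ofReal_coe_nnreal]
    exact lintegral_lt_top.2.ne
  · refine integrable_of_lintegral_ofReal_ne_top measurable_Φh_pair.coe_nnreal_real
      (fun _ => NNReal.coe_nonneg _) ?_
    simp only [ENNReal.ofReal_coe_nnreal]
    rw [lintegral_prod _ measurable_Φh_pair.coe_nnreal_ennreal.aemeasurable]
    exact lintegral_lt_top.1.ne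

theorem exists_solution_of_optimal (hg : IsC1InControl c.g) (hh : IsC1InControl c.h)
    (hP : Admissible P₀ P) (hΦ : c.IntegrableGrowth P Prod.fst Φg Φh M) (hA : IsControl P A)
    (hfin : c.controlCost P A < ∞)
    (hopt : ∀ b, IsControl P b → c.controlCost P A ≤ c.controlCost P b) :
    ∃ Q : Measure (Triple T d k), IsPontryaginSolution c P₀ Q := by
  have := hP.isProbabilityMeasure
  have hL := measurable_fst_eval_augFiltration P
  have finiteCost := c.finiteCost measurable_fst hA.measurable hfin
  obtain ⟨Y, hY, Y_eq, martingale_Y⟩ := finiteCost.exists_dual_process hg hh hΦ hL hA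
    fun t _ => measurableSet_augFiltration_of_null t
  have integrable_Γ := finiteCost.integrable_marginalCost hg hh hΦ measurable_fst hA.measurable
  obtain ⟨B, hB, norm_Γ_le⟩ :=
    finiteCost.exists_norm_marginalCost_le hg hh hΦ measurable_fst hA.measurable
  have integrable_grad := finiteCost.ae_integrable_grad_h hh hΦ measurable_fst hA.measurable
  have isCadlag_Γ : ∀ᵐ ω ∂P, IsCadlag (c.marginalCost ω.1 (A ω)) :=
    integrable_grad.mono fun ω hω => isCadlag_of_continuous (CostData.continuous_marginalCost hω)
  have Y_nonneg := ae_nonneg_of_condExp integrable_Γ Y_eq fun t G hG i =>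
    setIntegral_marginalCost_nonneg hg hh hΦ hA hfin hopt hG i
  have integral_trunc_eq_zero : ∀ᵐ ω ∂P, ∀ n : ℕ,
      ∑ i, ∫ t, Y ω t i ∂(((A ω).trunc n).dMeasure i) = 0 :=
    ae_all_iff.2 fun n => ae_sum_integral_dMeasure_eq_zero (hA.trunc n)
      (fun ω i => min_le_right _ _) integrable_Γ Y_eq Y_nonneg isCadlag_Γ hB norm_Γ_le
      (Skorokhod.measurable_iff.2 fun t => (hY t).mono ((augFiltration P).le t) le_rfl)
      (integral_marginalCost_trunc_nonpos hg hh hΦ hA hfin hopt n)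
  have integral_eq_zero : ∀ᵐ ω ∂P, ∑ i, ∫ t, Y ω t i ∂((A ω).dMeasure i) = 0 := by
    filter_upwards [integral_trunc_eq_zero] with ω hω
    obtain ⟨n, trunc_eq⟩ := (A ω).exists_trunc_eq
    exact trunc_eq ▸ hω n
  exact ⟨_, isPontryaginSolution_map hL hA hY hg hh (hA.admissible_map hP) Y_nonneg
    integral_eq_zero integrable_grad martingale_Y
    (finiteCost.ae_eq_terminal hg hh hΦ hL hA (Y_eq ⊤))⟩

end Solution

end

end MonotoneFollower

open MonotoneFollower in
theorem corollary2p11 (T : ℝ) [Fact (0 < T)] (d k : ℕ)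
    (P₀ : MeasureTheory.Measure (Skorokhod T d)) [MeasureTheory.IsProbabilityMeasure P₀]
    (c : CostData T d k)
    (hg : IsC1InControl c.g) (hh : IsC1InControl c.h)
    (hcoercive : c.LinearlyCoercive P₀)
    (hgrowth : c.GradientGrowth P₀)
    (hvalue : c.value P₀ < ⊤) :
    ∃ Q : MeasureTheory.Measure (Triple T d k), IsPontryaginSolution c P₀ Q := by
  obtain ⟨P, hP⟩ := iInf_lt_iff.1 hvalue
  obtain ⟨hadm, hfin⟩ := iInf_lt_iff.1 hP
  obtain ⟨Φg, Φh, M, hΦ⟩ := hgrowth.exists_integrableGrowth hadm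
  obtain ⟨A, hA, hcost, hopt⟩ := exists_optimal_control hg hh hcoercive hadm hfin
  exact exists_solution_of_optimal hg hh hadm hΦ hA hcost hopt
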